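/- \textbf{Setting.} Let $\mathscr X$ be a Banach space, let $L$ be the generator of a strongly continuous semigroup on $\mathscr X$ (Assumption 1), let $t_0<T$, and let $u:[t_0,T]\to\mathscr X$ solve $u'(t)=f(u(t))=Lu(t)+N(u(t))$, $u(t_0)=u_0$ (with $u(t)\in D(L)$). Assume that $u$ and $N:\mathscr X\to\mathscr X$ are sufficiently smooth, $N$ in a strip $\{v:\operatorname{dist}(v,u([t_0,T]))<\delta\}$, $\delta>0$ (Assumption 2): for part (a) it suffices that $u$ is $C^4$ on $[t_0,T]$ and $N$ is $C^3$ in the strip; for parts (b), (c) that both are $C^5$. For $t\in[t_0,T]$ write $\tilde u=u(t)$, $\tilde u^{(k)}=u^{(k)}(t)$, $\tilde J=L+N'(\tilde u)$, $\tilde N(v)=N(v)-N'(\tilde u)v$, and $\partial^k\tilde N=\partial^k\tilde N(\tilde u)$. The operator $\tilde J$ generates a strongly continuous semigroup $e^{\tau\tilde J}$; for $k\ge 1$, $\tau\ge0$ put $\varphi_k(\tau\tilde J)=\int_0^1 e^{\tau(1-\theta)\tilde J}\frac{\theta^{k-1}}{(k-1)!}\,d\theta$. An $s$-stage EPIRK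 method is given by real coefficients $\alpha_{ij},\beta_j,p_{ijk}$ and $g_{ij}\ge 0$. Put $\psi_{ij}(z)=\sum_{k=1}^{K}p_{ijk}\varphi_k(z)$, $\mathbb P_{il}=\sum_{k=1}^{K}\frac{p_{i1k}}{(k+l-1)!}$ $(l=1,2,3)$, $$a_{ij}(z)=\sum_{k=j}^{i-1}(-1)^{k-j}\tbinom{k-1}{j-1}\alpha_{ik}\psi_{ik}(g_{ik}z),\qquad b_j(z)=\sum_{k=j}^{s}(-1)^{k-j}\tbinom{k-1}{j-1}\beta_k\psi_{s+1,k}(g_{s+1,k}z).$$ One step of size $h>0$ from the exact value $\tilde u$ is, for $i=2,\dots,s$, $$\widehat U_i=\tilde u+\alpha_{i1}\psi_{i1}(g_{i1}h\tilde J)hf(\tilde u)+h\sum_{j=2}^{i-1}a_{ij}(h\tilde J)\hat r_j,\qquad \hat r_j=\tilde N(\widehat U_j)-\tilde N(\tilde u),$$ $$\hat u=\tilde u+\beta_1\psi_{s+1,1}(g_{s+1,1}h\tilde J)hf(\tilde u)+h\sum_{i=2}^{s}b_i(h\tilde J)\hat r_i.$$ Let $V_i=\frac1h(\widehat U_i-\tilde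 u)$ and $\tilde e=\hat u-u(t+h)$. Below, $\mathcal O(h^m)$ denotes a term of norm at most $Ch^m$ for all $0<h\le h_0$, with $C$ and $h_0>0$ independent of $h$ and of $t\in[t_0,T]$ (with $t+h\le T$ in (b), (c)). \textbf{(a)} For $i=2,\dots,s$, $$V_i=\alpha_{i1}\mathbb P_{i1}\tilde u'+h\,\alpha_{i1}g_{i1}\mathbb P_{i2}\tilde u''+h^2\alpha_{i1}g_{i1}^2\mathbb P_{i3}\tilde u'''+h^2\,\Psi_i(h\tilde J)\,\partial^2\tilde N(\tilde u',\tilde u')+\mathcal O(h^3),$$ $$\Psi_i(z)=\frac1{2!}\sum_{j=2}^{i-1}\alpha_{j1}^2\mathbb P_{j1}^2a_{ij}(z)-\alpha_{i1}g_{i1}^2\sum_{k=1}^{K}p_{i1k}\varphi_{k+2}(g_{i1}z).$$ \textbf{(b)} With $b_i=b_i(h\tilde J)$, $\varphi_k=\varphi_k(h\tilde J)$ and $\sum=\sum_{i=2}^s$, the local error satisfies $$\begin{aligned}\tilde e={}&h\big(\beta_1\psi_{s+1,1}(g_{s+1,1}h\tilde J)-\varphi_1\big)f(\tilde u)+h^3\Big(\sum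 \tfrac{\alpha_{i1}^2\mathbb P_{i1}^2}{2!}b_i-\varphi_3\Big)\partial^2\tilde N(\tilde u',\tilde u')\\ &+h^4\Big(\sum \alpha_{i1}^2g_{i1}\mathbb P_{i1}\mathbb P_{i2}b_i-3\varphi_4\Big)\partial^2\tilde N(\tilde u',\tilde u'')+h^4\Big(\sum\tfrac{\alpha_{i1}^3\mathbb P_{i1}^3}{3!}b_i-\varphi_4\Big)\partial^3\tilde N(\tilde u',\tilde u',\tilde u')\\ &+h^5\Big(\sum \alpha_{i1}^2g_{i1}^2\mathbb P_{i1}\mathbb P_{i3}b_i-4\varphi_5\Big)\partial^2\tilde N(\tilde u',\tilde u''')+h^5\Big(\sum\tfrac{\alpha_{i1}^2g_{i1}^2\mathbb P_{i2}^2}{2!}b_i-3\varphi_5\Big)\partial^2\tilde N(\tilde u'',\tilde u'')\\ &+h^5\Big(\sum\tfrac{\alpha_{i1}^3g_{i1}\mathbb P_{i1}^2\mathbb P_{i2}}{2!}b_i-6\varphi_5\Big)\partial^3\tilde N(\tilde u',\tilde u',\tilde u'')+h^5\Big(\sum\tfrac{\alpha_{i1}^4\mathbb P_{i1}^4}{4!}b_i-\varphi_5\Big)\partial^4\tilde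 N(\tilde u',\tilde u',\tilde u',\tilde u')\\ &+h^5\sum\alpha_{i1}\mathbb P_{i1}\,b_i\,\partial^2\tilde N\big(\tilde u',\Psi_i(h\tilde J)\partial^2\tilde N(\tilde u',\tilde u')\big)+\mathcal O(h^6).\end{aligned}$$ \textbf{(c)} Consequently, if $\beta_1\psi_{s+1,1}(g_{s+1,1}Z)=\varphi_1(Z)$ for all real square matrices $Z$, then $\tilde e=\mathcal O(h^3)$. If in addition, for all real square matrices $Z,Q$ of equal size, (C1) holds, then $\tilde e=\mathcal O(h^4)$; if (C1)--(C3) hold, then $\tilde e=\mathcal O(h^5)$; and if (C1)--(C8) hold, then $\tilde e=\mathcal O(h^6)$, where (C1) $\sum b_i(Z)\alpha_{i1}^2\mathbb P_{i1}^2=2\varphi_3(Z)$; (C2) $\sum b_i(Z)\alpha_{i1}^2g_{i1}\mathbb P_{i1}\mathbb P_{i2}=3\varphi_4(Z)$; (C3) $\sum b_i(Z)\alpha_{i1}^3\mathbb P_{i1}^3=3!\,\varphi_4(Z)$; (C4) $\sum b_i(Z)\alpha_{i1}^2g_{i1}^2\mathbb P_{i1}\mathbb P_{i3}=4\varphi_5(Z)$;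 (C5) $\sum b_i(Z)\alpha_{i1}^2g_{i1}^2\mathbb P_{i2}^2=3!\,\varphi_5(Z)$; (C6) $\sum b_i(Z)\alpha_{i1}^3g_{i1}\mathbb P_{i1}^2\mathbb P_{i2}=12\varphi_5(Z)$; (C7) $\sum b_i(Z)\alpha_{i1}^4\mathbb P_{i1}^4=4!\,\varphi_5(Z)$; (C8) $\sum b_i(Z)\,\alpha_{i1}\mathbb P_{i1}\,Q\,\Psi_i(Z)=0$. -/

import Mathlib

open Set Filter Topology

noncomputable section

namespace StiffEPIRK

variable {X : Type*} [NormedAddCommGroup X] [NormedSpace ℝ X]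

/-! ### Strongly continuous semigroups and their generators -/

/-- `S` (restricted to `t ≥ 0`) is a strongly continuous semigroup of bounded operators. -/
structure IsC0Semigroup (S : ℝ → X →L[ℝ] X) : Prop where
  map_zero : S 0 = 1
  map_add : ∀ s t : ℝ, 0 ≤ s → 0 ≤ t → S (s + t) = S s * S t
  continuousOn : ∀ x : X, ContinuousOn (fun t => S t x) (Ici 0)

/-- The (in general unbounded) operator `A` is the infinitesimal generator of the strongly
continuous semigroup `S`: its graph consists of all `(x, y)` such that
`(S t x - x) / t → y` as `t ↓ 0`. -/
structure IsGenerator (A : X →ₗ.[ℝ] X) (S : ℝ → X →L[ℝ] X) : Prop where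
  semigroup : IsC0Semigroup S
  mem_graph_iff : ∀ x y : X, (x, y) ∈ A.graph ↔
    Tendsto (fun t : ℝ => t⁻¹ • (S t x - x)) (𝓝[>] 0) (𝓝 y)

open Classical in
/-- The semigroup `t ↦ e^{tA}` generated by `A` (and `0` if `A` generates no strongly continuous
semigroup). -/
def expSemigroup (A : X →ₗ.[ℝ] X) : ℝ → X →L[ℝ] X :=
  if hA : ∃ S, IsGenerator A S then hA.choose else 0

/-- The operator `φ_k(tA)`, where `S` is the semigroup generated by `A`:
`φ_0(tA) = e^{tA}` and, for `k ≥ 1`,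
`φ_k(tA) x = ∫_0^1 (θ^{k-1} / (k-1)!) e^{t(1-θ)A} x dθ`. -/
def phi (S : ℝ → X →L[ℝ] X) : ℕ → ℝ → X → X
  | 0, t, x => S t x
  | k + 1, t, x => ∫ θ in (0 : ℝ)..1, (θ ^ k / (k.factorial : ℝ)) • S (t * (1 - θ)) x

/-! ### The initial value problem `u' = f(u) = L u + N(u)` -/

open Classical in
/-- The right-hand side `f(v) = L v + N(v)`, for `v` in the domain of `L` (and `0` otherwise). -/
def rhs (L : X →ₗ.[ℝ] X) (N : X → X) (v : X) : X :=
  if hv : v ∈ L.domain then L ⟨v, hv⟩ + N v else 0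

/-- `u` solves `u' = L u + N(u)`, `u(t₀) = u₀`, on `[t₀, T]`. -/
structure IsSolution (L : X →ₗ.[ℝ] X) (N : X → X) (t₀ T : ℝ) (u₀ : X) (u : ℝ → X) : Prop where
  initial : u t₀ = u₀
  mem_domain : ∀ t ∈ Icc t₀ T, u t ∈ L.domain
  hasDeriv : ∀ t ∈ Icc t₀ T, HasDerivWithinAt u (rhs L N (u t)) (Icc t₀ T) t

/-- The strip of radius `δ` along the trajectory `u([t₀, T])`. -/
def strip (t₀ T : ℝ) (u : ℝ → X) (δ : ℝ) : Set X := Metric.thickening δ (u '' Icc t₀ T)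

/-- The Jacobian `J(v) = L + N'(v)`, with the domain of `L`. -/
def jacobian (L : X →ₗ.[ℝ] X) (N : X → X) (v : X) : X →ₗ.[ℝ] X :=
  (fderiv ℝ N v : X →ₗ[ℝ] X) +ᵥ L

/-- The nonlinearity `w ↦ N(w) - N'(v) w` left over after linearization at `v`. -/
def Ntilde (N : X → X) (v : X) : X → X := fun w => N w - fderiv ℝ N v w

/-! ### EPIRK methods -/

/-- The coefficients of an `s`-stage EPIRK method, where
`ψ_{ij}(z) = ∑_{k=1}^K p_{ijk} φ_k(z)`. The entries that are used are `α i j`, `g i j`, `p i j k`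
with `1 ≤ j < i`, and row `s + 1` of `g` and `p` belongs to the final update. -/
structure Method where
  s : ℕ
  K : ℕ
  α : ℕ → ℕ → ℝ
  β : ℕ → ℝ
  g : ℕ → ℕ → ℝ
  p : ℕ → ℕ → ℕ → ℝ
  g_nonneg : ∀ i j, 0 ≤ g i j

namespace Method

/-- `ℙ_{i,l} = ∑_{k=1}^K p_{i1k} / (k + l - 1)!` (used for `l = 1, 2, 3`). -/
def P (M : Method) (i l : ℕ) : ℝ :=
  ∑ k ∈ Finset.Icc 1 M.K, M.p i 1 k / ((k + l - 1).factorial : ℝ)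

/-- The operator `ψ_{ij}(g_{ij} h A)`, where `S` is the semigroup generated by `A`. -/
def psi (M : Method) (S : ℝ → X →L[ℝ] X) (h : ℝ) (i j : ℕ) (x : X) : X :=
  ∑ k ∈ Finset.Icc 1 M.K, M.p i j k • phi S k (M.g i j * h) x

/-- The operator `a_{ij}(hA)`, with
`a_{ij}(z) = ∑_{k=j}^{i-1} (-1)^{k-j} (k-1 choose j-1) α_{ik} ψ_{ik}(g_{ik} z)`. This collects the
contributions of `r(U_j)` to the forward differences
`Δ^{(k-1)} r = ∑_{j=2}^{k} (-1)^{k-j} (k-1 choose j-1) r(U_j)`. -/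
def a (M : Method) (S : ℝ → X →L[ℝ] X) (h : ℝ) (i j : ℕ) (x : X) : X :=
  ∑ k ∈ Finset.Ico j i,
    ((-1 : ℝ) ^ (k - j) * ((k - 1).choose (j - 1) : ℝ) * M.α i k) • M.psi S h i k x

/-- The operator `b_j(hA)`, with
`b_j(z) = ∑_{k=j}^{s} (-1)^{k-j} (k-1 choose j-1) β_k ψ_{s+1,k}(g_{s+1,k} z)`. -/
def b (M : Method) (S : ℝ → X →L[ℝ] X) (h : ℝ) (j : ℕ) (x : X) : X :=
  ∑ k ∈ Finset.Icc j M.s,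
    ((-1 : ℝ) ^ (k - j) * ((k - 1).choose (j - 1) : ℝ) * M.β k) • M.psi S h (M.s + 1) k x

/-- The operator `Ψ_i(hA)`, with
`Ψ_i(z) = (1/2) ∑_{j=2}^{i-1} α_{j1}² ℙ_{j1}² a_{ij}(z)
  - α_{i1} g_{i1}² ∑_{k=1}^K p_{i1k} φ_{k+2}(g_{i1} z)`. -/
def Psi (M : Method) (S : ℝ → X →L[ℝ] X) (h : ℝ) (i : ℕ) (x : X) : X :=
  (1 / 2 : ℝ) • ∑ j ∈ Finset.Ico 2 i, (M.α j 1 ^ 2 * M.P j 1 ^ 2) • M.a S h i j x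
    - (M.α i 1 * M.g i 1 ^ 2) •
      ∑ k ∈ Finset.Icc 1 M.K, M.p i 1 k • phi S (k + 2) (M.g i 1 * h) x

/-- The internal stages of one step of size `h` from `v`:
`U_i = v + α_{i1} ψ_{i1}(g_{i1} h A) h F + h ∑_{j=2}^{i-1} a_{ij}(hA) (R(U_j) - R(v))`,
where `S` is the semigroup generated by `A`. -/
def stage (M : Method) (S : ℝ → X →L[ℝ] X) (h : ℝ) (F : X) (R : X → X) (v : X) (i : ℕ) : X :=
  v + (M.α i 1 * h) • M.psi S h i 1 F
    + h • ∑ j ∈ (Finset.Ico 2 i).attach,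
        M.a S h i j.1 (R (M.stage S h F R v j.1) - R v)
termination_by i
decreasing_by exact (Finset.mem_Ico.mp j.2).2

section AlongSolution

variable (M : Method) (L : X →ₗ.[ℝ] X) (N : X → X) (u : ℝ → X) (t h : ℝ)

/-- The semigroup `τ ↦ e^{τ J̃}` with `J̃ = L + N'(u(t))`. -/
def expJ (L : X →ₗ.[ℝ] X) (N : X → X) (u : ℝ → X) (t : ℝ) : ℝ → X →L[ℝ] X :=
  expSemigroup (jacobian L N (u t))

/-- The stages `Û_i` of one step of size `h` that starts from the exact value `u(t)`. -/
def Uhat (i : ℕ) : X :=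
  M.stage (expJ L N u t) h (rhs L N (u t)) (Ntilde N (u t)) (u t) i

/-- `r̂_i = Ñ(Û_i) - Ñ(u(t))`. -/
def rhat (i : ℕ) : X :=
  Ntilde N (u t) (M.Uhat L N u t h i) - Ntilde N (u t) (u t)

/-- The normalized stage increments `V_i = (Û_i - u(t)) / h`. -/
def V (i : ℕ) : X := h⁻¹ • (M.Uhat L N u t h i - u t)

/-- The numerical solution after one step of size `h` that starts from the exact value `u(t)`. -/
def uhatNext : X :=
  u t + (M.β 1 * h) • M.psi (expJ L N u t) h (M.s + 1) 1 (rhs L N (u t))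
    + h • ∑ i ∈ Finset.Icc 2 M.s, M.b (expJ L N u t) h i (M.rhat L N u t h i)

/-- The local error `û(t + h) - u(t + h)`. -/
def localError : X := M.uhatNext L N u t h - u (t + h)

end AlongSolution

/-- The principal part of the local error, in terms of the semigroup `S` generated by `J̃`, the
value `F = f(ũ)`, the derivatives `u₁, u₂, u₃` of the solution and the derivatives
`D₂, D₃, D₄` of `Ñ` at `ũ`. -/
def localErrorPrincipal (M : Method) (S : ℝ → X →L[ℝ] X) (h : ℝ) (F u₁ u₂ u₃ : X)
    (D₂ : (Fin 2 → X) → X) (D₃ : (Fin 3 → X) → X) (D₄ : (Fin 4 → X) → X) : X :=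
  h • (M.β 1 • M.psi S h (M.s + 1) 1 F - phi S 1 h F)
  + h ^ 3 • (∑ i ∈ Finset.Icc 2 M.s,
        (M.α i 1 ^ 2 * M.P i 1 ^ 2 / 2) • M.b S h i (D₂ ![u₁, u₁])
      - phi S 3 h (D₂ ![u₁, u₁]))
  + h ^ 4 • (∑ i ∈ Finset.Icc 2 M.s,
        (M.α i 1 ^ 2 * M.g i 1 * M.P i 1 * M.P i 2) • M.b S h i (D₂ ![u₁, u₂])
      - (3 : ℝ) • phi S 4 h (D₂ ![u₁, u₂]))
  + h ^ 4 • (∑ i ∈ Finset.Icc 2 M.s,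
        (M.α i 1 ^ 3 * M.P i 1 ^ 3 / 6) • M.b S h i (D₃ ![u₁, u₁, u₁])
      - phi S 4 h (D₃ ![u₁, u₁, u₁]))
  + h ^ 5 • (∑ i ∈ Finset.Icc 2 M.s,
        (M.α i 1 ^ 2 * M.g i 1 ^ 2 * M.P i 1 * M.P i 3) • M.b S h i (D₂ ![u₁, u₃])
      - (4 : ℝ) • phi S 5 h (D₂ ![u₁, u₃]))
  + h ^ 5 • (∑ i ∈ Finset.Icc 2 M.s,
        (M.α i 1 ^ 2 * M.g i 1 ^ 2 * M.P i 2 ^ 2 / 2) • M.b S h i (D₂ ![u₂, u₂])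
      - (3 : ℝ) • phi S 5 h (D₂ ![u₂, u₂]))
  + h ^ 5 • (∑ i ∈ Finset.Icc 2 M.s,
        (M.α i 1 ^ 3 * M.g i 1 * M.P i 1 ^ 2 * M.P i 2 / 2) • M.b S h i (D₃ ![u₁, u₁, u₂])
      - (6 : ℝ) • phi S 5 h (D₃ ![u₁, u₁, u₂]))
  + h ^ 5 • (∑ i ∈ Finset.Icc 2 M.s,
        (M.α i 1 ^ 4 * M.P i 1 ^ 4 / 24) • M.b S h i (D₄ ![u₁, u₁, u₁, u₁])
      - phi S 5 h (D₄ ![u₁, u₁, u₁, u₁]))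
  + h ^ 5 • ∑ i ∈ Finset.Icc 2 M.s,
        (M.α i 1 * M.P i 1) • M.b S h i (D₂ ![u₁, M.Psi S h i (D₂ ![u₁, u₁])])

/-! ### The stiff order conditions, for arbitrary square matrices `Z` and `Q` -/

/-- The semigroup `t ↦ e^{tZ}` on `ℝ^m` of a square matrix `Z`. -/
def matExp {m : ℕ} (Z : Matrix (Fin m) (Fin m) ℝ) (t : ℝ) : (Fin m → ℝ) →L[ℝ] (Fin m → ℝ) :=
  LinearMap.toContinuousLinearMap (Matrix.toLin' (NormedSpace.exp (t • Z)))

/-- `∑_{i=2}^s c_i b_i(Z) = d φ_k(Z)` for all square matrices `Z`. -/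
def QuadratureCondition (M : Method) (c : ℕ → ℝ) (d : ℝ) (k : ℕ) : Prop :=
  ∀ (m : ℕ) (Z : Matrix (Fin m) (Fin m) ℝ) (x : Fin m → ℝ),
    ∑ i ∈ Finset.Icc 2 M.s, c i • M.b (matExp Z) 1 i x = d • phi (matExp Z) k 1 x

/-- `β_1 ψ_{s+1,1}(g_{s+1,1} Z) = φ_1(Z)`. -/
def C0 (M : Method) : Prop :=
  ∀ (m : ℕ) (Z : Matrix (Fin m) (Fin m) ℝ) (x : Fin m → ℝ),
    M.β 1 • M.psi (matExp Z) 1 (M.s + 1) 1 x = phi (matExp Z) 1 1 x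

def C1 (M : Method) : Prop :=
  M.QuadratureCondition (fun i => M.α i 1 ^ 2 * M.P i 1 ^ 2) 2 3

def C2 (M : Method) : Prop :=
  M.QuadratureCondition (fun i => M.α i 1 ^ 2 * M.g i 1 * M.P i 1 * M.P i 2) 3 4

def C3 (M : Method) : Prop :=
  M.QuadratureCondition (fun i => M.α i 1 ^ 3 * M.P i 1 ^ 3) 6 4

def C4 (M : Method) : Prop :=
  M.QuadratureCondition (fun i => M.α i 1 ^ 2 * M.g i 1 ^ 2 * M.P i 1 * M.P i 3) 4 5

def C5 (M : Method) : Prop :=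
  M.QuadratureCondition (fun i => M.α i 1 ^ 2 * M.g i 1 ^ 2 * M.P i 2 ^ 2) 6 5

def C6 (M : Method) : Prop :=
  M.QuadratureCondition (fun i => M.α i 1 ^ 3 * M.g i 1 * M.P i 1 ^ 2 * M.P i 2) 12 5

def C7 (M : Method) : Prop :=
  M.QuadratureCondition (fun i => M.α i 1 ^ 4 * M.P i 1 ^ 4) 24 5

/-- `∑_{i=2}^s α_{i1} ℙ_{i1} b_i(Z) Q Ψ_i(Z) = 0` for all square matrices `Z`, `Q`. -/
def C8 (M : Method) : Prop :=
  ∀ (m : ℕ) (Z Q : Matrix (Fin m) (Fin m) ℝ) (x : Fin m → ℝ),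
    ∑ i ∈ Finset.Icc 2 M.s,
      (M.α i 1 * M.P i 1) • M.b (matExp Z) 1 i (Q.mulVec (M.Psi (matExp Z) 1 i x)) = 0

/-- The method satisfies the stiff order conditions up to order `q` (for `2 ≤ q ≤ 5`). -/
def StiffOrder (M : Method) (q : ℕ) : Prop :=
  M.C0 ∧ (3 ≤ q → M.C1) ∧ (4 ≤ q → M.C2 ∧ M.C3) ∧
    (5 ≤ q → M.C4 ∧ M.C5 ∧ M.C6 ∧ M.C7 ∧ M.C8)

end Method

end StiffEPIRK

end

/-!
The Jacobians `J̃ = L + N'(u(t))` are bounded perturbations of `L`, uniformly in `t ∈ [t₀, T]`, so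
they generate semigroups with a common exponential bound. All `φ`-functions of `h J̃` are therefore
bounded uniformly in `t` and in small `h`. In the expansion of the stages in powers of `h` the only
unbounded terms are `J̃ u^{(k)}`; the differentiated equation
`u^{(k+1)} = J̃ u^{(k)} + (Ñ ∘ u)^{(k)}` converts them into derivatives of `u` and of `Ñ`. The
local error formula is the difference between the resulting expansion of the numerical solution and
that of the exact flow, which comes from the variation of constants formula.

The order conditions are identities between matrix functions, but are needed for operators `h J̃`
that have no functional calculus beyond the semigroup. Every function involved is a combination of
`z ↦ φ_k(g z)` with `g ≥ 0`, hence the Laplace transform of a compactly supported signed measure on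
`[0, ∞)`. The case of `1 × 1` matrices determines this measure, and the operator is its integral
against the semigroup; condition (C8) is reduced to scalars by testing `2 × 2` matrices with
`Z = diag(z, w)` and `Q = E₁₂`.
-/

noncomputable section

namespace StiffEPIRK

open scoped NNReal

variable {X : Type*} [NormedAddCommGroup X] [NormedSpace ℝ X]

/-! ### Strongly continuous semigroups -/

theorem hasDerivWithinAt_Ioi_iff_tendsto {f : ℝ → X} {f' : X} {a : ℝ} :
    HasDerivWithinAt f f' (Ioi a) a ↔
      Tendsto (fun t : ℝ => t⁻¹ • (f (a + t) - f a)) (𝓝[>] 0) (𝓝 f') := by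
  have hmap : map (fun t => a + t) (𝓝[>] (0 : ℝ)) = 𝓝[>] a := by simp [map_add_left_nhdsGT]
  rw [hasDerivWithinAt_iff_tendsto_slope' (by simp), ← hmap, tendsto_map'_iff]
  simp [Function.comp_def, slope_def_module]

theorem intervalIntegrable_of_continuousOn_Icc {E : Type*} [NormedAddCommGroup E] {f : ℝ → E}
    {a b : ℝ} (hab : a ≤ b) (hf : ContinuousOn f (Icc a b)) :
    IntervalIntegrable f MeasureTheory.volume a b :=
  ContinuousOn.intervalIntegrable (by rwa [uIcc_of_le hab])

namespace IsC0Semigroup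

variable {S : ℝ → X →L[ℝ] X}

theorem map_add_apply (hS : IsC0Semigroup S) {s t : ℝ} (hs : 0 ≤ s) (ht : 0 ≤ t) (x : X) :
    S (s + t) x = S s (S t x) := by
  rw [hS.map_add s t hs ht]
  rfl

theorem phi_zero_time [CompleteSpace X] (hS : IsC0Semigroup S) (k : ℕ) (x : X) :
    phi S (k + 1) 0 x = (((k + 1).factorial : ℝ)⁻¹) • x := by
  have hk : ((k : ℝ) + 1) ≠ 0 := by positivity
  simp only [phi, zero_mul, hS.map_zero, one_apply_eq_self]
  rw [intervalIntegral.integral_smul_const, intervalIntegral.integral_div, integral_pow,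
    Nat.factorial_succ, Nat.cast_mul]
  congr 1
  push_cast
  field_simp
  simp

variable [CompleteSpace X]

theorem exists_norm_le (hS : IsC0Semigroup S) (b : ℝ) : ∃ C, ∀ t ∈ Icc 0 b, ‖S t‖ ≤ C := by
  obtain ⟨C, hC⟩ := banach_steinhaus (g := fun t : Icc (0 : ℝ) b => S t) (fun x => by
    obtain ⟨C, hC⟩ := isCompact_Icc.exists_bound_of_continuousOn
      ((hS.continuousOn x).mono fun t (ht : t ∈ Icc (0 : ℝ) b) => ht.1)
    exact ⟨C, fun t => hC t t.2⟩)
  exact ⟨C, fun t ht => hC ⟨t, ht⟩⟩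

omit [CompleteSpace X] in
theorem norm_natCast_add_le (hS : IsC0Semigroup S) {C : ℝ}
    (hC : ∀ t ∈ Icc (0 : ℝ) 1, ‖S t‖ ≤ C) (n : ℕ) {r : ℝ} (hr : r ∈ Icc (0 : ℝ) 1) :
    ‖S (n + r)‖ ≤ C ^ (n + 1) := by
  induction n with
  | zero => simpa using hC r hr
  | succ n ih =>
    have hnr : (0 : ℝ) ≤ n + r := add_nonneg n.cast_nonneg hr.1
    calc ‖S ((n + 1 : ℕ) + r)‖ = ‖S 1 * S (n + r)‖ := by
          rw [← hS.map_add 1 _ zero_le_one hnr]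
          congr 2
          push_cast
          ring
      _ ≤ ‖S 1‖ * ‖S (n + r)‖ := norm_mul_le _ _
      _ ≤ C * C ^ (n + 1) := by
          have := hC 1 (by simp)
          gcongr
          exact (norm_nonneg _).trans this
      _ = C ^ (n + 1 + 1) := by ring

theorem exists_norm_le_exp (hS : IsC0Semigroup S) :
    ∃ C ω : ℝ, 1 ≤ C ∧ 0 ≤ ω ∧ ∀ t, 0 ≤ t → ‖S t‖ ≤ C * Real.exp (ω * t) := by
  obtain ⟨C₀, hC₀⟩ := hS.exists_norm_le 1
  set C := max C₀ 1
  have hC1 : 1 ≤ C := le_max_right _ _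
  have hC : ∀ t ∈ Icc (0 : ℝ) 1, ‖S t‖ ≤ C := fun t ht => (hC₀ t ht).trans (le_max_left _ _)
  refine ⟨C, Real.log C, hC1, Real.log_nonneg hC1, fun t ht => ?_⟩
  have hfloor := Nat.floor_le ht
  have hfract : t - ⌊t⌋₊ ∈ Icc (0 : ℝ) 1 :=
    ⟨by linarith, by linarith [Nat.lt_floor_add_one t]⟩
  calc ‖S t‖ = ‖S (⌊t⌋₊ + (t - ⌊t⌋₊))‖ := by rw [add_sub_cancel]
    _ ≤ C ^ (⌊t⌋₊ + 1) := hS.norm_natCast_add_le hC _ hfract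
    _ = C * Real.exp (Real.log C * ⌊t⌋₊) := by
        rw [mul_comm (Real.log C), Real.exp_nat_mul, Real.exp_log (by linarith), pow_succ']
    _ ≤ C * Real.exp (Real.log C * t) := by
        have := Real.log_nonneg hC1
        gcongr

theorem continuous_uncurry (hS : IsC0Semigroup S) :
    Continuous fun p : ℝ≥0 × X => S p.1 p.2 := by
  rw [continuous_iff_continuousAt]
  rintro ⟨t, x⟩
  obtain ⟨C, hC⟩ := hS.exists_norm_le (t + 1)
  refine (continuousOn_prod_of_continuousOn_lipschitzOnWith' (fun p : ℝ≥0 × X => S p.1 p.2)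
    C.toNNReal (s := Iio (t + 1)) (t := univ) (fun r hr => ?_) fun y _ => ?_).continuousAt
    (prod_mem_nhds (Iio_mem_nhds (lt_add_one t)) univ_mem)
  · refine ((S r).lipschitz.weaken ?_).lipschitzOnWith
    rw [← NNReal.coe_le_coe, coe_nnnorm]
    exact (hC r ⟨r.2, by exact_mod_cast hr.le⟩).trans (Real.le_coe_toNNReal C)
  · exact ((hS.continuousOn y).comp_continuous NNReal.continuous_coe fun r => r.2).continuousOn

variable {Y : Type*}

theorem continuous_apply [TopologicalSpace Y] (hS : IsC0Semigroup S) {a : Y → ℝ≥0} {w : Y → X}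
    (ha : Continuous a) (hw : Continuous w) : Continuous fun y => S (a y) (w y) :=
  hS.continuous_uncurry.comp (ha.prodMk hw)

theorem continuousOn_apply [TopologicalSpace Y] (hS : IsC0Semigroup S) {a : Y → ℝ} {w : Y → X}
    {s : Set Y} (ha : ContinuousOn a s) (hw : ContinuousOn w s) (h0 : ∀ y ∈ s, 0 ≤ a y) :
    ContinuousOn (fun y => S (a y) (w y)) s :=
  (hS.continuous_uncurry.comp_continuousOn
    ((continuous_real_toNNReal.comp_continuousOn ha).prodMk hw)).congr
    fun y hy => by simp [max_eq_left (h0 y hy)]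

theorem tendsto_apply (hS : IsC0Semigroup S) {l : Filter Y} {a : Y → ℝ} {w : Y → X}
    {a₀ : ℝ} {w₀ : X} (ha : Tendsto a l (𝓝 a₀)) (hw : Tendsto w l (𝓝 w₀))
    (h0 : ∀ᶠ y in l, 0 ≤ a y) (ha₀ : 0 ≤ a₀) :
    Tendsto (fun y => S (a y) (w y)) l (𝓝 (S a₀ w₀)) := by
  have hlim := (hS.continuous_uncurry.tendsto (a₀.toNNReal, w₀)).comp
    ((tendsto_real_toNNReal ha).prodMk_nhds hw)
  simp only [Real.coe_toNNReal _ ha₀] at hlim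
  refine hlim.congr' ?_
  filter_upwards [h0] with y hy
  simp [max_eq_left hy]

theorem intervalIntegrable_convolution (hS : IsC0Semigroup S) {w : ℝ → X} {t : ℝ} (ht : 0 ≤ t)
    (hw : ContinuousOn w (Icc 0 t)) :
    IntervalIntegrable (fun s => S (t - s) (w s)) MeasureTheory.volume 0 t :=
  intervalIntegrable_of_continuousOn_Icc ht <|
    hS.continuousOn_apply (by fun_prop) hw fun _ hs => sub_nonneg.2 hs.2

theorem continuous_phi (hS : IsC0Semigroup S) (k : ℕ) :
    Continuous fun p : ℝ≥0 × X => phi S (k + 1) p.1 p.2 := by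
  have heq (p : ℝ≥0 × X) : phi S (k + 1) p.1 p.2
      = ∫ θ in (0 : ℝ)..1,
          (θ ^ k / (k.factorial : ℝ)) • S (p.1 * (1 - θ).toNNReal : ℝ≥0) p.2 :=
    intervalIntegral.integral_congr fun θ hθ => by
      rw [uIcc_of_le zero_le_one] at hθ
      simp [max_eq_left (sub_nonneg.2 hθ.2)]
  simp_rw [heq]
  refine intervalIntegral.continuous_parametric_intervalIntegral_of_continuous'
    (f := fun (p : ℝ≥0 × X) θ =>
      (θ ^ k / (k.factorial : ℝ)) • S (p.1 * (1 - θ).toNNReal : ℝ≥0) p.2) ?_ 0 1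
  exact Continuous.smul (by fun_prop)
    (hS.continuous_apply (a := fun q : (ℝ≥0 × X) × ℝ => q.1.1 * (1 - q.2).toNNReal)
      (by fun_prop) (by fun_prop))

theorem tendsto_phi_one (hS : IsC0Semigroup S) (x : X) :
    Tendsto (fun h => phi S 1 h x) (𝓝[>] 0) (𝓝 x) := by
  have hc : Continuous fun h : ℝ => phi S 1 h.toNNReal x :=
    (hS.continuous_phi 0).comp (by fun_prop : Continuous fun h : ℝ => (h.toNNReal, x))
  have hlim := hc.tendsto 0
  simp only [Real.toNNReal_zero, NNReal.coe_zero, hS.phi_zero_time] at hlim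
  simp only [zero_add, Nat.factorial_one, Nat.cast_one, inv_one, one_smul] at hlim
  refine (hlim.mono_left nhdsWithin_le_nhds).congr' ?_
  filter_upwards [self_mem_nhdsWithin] with h hh
  rw [Real.coe_toNNReal h (le_of_lt hh)]

end IsC0Semigroup

theorem integral_pow_smul_eq_phi (S : ℝ → X →L[ℝ] X) (k : ℕ) (h : ℝ) (x : X) :
    ∫ τ in (0 : ℝ)..h, S (h - τ) ((τ ^ k / (k.factorial : ℝ)) • x)
      = h ^ (k + 1) • phi S (k + 1) h x := by
  have hscale := intervalIntegral.smul_integral_comp_mul_left (E := X)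
    (fun τ : ℝ => S (h - τ) ((τ ^ k / (k.factorial : ℝ)) • x)) h (a := 0) (b := 1)
  rw [mul_zero, mul_one] at hscale
  rw [← hscale, phi, pow_succ', mul_smul, ← intervalIntegral.integral_smul (h ^ k)]
  congr 1
  refine intervalIntegral.integral_congr fun θ _ => ?_
  simp only [map_smul, smul_smul]
  congr 1
  · ring
  · congr 2
    ring

theorem smul_phi_one_eq_integral (S : ℝ → X →L[ℝ] X) (h : ℝ) (x : X) :
    h • phi S 1 h x = ∫ s in (0 : ℝ)..h, S s x := by
  have hphi := integral_pow_smul_eq_phi S 0 h x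
  have hreflect := intervalIntegral.integral_comp_sub_left (fun s => S s x) h (a := 0) (b := h)
  simp only [pow_zero, Nat.factorial_zero, Nat.cast_one, div_one, one_smul, zero_add, pow_one]
    at hphi
  rw [← hphi, hreflect, sub_self, sub_zero]

namespace IsGenerator

variable {A : X →ₗ.[ℝ] X} {S : ℝ → X →L[ℝ] X}

theorem mem_graph_iff_hasDerivWithinAt (hA : IsGenerator A S) {x y : X} :
    (x, y) ∈ A.graph ↔ HasDerivWithinAt (fun t => S t x) y (Ioi 0) 0 := by
  rw [hA.mem_graph_iff, hasDerivWithinAt_Ioi_iff_tendsto]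
  simp [hA.semigroup.map_zero]

theorem apply_mem_graph (hA : IsGenerator A S) {x y : X} (hxy : (x, y) ∈ A.graph) {t : ℝ}
    (ht : 0 ≤ t) : (S t x, S t y) ∈ A.graph := by
  rw [hA.mem_graph_iff] at hxy ⊢
  refine (((S t).continuous.tendsto y).comp hxy).congr' ?_
  filter_upwards [self_mem_nhdsWithin] with r (hr : 0 < r)
  simp [← hA.semigroup.map_add_apply ht hr.le, ← hA.semigroup.map_add_apply hr.le ht, add_comm]

theorem hasDerivWithinAt_orbit (hA : IsGenerator A S) {x y : X} (hxy : (x, y) ∈ A.graph) {t : ℝ}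
    (ht : 0 ≤ t) : HasDerivWithinAt (fun s => S s x) (S t y) (Ioi t) t := by
  rw [hasDerivWithinAt_Ioi_iff_tendsto]
  refine (((S t).continuous.tendsto y).comp ((hA.mem_graph_iff x y).1 hxy)).congr' ?_
  filter_upwards [self_mem_nhdsWithin] with r (hr : 0 < r)
  simp [hA.semigroup.map_add_apply ht hr.le]

variable [CompleteSpace X]

theorem hasDerivWithinAt_apply_sub (hA : IsGenerator A S) {h τ : ℝ} (hτ : τ < h) {w : ℝ → X}
    {y z : X} (hy : (w τ, y) ∈ A.graph) (hw : HasDerivWithinAt w (y + z) (Ioi τ) τ) :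
    HasDerivWithinAt (fun σ => S (h - σ) (w σ)) (S (h - τ) z) (Ioi τ) τ := by
  have hS := hA.semigroup
  rw [hasDerivWithinAt_Ioi_iff_tendsto] at hw ⊢
  have hsmall : ∀ᶠ σ in 𝓝[>] (0 : ℝ), σ ∈ Ioo 0 (h - τ) := Ioo_mem_nhdsGT (sub_pos.2 hτ)
  have htime : Tendsto (fun σ => h - (τ + σ)) (𝓝[>] 0) (𝓝 (h - τ)) := by
    refine tendsto_nhdsWithin_of_tendsto_nhds ?_
    exact Continuous.tendsto' (by fun_prop) _ _ (by ring)
  have hlim := hS.tendsto_apply htime (hw.sub ((hA.mem_graph_iff _ _).1 hy))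
    (by filter_upwards [hsmall] with σ hσ; linarith [hσ.2]) (by linarith)
  rw [add_sub_cancel_left] at hlim
  refine hlim.congr' ?_
  filter_upwards [hsmall] with σ hσ
  have hsplit : S (h - τ) (w τ) = S (h - (τ + σ)) (S σ (w τ)) := by
    rw [← hS.map_add_apply (by linarith [hσ.2]) hσ.1.le]
    congr 2
    ring
  rw [hsplit, ← smul_sub, ← map_sub, map_smul]
  congr 2
  abel

theorem variation_of_constants (hA : IsGenerator A S) {h : ℝ} (hh : 0 ≤ h) {w F : ℝ → X}
    (hw : ContinuousOn w (Icc 0 h)) (hF : ContinuousOn F (Icc 0 h))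
    (hd : ∀ τ ∈ Ioo 0 h, ∃ y, (w τ, y) ∈ A.graph ∧ HasDerivWithinAt w (y + F τ) (Ioi τ) τ) :
    w h = S h (w 0) + ∫ τ in (0 : ℝ)..h, S (h - τ) (F τ) := by
  have hS := hA.semigroup
  rw [intervalIntegral.integral_eq_sub_of_hasDeriv_right_of_le (f := fun τ => S (h - τ) (w τ)) hh
    (hS.continuousOn_apply (by fun_prop) hw fun τ hτ => sub_nonneg.2 hτ.2) (fun τ hτ => ?_)
    (hS.intervalIntegrable_convolution hh hF)]
  · simp [hS.map_zero]
  · obtain ⟨y, hy, hdw⟩ := hd τ hτ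
    exact hA.hasDerivWithinAt_apply_sub hτ.2 hy hdw

theorem phi_eq_add_smul_phi_succ (hA : IsGenerator A S) {x y : X} (hxy : (x, y) ∈ A.graph)
    (k : ℕ) {h : ℝ} (hh : 0 ≤ h) :
    phi S (k + 1) h x = ((k + 1).factorial : ℝ)⁻¹ • x + h • phi S (k + 2) h y := by
  have hS := hA.semigroup
  rcases hh.eq_or_lt with rfl | hpos
  · rw [hS.phi_zero_time, zero_smul, add_zero]
  -- Variation of constants for `w τ = (τ ^ (k + 1) / (k + 1)!) • x`, which solves `w' = A w + F`.
  have hvoc := hA.variation_of_constants hh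
    (w := fun τ => (τ ^ (k + 1) / ((k + 1).factorial : ℝ)) • x)
    (F := fun τ => (τ ^ k / (k.factorial : ℝ)) • x
      - (τ ^ (k + 1) / ((k + 1).factorial : ℝ)) • y) (by fun_prop) (by fun_prop) fun τ _ => by
      refine ⟨(τ ^ (k + 1) / ((k + 1).factorial : ℝ)) • y, A.graph.smul_mem _ hxy, ?_⟩
      rw [add_sub_cancel]
      have hk : (k : ℝ) + 1 ≠ 0 := by positivity
      refine (((hasDerivAt_pow (k + 1) τ).div_const _).congr_deriv ?_).smul_const x
        |>.hasDerivWithinAt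
      rw [Nat.factorial_succ, Nat.add_sub_cancel]
      push_cast
      field_simp
  have hint (j : ℕ) (z : X) := hS.intervalIntegrable_convolution hh
    (w := fun τ => (τ ^ j / (j.factorial : ℝ)) • z) (by fun_prop)
  simp only [map_sub] at hvoc
  rw [intervalIntegral.integral_sub (hint _ _) (hint _ _), integral_pow_smul_eq_phi S k,
    integral_pow_smul_eq_phi S (k + 1), zero_pow k.succ_ne_zero, zero_div, zero_smul, map_zero,
    zero_add] at hvoc
  refine smul_right_injective X (pow_ne_zero (k + 1) hpos.ne') ?_
  dsimp only
  rw [smul_add, smul_smul, smul_smul, ← pow_succ, ← div_eq_mul_inv, hvoc, sub_add_cancel]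

theorem sub_eq_smul_phi_one (hA : IsGenerator A S) {x y : X} (hxy : (x, y) ∈ A.graph) {h : ℝ}
    (hh : 0 ≤ h) : S h x - x = h • phi S 1 h y := by
  have hderiv := intervalIntegral.integral_eq_sub_of_hasDeriv_right_of_le hh
    ((hA.semigroup.continuousOn x).mono Icc_subset_Ici_self)
    (fun s hs => hA.hasDerivWithinAt_orbit hxy hs.1.le)
    (intervalIntegrable_of_continuousOn_Icc hh
      ((hA.semigroup.continuousOn y).mono Icc_subset_Ici_self))
  rw [smul_phi_one_eq_integral, hderiv, hA.semigroup.map_zero, one_apply_eq_self]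

/-! ### Generators are closed, densely defined and determine their semigroups -/

theorem mem_graph_of_tendsto (hA : IsGenerator A S) {ι : Type*} {l : Filter ι} [l.NeBot]
    {x y : ι → X} {x₀ y₀ : X} (hxy : ∀ᶠ i in l, (x i, y i) ∈ A.graph)
    (hx : Tendsto x l (𝓝 x₀)) (hy : Tendsto y l (𝓝 y₀)) : (x₀, y₀) ∈ A.graph := by
  have hlimit : ∀ h : ℝ≥0, S h x₀ - x₀ = h • phi S 1 h y₀ := by
    intro h
    have hphi : Tendsto (fun i => phi S 1 h (y i)) l (𝓝 (phi S 1 h y₀)) :=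
      ((hA.semigroup.continuous_phi 0).tendsto (h, y₀)).comp (tendsto_const_nhds.prodMk_nhds hy)
    refine tendsto_nhds_unique ((((S h).continuous.tendsto x₀).comp hx).sub hx)
      ((hphi.const_smul h).congr' ?_)
    filter_upwards [hxy] with i hi
    exact (hA.sub_eq_smul_phi_one hi h.2).symm
  rw [hA.mem_graph_iff]
  refine (hA.semigroup.tendsto_phi_one y₀).congr' ?_
  filter_upwards [self_mem_nhdsWithin] with h (hh : 0 < h)
  have hlimit_h : S h x₀ - x₀ = h • phi S 1 h y₀ := hlimit ⟨h, hh.le⟩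
  rw [hlimit_h, inv_smul_smul₀ hh.ne']

theorem integral_orbit_mem_graph (hA : IsGenerator A S) (x : X) {ε : ℝ} (hε : 0 ≤ ε) :
    (∫ s in (0 : ℝ)..ε, S s x, S ε x - x) ∈ A.graph := by
  have hS := hA.semigroup
  set f : ℝ → X := fun s => S s.toNNReal x
  have hf : Continuous f := hS.continuous_apply (by fun_prop) continuous_const
  have hfS : ∀ s, 0 ≤ s → f s = S s x := fun s hs => by simp [f, max_eq_left hs]
  have hprim (a : ℝ) : HasDerivAt (fun t => ∫ s in (0 : ℝ)..t, f s) (f a) a :=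
    (hf.integral_hasStrictDerivAt 0 a).hasDerivAt
  have hshift : ∀ t, 0 ≤ t → S t (∫ s in (0 : ℝ)..ε, S s x)
      = (∫ s in (0 : ℝ)..(ε + t), f s) - ∫ s in (0 : ℝ)..t, f s := by
    intro t ht
    rw [intervalIntegral.integral_interval_sub_left (hf.intervalIntegrable _ _)
      (hf.intervalIntegrable _ _), ← (S t).intervalIntegral_comp_comm
      (intervalIntegrable_of_continuousOn_Icc hε ((hS.continuousOn x).mono Icc_subset_Ici_self))]
    have htranslate := intervalIntegral.integral_comp_add_left f t (a := 0) (b := ε)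
    rw [add_zero, add_comm t ε] at htranslate
    rw [← htranslate]
    refine intervalIntegral.integral_congr fun s hs => ?_
    rw [uIcc_of_le hε] at hs
    rw [hfS _ (add_nonneg ht hs.1), hS.map_add_apply ht hs.1]
  have hderiv := ((hprim (ε + 0)).comp_const_add ε 0).sub (hprim 0)
  rw [add_zero, hfS ε hε, hfS 0 le_rfl, hS.map_zero, one_apply_eq_self] at hderiv
  rw [hA.mem_graph_iff_hasDerivWithinAt]
  exact hderiv.hasDerivWithinAt.congr (fun t ht => hshift t (le_of_lt ht)) (hshift 0 le_rfl)

theorem dense_domain (hA : IsGenerator A S) : Dense (A.domain : Set X) := by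
  intro x
  refine mem_closure_of_tendsto (hA.semigroup.tendsto_phi_one x) ?_
  filter_upwards [self_mem_nhdsWithin] with h (hh : 0 < h)
  rw [SetLike.mem_coe]
  have hmem : h • phi S 1 h x ∈ A.domain := by
    rw [smul_phi_one_eq_integral]
    exact LinearPMap.mem_domain_of_mem_graph (hA.integral_orbit_mem_graph x hh.le)
  simpa only [inv_smul_smul₀ hh.ne'] using A.domain.smul_mem h⁻¹ hmem

theorem semigroup_unique {S' : ℝ → X →L[ℝ] X} (hA : IsGenerator A S) (hA' : IsGenerator A S')
    {t : ℝ} (ht : 0 ≤ t) : S t = S' t := by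
  refine ContinuousLinearMap.coeFn_injective
    ((S t).continuous.ext_on hA.dense_domain (S' t).continuous fun x hx => ?_)
  have hxy : (x, A ⟨x, hx⟩) ∈ A.graph := A.mem_graph ⟨x, hx⟩
  have hvoc := hA.variation_of_constants ht (w := fun s => S' s x) (F := fun _ => 0)
    ((hA'.semigroup.continuousOn x).mono fun s hs => hs.1) continuousOn_const
    (fun τ hτ => ⟨S' τ (A ⟨x, hx⟩), hA'.apply_mem_graph hxy hτ.1.le, by
      simpa using hA'.hasDerivWithinAt_orbit hxy hτ.1.le⟩)
  simpa [hA'.semigroup.map_zero] using hvoc.symm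

end IsGenerator

/-! ### Bounded perturbations of generators -/

theorem mem_graph_vadd_iff {A : X →ₗ.[ℝ] X} {B : X →L[ℝ] X} {x y : X} :
    (x, y) ∈ ((B : X →ₗ[ℝ] X) +ᵥ A).graph ↔ (x, y - B x) ∈ A.graph := by
  simp only [LinearPMap.mem_graph_iff, LinearPMap.vadd_apply]
  constructor
  · rintro ⟨z, rfl, rfl⟩
    exact ⟨z, rfl, by simp⟩
  · rintro ⟨z, rfl, hz⟩
    exact ⟨z, rfl, by simp [hz]⟩

theorem IsGenerator.vadd_of_tendsto {A : X →ₗ.[ℝ] X} {S W : ℝ → X →L[ℝ] X}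
    (hA : IsGenerator A S) (hW : IsC0Semigroup W) (B : X →L[ℝ] X)
    (hB : ∀ x, Tendsto (fun t : ℝ => t⁻¹ • (W t x - S t x)) (𝓝[>] 0) (𝓝 (B x))) :
    IsGenerator ((B : X →ₗ[ℝ] X) +ᵥ A) W := by
  refine ⟨hW, fun x y => ?_⟩
  rw [mem_graph_vadd_iff, hA.mem_graph_iff]
  constructor
  · intro hS
    have hsum := hS.add (hB x)
    rw [sub_add_cancel] at hsum
    exact hsum.congr fun t => by rw [← smul_add, add_comm, sub_add_sub_cancel]
  · intro hWx
    exact (hWx.sub (hB x)).congr fun t => by rw [← smul_sub, sub_sub_sub_cancel_left, ← neg_sub,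
      neg_sub]

theorem IsGenerator.exp_smul {A : X →ₗ.[ℝ] X} {S : ℝ → X →L[ℝ] X} (hA : IsGenerator A S) (ν : ℝ) :
    IsGenerator (((ν • (1 : X →L[ℝ] X) : X →L[ℝ] X) : X →ₗ[ℝ] X) +ᵥ A)
      (fun t => Real.exp (ν * t) • S t) := by
  refine hA.vadd_of_tendsto ⟨?_, fun s t hs ht => ?_, fun x => ?_⟩ _ fun x => ?_
  · simp [hA.semigroup.map_zero]
  · rw [hA.semigroup.map_add s t hs ht, mul_add, Real.exp_add, smul_mul_smul_comm]
  · exact ContinuousOn.smul (by fun_prop) (hA.semigroup.continuousOn x)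
  · have hexp : HasDerivAt (fun t => Real.exp (ν * t)) ν 0 := by
      simpa using ((hasDerivAt_id (0 : ℝ)).const_mul ν).exp
    have hSx : Tendsto (fun t => S t x) (𝓝[>] 0) (𝓝 x) := by
      have hcont := (hA.semigroup.continuousOn x 0 self_mem_Ici).mono Ioi_subset_Ici_self
      simpa [ContinuousWithinAt, hA.semigroup.map_zero] using hcont
    refine (((hasDerivWithinAt_Ioi_iff_tendsto.1 hexp.hasDerivWithinAt).smul hSx)).congr fun t => ?_
    simp [smul_sub, sub_smul, mul_smul]

section MildSolution

open scoped BoundedContinuousFunction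

/-- A bounded mild solution of `v' = (A + B) v`, `v 0 = x`, in terms of the semigroup `S`
generated by `A`. -/
def IsMildSolution (S : ℝ → X →L[ℝ] X) (B : X →L[ℝ] X) (x : X) (v : ℝ≥0 →ᵇ X) : Prop :=
  ∀ t : ℝ≥0, v t = S t x + ∫ s in (0 : ℝ)..t, S (t - s) (B (v s.toNNReal))

theorem continuous_apply_toNNReal (B : X →L[ℝ] X) (v : ℝ≥0 →ᵇ X) :
    Continuous fun s : ℝ => B (v s.toNNReal) :=
  B.continuous.comp (v.continuous.comp continuous_real_toNNReal)

variable {S : ℝ → X →L[ℝ] X}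

theorem IsMildSolution.apply_zero (hS : IsC0Semigroup S) {B : X →L[ℝ] X} {x : X} {v : ℝ≥0 →ᵇ X}
    (hv : IsMildSolution S B x v) : v 0 = x := by
  simpa [hS.map_zero] using hv 0

variable [CompleteSpace X]

theorem IsMildSolution.shift (hS : IsC0Semigroup S) {B : X →L[ℝ] X} {x : X} {v : ℝ≥0 →ᵇ X}
    (hv : IsMildSolution S B x v) (t : ℝ≥0) :
    IsMildSolution S B (v t) (v.compContinuous ⟨fun r => r + t, by fun_prop⟩) := by
  intro r
  set w : ℝ → X := fun s => B (v s.toNNReal)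
  have hw : Continuous w := continuous_apply_toNNReal B v
  have hint : IntervalIntegrable (fun s => S (r + t - s) (w s)) MeasureTheory.volume 0 (r + t) :=
    hS.intervalIntegrable_convolution (by positivity) hw.continuousOn
  have ht : (t : ℝ) ∈ uIcc 0 (r + t : ℝ) := by
    rw [uIcc_of_le (by positivity)]
    exact ⟨t.coe_nonneg, le_add_of_nonneg_left r.coe_nonneg⟩
  have hpast : ∫ s in (0 : ℝ)..t, S (r + t - s) (w s)
      = S r (∫ s in (0 : ℝ)..t, S (t - s) (w s)) := by
    rw [← (S r).intervalIntegral_comp_comm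
      (hS.intervalIntegrable_convolution t.coe_nonneg hw.continuousOn)]
    refine intervalIntegral.integral_congr fun s hs => ?_
    rw [uIcc_of_le t.coe_nonneg] at hs
    rw [add_sub_assoc, hS.map_add_apply r.coe_nonneg (sub_nonneg.2 hs.2)]
  have hfuture : ∫ s in (t : ℝ)..(r + t), S (r + t - s) (w s)
      = ∫ s in (0 : ℝ)..r, S (r - s) (B (v (s.toNNReal + t))) := by
    have htranslate := intervalIntegral.integral_comp_add_right
      (fun s => S (r + t - s) (w s)) (t : ℝ) (a := 0) (b := r)
    rw [zero_add] at htranslate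
    rw [← htranslate]
    refine intervalIntegral.integral_congr fun s hs => ?_
    rw [uIcc_of_le r.coe_nonneg] at hs
    rw [add_sub_add_right_eq_sub]
    simp only [w]
    rw [Real.toNNReal_add hs.1 t.coe_nonneg, Real.toNNReal_coe]
  calc v (r + t) = S (r + t) x + ∫ s in (0 : ℝ)..(r + t), S (r + t - s) (w s) := hv (r + t)
    _ = S r (S t x + ∫ s in (0 : ℝ)..t, S (t - s) (w s))
          + ∫ s in (t : ℝ)..(r + t), S (r + t - s) (w s) := by
        rw [← intervalIntegral.integral_add_adjacent_intervals
          (hint.mono_set (uIcc_subset_uIcc_left ht)) (hint.mono_set (uIcc_subset_uIcc_right ht)),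
          hpast, map_add, hS.map_add_apply r.coe_nonneg t.coe_nonneg, add_assoc]
    _ = _ := by rw [← hv t, hfuture]; rfl

theorem IsMildSolution.tendsto (hS : IsC0Semigroup S) {B : X →L[ℝ] X} {x : X} {v : ℝ≥0 →ᵇ X}
    (hv : IsMildSolution S B x v) :
    Tendsto (fun t : ℝ => t⁻¹ • (v t.toNNReal - S t x)) (𝓝[>] 0) (𝓝 (B x)) := by
  set w : ℝ → X := fun s => B (v s.toNNReal)
  have hw : Continuous w := continuous_apply_toNNReal B v
  have hmean : Continuous fun t : ℝ => ∫ θ in (0 : ℝ)..1,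
      S (t * (1 - θ)).toNNReal (w (t * θ)) := by
    refine intervalIntegral.continuous_parametric_intervalIntegral_of_continuous'
      (f := fun (t : ℝ) θ => S (t * (1 - θ)).toNNReal (w (t * θ))) ?_ 0 1
    exact hS.continuous_apply (by fun_prop) (hw.comp (by fun_prop))
  have hlim := hmean.tendsto 0
  simp only [zero_mul, Real.toNNReal_zero, NNReal.coe_zero, hS.map_zero, one_apply_eq_self,
    intervalIntegral.integral_const, sub_zero, one_smul, w, hv.apply_zero hS] at hlim
  refine (hlim.mono_left nhdsWithin_le_nhds).congr' ?_
  filter_upwards [self_mem_nhdsWithin] with t (ht : 0 < t)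
  have hvt := hv t.toNNReal
  rw [Real.coe_toNNReal t ht.le] at hvt
  have hscale := intervalIntegral.smul_integral_comp_mul_left (E := X)
    (fun s => S (t - s) (w s)) t (a := 0) (b := 1)
  rw [mul_zero, mul_one] at hscale
  rw [hvt, add_sub_cancel_left, ← hscale, inv_smul_smul₀ ht.ne']
  refine intervalIntegral.integral_congr fun θ hθ => ?_
  rw [uIcc_of_le zero_le_one] at hθ
  have hθt : 0 ≤ t * (1 - θ) := mul_nonneg ht.le (sub_nonneg.2 hθ.2)
  rw [Real.coe_toNNReal _ hθt, mul_one_sub]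

theorem exists_orbit_clm (hS : IsC0Semigroup S) {C : ℝ} (hC : ∀ t, 0 ≤ t → ‖S t‖ ≤ C) :
    ∃ O : X →L[ℝ] ℝ≥0 →ᵇ X, ‖O‖ ≤ C ∧ ∀ x (t : ℝ≥0), O x t = S t x := by
  have hC0 : 0 ≤ C := (norm_nonneg _).trans (hC 0 le_rfl)
  have hbound (x : X) (t : ℝ≥0) : ‖S t x‖ ≤ C * ‖x‖ := (S t).le_of_opNorm_le (hC t t.coe_nonneg) x
  let O : X →ₗ[ℝ] ℝ≥0 →ᵇ X :=
    { toFun := fun x => .ofNormedAddCommGroup (fun t => S t x)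
        (hS.continuous_apply continuous_id continuous_const) (C * ‖x‖) (hbound x)
      map_add' := fun x y => by ext t; simp
      map_smul' := fun a x => by ext t; simp }
  exact ⟨O.mkContinuous C fun x => BoundedContinuousFunction.norm_ofNormedAddCommGroup_le _
    (by positivity) (hbound x), LinearMap.mkContinuous_norm_le _ hC0 _, fun _ _ => rfl⟩

theorem integral_exp_neg_le {c t : ℝ} (hc : 0 < c) :
    ∫ s in (0 : ℝ)..t, Real.exp (-c * (t - s)) ≤ c⁻¹ := by
  rw [intervalIntegral.integral_comp_sub_left (fun s => Real.exp (-c * s)),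
    intervalIntegral.integral_comp_mul_left _ (neg_ne_zero.2 hc.ne'), integral_exp]
  have : 0 ≤ c⁻¹ * Real.exp (-c * t) := by positivity
  simp only [sub_self, sub_zero, mul_zero, Real.exp_zero, smul_eq_mul, inv_neg]
  linarith

theorem continuous_convolution (hS : IsC0Semigroup S) {w : ℝ → X} (hw : Continuous w) :
    Continuous fun t : ℝ≥0 => ∫ s in (0 : ℝ)..t, S (t - s) (w s) := by
  have htrunc (t : ℝ≥0) : ∫ s in (0 : ℝ)..t, S (t - s) (w s)
      = ∫ s in (0 : ℝ)..t, S (t - s.toNNReal : ℝ≥0) (w s) :=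
    intervalIntegral.integral_congr fun s hs => by
      rw [uIcc_of_le t.coe_nonneg] at hs
      simp [NNReal.coe_sub (Real.toNNReal_le_iff_le_coe.2 hs.2), max_eq_left hs.1]
  simp_rw [htrunc]
  exact intervalIntegral.continuous_parametric_intervalIntegral_of_continuous
    (f := fun (t : ℝ≥0) (s : ℝ) => S (t - s.toNNReal : ℝ≥0) (w s))
    (hS.continuous_apply (by fun_prop) (by fun_prop)) (by fun_prop)

theorem exists_volterra_clm (hS : IsC0Semigroup S) {C c : ℝ} (hc : 0 < c)
    (hb : ∀ t, 0 ≤ t → ‖S t‖ ≤ C * Real.exp (-c * t)) (B : X →L[ℝ] X) :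
    ∃ K : (ℝ≥0 →ᵇ X) →L[ℝ] ℝ≥0 →ᵇ X, ‖K‖ ≤ C * ‖B‖ / c ∧
      ∀ v (t : ℝ≥0), K v t = ∫ s in (0 : ℝ)..t, S (t - s) (B (v s.toNNReal)) := by
  have hC0 : 0 ≤ C := by simpa using (norm_nonneg _).trans (hb 0 le_rfl)
  have hbound (v : ℝ≥0 →ᵇ X) (t : ℝ≥0) :
      ‖∫ s in (0 : ℝ)..t, S (t - s) (B (v s.toNNReal))‖ ≤ C * ‖B‖ / c * ‖v‖ := by
    calc _ ≤ ∫ s in (0 : ℝ)..t, C * ‖B‖ * ‖v‖ * Real.exp (-c * (t - s)) := by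
          refine intervalIntegral.norm_integral_le_of_norm_le t.coe_nonneg
            (.of_forall fun s hs => ?_)
            (Continuous.intervalIntegrable (by fun_prop) _ _)
          calc _ ≤ C * Real.exp (-c * (t - s)) * (‖B‖ * ‖v‖) :=
                (S (t - s)).le_of_opNorm_le_of_le (hb _ (sub_nonneg.2 hs.2))
                  (B.le_opNorm_of_le (v.norm_coe_le_norm _))
            _ = _ := by ring
      _ ≤ C * ‖B‖ * ‖v‖ * c⁻¹ := by
          rw [intervalIntegral.integral_const_mul]
          gcongr
          exact integral_exp_neg_le hc
      _ = _ := by ring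
  have hint (v : ℝ≥0 →ᵇ X) (t : ℝ≥0) := hS.intervalIntegrable_convolution t.coe_nonneg
    (continuous_apply_toNNReal B v).continuousOn
  let K : (ℝ≥0 →ᵇ X) →ₗ[ℝ] ℝ≥0 →ᵇ X :=
    { toFun := fun v => .ofNormedAddCommGroup
        (fun t => ∫ s in (0 : ℝ)..t, S (t - s) (B (v s.toNNReal)))
        (continuous_convolution hS (continuous_apply_toNNReal B v)) _ (hbound v)
      map_add' := fun v w => by
        ext t
        simpa using intervalIntegral.integral_add (hint v t) (hint w t)
      map_smul' := fun a v => by ext t; simp }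
  exact ⟨K.mkContinuous _ fun v => BoundedContinuousFunction.norm_ofNormedAddCommGroup_le _
    (by positivity) (hbound v), LinearMap.mkContinuous_norm_le _ (by positivity) _, fun _ _ => rfl⟩

theorem exists_mildSolution_clm (hS : IsC0Semigroup S) {C c : ℝ} (hc : 0 < c)
    (hb : ∀ t, 0 ≤ t → ‖S t‖ ≤ C * Real.exp (-c * t)) {B : X →L[ℝ] X} (hB : C * ‖B‖ ≤ c / 2) :
    ∃ Z : X →L[ℝ] ℝ≥0 →ᵇ X, (∀ x v, IsMildSolution S B x v ↔ v = Z x) ∧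
      ∀ x, ‖Z x‖ ≤ 2 * C * ‖x‖ := by
  have hC0 : 0 ≤ C := by simpa using (norm_nonneg _).trans (hb 0 le_rfl)
  obtain ⟨O, hO, hO_apply⟩ := exists_orbit_clm hS (C := C) fun t ht => (hb t ht).trans <|
    mul_le_of_le_one_right hC0 (Real.exp_le_one_iff.2 (by nlinarith))
  obtain ⟨K, hK, hK_apply⟩ := exists_volterra_clm hS hc hb B
  have hK_half : ‖K‖ ≤ 1 / 2 := hK.trans (by rw [div_le_iff₀ hc]; linarith)
  let U := Units.oneSub K (by linarith)
  have hU (v : ℝ≥0 →ᵇ X) : (U : (ℝ≥0 →ᵇ X) →L[ℝ] ℝ≥0 →ᵇ X) v = v - K v := rfl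
  let Z : X →L[ℝ] ℝ≥0 →ᵇ X := (↑U⁻¹ : (ℝ≥0 →ᵇ X) →L[ℝ] ℝ≥0 →ᵇ X) ∘L O
  have hUZ (x : X) : Z x - K (Z x) = O x := DFunLike.congr_fun U.mul_inv (O x)
  refine ⟨Z, fun x v => ?_, fun x => ?_⟩
  · have hfix : IsMildSolution S B x v ↔ v - K v = O x := by
      rw [sub_eq_iff_eq_add, DFunLike.ext_iff]
      simp only [IsMildSolution, BoundedContinuousFunction.coe_add, Pi.add_apply, hO_apply,
        hK_apply]
    rw [hfix, ← hU]
    refine ⟨fun hv => ?_, fun hv => hv ▸ hUZ x⟩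
    have hinv : (↑U⁻¹ : (ℝ≥0 →ᵇ X) →L[ℝ] ℝ≥0 →ᵇ X) ((U : (ℝ≥0 →ᵇ X) →L[ℝ] ℝ≥0 →ᵇ X) v) = v :=
      DFunLike.congr_fun U.inv_mul v
    rw [← hinv, hv]
    rfl
  · have hsum : ‖Z x‖ ≤ ‖O x‖ + ‖K (Z x)‖ := by
      rw [← hUZ x]
      exact norm_le_norm_sub_add _ _
    have hOx := O.le_of_opNorm_le hO x
    have hKx := K.le_of_opNorm_le hK_half (Z x)
    linarith

end MildSolution

namespace IsGenerator

variable [CompleteSpace X] {A : X →ₗ.[ℝ] X} {S : ℝ → X →L[ℝ] X}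

theorem exists_vadd_of_decay (hA : IsGenerator A S) {C c : ℝ} (hc : 0 < c)
    (hb : ∀ t, 0 ≤ t → ‖S t‖ ≤ C * Real.exp (-c * t)) {B : X →L[ℝ] X} (hB : C * ‖B‖ ≤ c / 2) :
    ∃ W, IsGenerator ((B : X →ₗ[ℝ] X) +ᵥ A) W ∧ ∀ t, ‖W t‖ ≤ 2 * C := by
  have hS := hA.semigroup
  have hC0 : 0 ≤ C := by simpa using (norm_nonneg _).trans (hb 0 le_rfl)
  obtain ⟨Z, hZ, hZ_norm⟩ := exists_mildSolution_clm hS hc hb hB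
  have hmild (x : X) : IsMildSolution S B x (Z x) := (hZ x _).2 rfl
  set W : ℝ → X →L[ℝ] X := fun t => BoundedContinuousFunction.evalCLM ℝ t.toNNReal ∘L Z
  have hW : IsC0Semigroup W := by
    refine ⟨?_, fun s t hs ht => ?_, fun x => ?_⟩
    · ext x
      simpa [W] using (hmild x).apply_zero hS
    · ext x
      have hshift := (hZ _ _).1 ((hmild x).shift hS t.toNNReal)
      simpa [W, Real.toNNReal_add hs ht] using DFunLike.congr_fun hshift s.toNNReal
    · exact ((Z x).continuous.comp continuous_real_toNNReal).continuousOn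
  refine ⟨W, hA.vadd_of_tendsto hW B fun x => (hmild x).tendsto hS, fun t => ?_⟩
  exact ContinuousLinearMap.opNorm_le_bound _ (by positivity) fun x =>
    ((Z x).norm_coe_le_norm _).trans (hZ_norm x)

theorem exists_vadd (hA : IsGenerator A S) (R : ℝ) :
    ∃ C ω : ℝ, 0 ≤ ω ∧ ∀ B : X →L[ℝ] X, ‖B‖ ≤ R →
      ∃ W, IsGenerator ((B : X →ₗ[ℝ] X) +ᵥ A) W ∧ ∀ t, 0 ≤ t → ‖W t‖ ≤ C * Real.exp (ω * t) := by
  obtain ⟨C, ω, hC, hω, hb⟩ := hA.semigroup.exists_norm_le_exp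
  -- The shift by `-ν` makes the semigroup decay fast enough for the Neumann series to converge.
  set c := 2 * C * (|R| + 1)
  set ν := ω + c
  have hc : 0 < c := by positivity
  have hdecay : ∀ t, 0 ≤ t → ‖Real.exp (-ν * t) • S t‖ ≤ C * Real.exp (-c * t) := by
    intro t ht
    calc ‖Real.exp (-ν * t) • S t‖ = Real.exp (-ν * t) * ‖S t‖ := by
          rw [norm_smul, Real.norm_of_nonneg (Real.exp_pos _).le]
      _ ≤ Real.exp (-ν * t) * (C * Real.exp (ω * t)) := by gcongr; exact hb t ht
      _ = C * Real.exp (-c * t) := by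
          rw [mul_left_comm, ← Real.exp_add]
          congr 2
          ring
  refine ⟨2 * C, ν, by positivity, fun B hB => ?_⟩
  obtain ⟨W, hW, hW_norm⟩ := (hA.exp_smul (-ν)).exists_vadd_of_decay hc hdecay (B := B) (by
    have hBR : ‖B‖ ≤ |R| + 1 := by linarith [le_abs_self R]
    calc C * ‖B‖ ≤ C * (|R| + 1) := by gcongr
      _ = c / 2 := by ring)
  refine ⟨fun t => Real.exp (ν * t) • W t, ?_, fun t _ => ?_⟩
  · convert hW.exp_smul ν using 1
    rw [vadd_vadd, vadd_vadd]
    congr 1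
    ext x
    simp
  · rw [norm_smul, Real.norm_of_nonneg (Real.exp_pos _).le, mul_comm]
    gcongr
    exact hW_norm t

end IsGenerator

/-! ### Linear combinations of the functions `z ↦ φ_k(g z)` -/

/-- A formal linear combination of the functions `z ↦ φ_{k+1}(g z)`, with `g ≥ 0`: the key
`(k, g)` stands for `z ↦ φ_{k+1}(g z)`. -/
abbrev Symbol : Type := (ℕ × ℝ≥0) →₀ ℝ

section SymInt

variable {E F : Type*} [NormedAddCommGroup E] [NormedSpace ℝ E] [NormedAddCommGroup F]
  [NormedSpace ℝ F]

/-- The integral of `f` against the compactly supported signed measure on `[0, ∞)` whose Laplace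
transform `∫ e^{rz} dμ(r)` is the function described by a symbol. -/
def symInt (f : ℝ → E) : Symbol →ₗ[ℝ] E :=
  Finsupp.linearCombination ℝ fun q : ℕ × ℝ≥0 =>
    ∫ θ in (0 : ℝ)..1, (θ ^ q.1 / (q.1.factorial : ℝ)) • f (q.2 * (1 - θ))

theorem symInt_single (f : ℝ → E) (q : ℕ × ℝ≥0) (c : ℝ) :
    symInt f (Finsupp.single q c)
      = c • ∫ θ in (0 : ℝ)..1, (θ ^ q.1 / (q.1.factorial : ℝ)) • f (q.2 * (1 - θ)) := by
  simp [symInt]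

theorem symInt_apply (f : ℝ → E) (σ : Symbol) :
    symInt f σ = ∑ q ∈ σ.support,
      σ q • ∫ θ in (0 : ℝ)..1, (θ ^ q.1 / (q.1.factorial : ℝ)) • f (q.2 * (1 - θ)) := by
  simp only [symInt, Finsupp.linearCombination_apply, Finsupp.sum]

theorem intervalIntegrable_symInt {f : ℝ → E} (hf : ContinuousOn f (Ici 0)) (k : ℕ) (g : ℝ≥0) :
    IntervalIntegrable (fun θ => (θ ^ k / (k.factorial : ℝ)) • f (g * (1 - θ)))
      MeasureTheory.volume 0 1 :=
  intervalIntegrable_of_continuousOn_Icc zero_le_one <| ContinuousOn.smul (by fun_prop) <|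
    hf.comp (by fun_prop) fun _ hθ => mul_nonneg g.coe_nonneg (sub_nonneg.2 hθ.2)

theorem symInt_fun_add {f f' : ℝ → E} (hf : ContinuousOn f (Ici 0)) (hf' : ContinuousOn f' (Ici 0))
    (σ : Symbol) : symInt (fun r => f r + f' r) σ = symInt f σ + symInt f' σ := by
  simp only [symInt_apply, ← Finset.sum_add_distrib, ← smul_add, ← intervalIntegral.integral_add
    (intervalIntegrable_symInt hf _ _) (intervalIntegrable_symInt hf' _ _)]

theorem clm_symInt [CompleteSpace E] [CompleteSpace F] (ℓ : E →L[ℝ] F) {f : ℝ → E}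
    (hf : ContinuousOn f (Ici 0)) (σ : Symbol) :
    ℓ (symInt f σ) = symInt (fun r => ℓ (f r)) σ := by
  simp only [symInt_apply, map_sum, map_smul,
    ← ℓ.intervalIntegral_comp_comm (intervalIntegrable_symInt hf _ _)]

theorem norm_integral_pow_smul_le {f : ℝ → E} {τ C : ℝ} (hτ : 0 ≤ τ)
    (hf : ∀ r ∈ Icc 0 τ, ‖f r‖ ≤ C) (k : ℕ) :
    ‖∫ θ in (0 : ℝ)..1, (θ ^ k / (k.factorial : ℝ)) • f (τ * (1 - θ))‖ ≤ C := by
  refine (intervalIntegral.norm_integral_le_of_norm_le_const (C := C) fun θ hθ => ?_).trans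
    (by simp)
  rw [uIoc_of_le zero_le_one] at hθ
  have hpow : θ ^ k / (k.factorial : ℝ) ≤ 1 := div_le_one_of_le₀
    ((pow_le_one₀ hθ.1.le hθ.2).trans (by exact_mod_cast k.factorial_pos)) (by positivity)
  have hfθ : ‖f (τ * (1 - θ))‖ ≤ C :=
    hf _ ⟨mul_nonneg hτ (sub_nonneg.2 hθ.2), mul_le_of_le_one_right hτ (by linarith [hθ.1])⟩
  rw [norm_smul, Real.norm_of_nonneg (div_nonneg (pow_nonneg hθ.1.le k) (by positivity))]
  exact (mul_le_of_le_one_left (norm_nonneg _) hpow).trans hfθ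

theorem exists_norm_symInt_le (σ : Symbol) :
    ∃ G D : ℝ, 0 ≤ D ∧ ∀ (f : ℝ → E) (C : ℝ), (∀ r ∈ Icc 0 G, ‖f r‖ ≤ C) →
      ‖symInt f σ‖ ≤ D * C := by
  obtain ⟨G, hG⟩ := (σ.support.image Prod.snd).exists_le
  refine ⟨G, ∑ q ∈ σ.support, |σ q|,
    Finset.sum_nonneg fun q _ => abs_nonneg _, fun f C hf => ?_⟩
  rw [symInt_apply, Finset.sum_mul]
  refine norm_sum_le_of_le _ fun q hq => ?_
  rw [norm_smul, Real.norm_eq_abs]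
  gcongr
  exact norm_integral_pow_smul_le q.2.coe_nonneg (fun r hr => hf r ⟨hr.1, hr.2.trans
    (NNReal.coe_le_coe.2 (hG _ (Finset.mem_image_of_mem _ hq)))⟩) q.1

end SymInt

/-- The value at `z` of the function described by a symbol. -/
def symEval (z : ℝ) : Symbol →ₗ[ℝ] ℝ := symInt fun r => Real.exp (r * z)

/-- The operator obtained by evaluating a symbol at `hA`, where `S` is the semigroup generated by
`A`. -/
def symOp (S : ℝ → X →L[ℝ] X) (h : ℝ) (σ : Symbol) (x : X) : X :=
  symInt (fun r => S (r * h) x) σ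

theorem symOp_single (S : ℝ → X →L[ℝ] X) (h : ℝ) (k : ℕ) (g : ℝ≥0) (c : ℝ) (x : X) :
    symOp S h (Finsupp.single (k, g) c) x = c • phi S (k + 1) (g * h) x := by
  simp only [symOp, symInt_single, phi, mul_right_comm]

/-- The symbol of `z ↦ φ_{k+1}(z)`. -/
def phiSym (k : ℕ) : Symbol := Finsupp.single (k, 1) 1

theorem symOp_phiSym (S : ℝ → X →L[ℝ] X) (h : ℝ) (k : ℕ) (x : X) :
    symOp S h (phiSym k) x = phi S (k + 1) h x := by
  simp [phiSym, symOp_single]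

theorem exists_norm_symOp_le (σ : Symbol) (C : ℝ) {ω : ℝ} (hω : 0 ≤ ω) :
    ∃ D, 0 ≤ D ∧ ∀ S : ℝ → X →L[ℝ] X, (∀ t, 0 ≤ t → ‖S t‖ ≤ C * Real.exp (ω * t)) →
      ∀ h ∈ Icc (0 : ℝ) 1, ∀ x, ‖symOp S h σ x‖ ≤ D * ‖x‖ := by
  obtain ⟨G, D, hD0, hD⟩ := exists_norm_symInt_le (E := X) σ
  refine ⟨D * (|C| * Real.exp (ω * G)), by positivity, fun S hS h hh x => ?_⟩
  rw [mul_assoc]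
  refine hD _ _ fun r hr => (S _).le_of_opNorm_le ((hS _ (mul_nonneg hr.1 hh.1)).trans ?_) x
  have hrh : r * h ≤ G := (mul_le_of_le_one_right hr.1 hh.2).trans hr.2
  gcongr
  exact le_abs_self C

section Linearity

variable [CompleteSpace X] {S : ℝ → X →L[ℝ] X} {h : ℝ}

theorem IsC0Semigroup.continuousOn_apply_mul (hS : IsC0Semigroup S) (hh : 0 ≤ h) (x : X) :
    ContinuousOn (fun r => S (r * h) x) (Ici 0) :=
  hS.continuousOn_apply (by fun_prop) continuousOn_const fun _ hr => mul_nonneg hr hh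

theorem exists_clm_symOp (hS : IsC0Semigroup S) (hh : 0 ≤ h) (σ : Symbol) :
    ∃ G : X →L[ℝ] X, ∀ x, G x = symOp S h σ x := by
  obtain ⟨G, D, -, hD⟩ := exists_norm_symInt_le (E := X) σ
  obtain ⟨C, hC⟩ := hS.exists_norm_le (G * h)
  let T : X →ₗ[ℝ] X :=
    { toFun := symOp S h σ
      map_add' := fun x y => by
        simp only [symOp, map_add]
        exact symInt_fun_add (hS.continuousOn_apply_mul hh x) (hS.continuousOn_apply_mul hh y) σ
      map_smul' := fun a x => by
        simp only [symOp, map_smul, RingHom.id_apply]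
        exact (clm_symInt (a • ContinuousLinearMap.id ℝ X) (hS.continuousOn_apply_mul hh x)
          σ).symm }
  refine ⟨T.mkContinuous (D * C) fun x => ?_, fun x => rfl⟩
  rw [mul_assoc]
  refine hD _ _ fun r hr => (S _).le_of_opNorm_le (hC _ ⟨mul_nonneg hr.1 hh, ?_⟩) x
  exact mul_le_mul_of_nonneg_right hr.2 hh

theorem symOp_map_add (hS : IsC0Semigroup S) (hh : 0 ≤ h) (σ : Symbol) (x y : X) :
    symOp S h σ (x + y) = symOp S h σ x + symOp S h σ y := by
  obtain ⟨G, hG⟩ := exists_clm_symOp hS hh σ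
  simp [← hG]

theorem symOp_map_sub (hS : IsC0Semigroup S) (hh : 0 ≤ h) (σ : Symbol) (x y : X) :
    symOp S h σ (x - y) = symOp S h σ x - symOp S h σ y := by
  obtain ⟨G, hG⟩ := exists_clm_symOp hS hh σ
  simp [← hG]

theorem symOp_map_smul (hS : IsC0Semigroup S) (hh : 0 ≤ h) (σ : Symbol) (c : ℝ) (x : X) :
    symOp S h σ (c • x) = c • symOp S h σ x := by
  obtain ⟨G, hG⟩ := exists_clm_symOp hS hh σ
  simp [← hG]

end Linearity

namespace Method

variable (M : Method)

/-- The symbol of `ψ_{ij}(g_{ij} z)`. -/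
def psiSym (i j : ℕ) : Symbol :=
  ∑ k ∈ Finset.Icc 1 M.K, M.p i j k • Finsupp.single (k - 1, ⟨M.g i j, M.g_nonneg i j⟩) 1

/-- The symbol of `a_{ij}(z)`. -/
def aSym (i j : ℕ) : Symbol :=
  ∑ k ∈ Finset.Ico j i,
    ((-1 : ℝ) ^ (k - j) * ((k - 1).choose (j - 1) : ℝ) * M.α i k) • M.psiSym i k

/-- The symbol of `b_j(z)`. -/
def bSym (j : ℕ) : Symbol :=
  ∑ k ∈ Finset.Icc j M.s,
    ((-1 : ℝ) ^ (k - j) * ((k - 1).choose (j - 1) : ℝ) * M.β k) • M.psiSym (M.s + 1) k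

/-- The symbol of `Ψ_i(z)`. -/
def PsiSym (i : ℕ) : Symbol :=
  (1 / 2 : ℝ) • ∑ j ∈ Finset.Ico 2 i, (M.α j 1 ^ 2 * M.P j 1 ^ 2) • M.aSym i j
    - (M.α i 1 * M.g i 1 ^ 2) •
      ∑ k ∈ Finset.Icc 1 M.K,
        M.p i 1 k • Finsupp.single (k + 1, ⟨M.g i 1, M.g_nonneg i 1⟩) 1

variable (S : ℝ → X →L[ℝ] X) (h : ℝ)

theorem symOp_psiSym (i j : ℕ) (x : X) : symOp S h (M.psiSym i j) x = M.psi S h i j x := by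
  simp only [symOp, psiSym, psi, map_sum, map_smul]
  refine Finset.sum_congr rfl fun k hk => ?_
  have hphi := symOp_single S h (k - 1) ⟨M.g i j, M.g_nonneg i j⟩ 1 x
  rw [Nat.sub_add_cancel (Finset.mem_Icc.1 hk).1, one_smul] at hphi
  exact congrArg _ hphi

theorem symOp_aSym (i j : ℕ) (x : X) : symOp S h (M.aSym i j) x = M.a S h i j x := by
  simp only [a, ← symOp_psiSym, symOp, aSym, map_sum, map_smul]

theorem symOp_bSym (j : ℕ) (x : X) : symOp S h (M.bSym j) x = M.b S h j x := by
  simp only [b, ← symOp_psiSym, symOp, bSym, map_sum, map_smul]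

theorem symOp_PsiSym (i : ℕ) (x : X) : symOp S h (M.PsiSym i) x = M.Psi S h i x := by
  have hphi (k : ℕ) : phi S (k + 2) (M.g i 1 * h) x
      = symOp S h (Finsupp.single (k + 1, ⟨M.g i 1, M.g_nonneg i 1⟩) 1) x :=
    ((symOp_single S h (k + 1) ⟨M.g i 1, M.g_nonneg i 1⟩ 1 x).trans (one_smul ℝ _)).symm
  simp only [Psi, ← symOp_aSym, hphi, symOp, PsiSym, map_sub, map_sum, map_smul]

end Method

/-! ### Transfer of scalar identities to semigroups -/

theorem symInt_eval_exp_neg {σ : Symbol} (hσ : ∀ z, symEval z σ = 0) (p : Polynomial ℝ) :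
    symInt (fun r => p.eval (Real.exp (-r))) σ = 0 := by
  induction p using Polynomial.induction_on' with
  | add p q hp hq =>
    simp only [Polynomial.eval_add]
    rw [symInt_fun_add (by fun_prop) (by fun_prop), hp, hq, add_zero]
  | monomial n a =>
    have hpow : (fun r => (Polynomial.monomial n a).eval (Real.exp (-r)))
        = fun r => (a • ContinuousLinearMap.id ℝ ℝ) (Real.exp (r * (-n))) := by
      funext r
      simp only [Polynomial.eval_monomial, ← Real.exp_nat_mul, FunLike.coe_smul, Pi.smul_apply,
        ContinuousLinearMap.coe_id', id_eq, smul_eq_mul]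
      ring_nf
    rw [hpow, ← clm_symInt _ (by fun_prop)]
    exact (congrArg _ (hσ (-n))).trans (map_zero _)

/-- Injectivity of the Laplace transform, by polynomial approximation in `e^{-r}`. -/
theorem symInt_eq_zero {σ : Symbol} (hσ : ∀ z, symEval z σ = 0) {f : ℝ → ℝ}
    (hf : ContinuousOn f (Ici 0)) : symInt f σ = 0 := by
  obtain ⟨G, D, -, hD⟩ := exists_norm_symInt_le (E := ℝ) σ
  have hlog : ContinuousOn (fun w => f (-Real.log w)) (Icc (Real.exp (-G)) 1) := by
    refine hf.comp (Real.continuousOn_log.neg.mono fun w hw => ?_) fun w hw => ?_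
    · exact ((Real.exp_pos _).trans_le hw.1).ne'
    · exact neg_nonneg.2 (Real.log_nonpos ((Real.exp_pos _).le.trans hw.1) hw.2)
  have hsmall (ε : ℝ) (hε : 0 < ε) : ‖symInt f σ‖ ≤ D * ε := by
    obtain ⟨p, hp⟩ := exists_polynomial_near_of_continuousOn _ _ _ hlog ε hε
    have hsub : symInt f σ = symInt (fun r => f r - p.eval (Real.exp (-r))) σ := by
      have hp : ContinuousOn (fun r : ℝ => p.eval (Real.exp (-r))) (Ici 0) := by fun_prop
      have hadd := symInt_fun_add (hf.fun_sub hp) hp σ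
      simpa only [sub_add_cancel, symInt_eval_exp_neg hσ, add_zero] using hadd
    rw [hsub]
    refine hD _ _ fun r hr => ?_
    have hpr := hp (Real.exp (-r)) ⟨Real.exp_le_exp.2 (neg_le_neg hr.2),
      Real.exp_le_one_iff.2 (neg_nonpos.2 hr.1)⟩
    rw [Real.log_exp, neg_neg, abs_sub_comm] at hpr
    exact hpr.le
  have hzero : Tendsto (fun ε => D * ε) (𝓝[>] 0) (𝓝 0) :=
    tendsto_nhdsWithin_of_tendsto_nhds (Continuous.tendsto' (by fun_prop) _ _ (mul_zero D))
  exact norm_le_zero_iff.1 <| ge_of_tendsto hzero <| by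
    filter_upwards [self_mem_nhdsWithin] with ε hε using hsmall ε hε

section

variable [CompleteSpace X] {S : ℝ → X →L[ℝ] X} {h : ℝ}

theorem symOp_eq_zero (hS : IsC0Semigroup S) (hh : 0 ≤ h) {σ : Symbol}
    (hσ : ∀ z, symEval z σ = 0) (x : X) : symOp S h σ x = 0 := by
  refine SeparatingDual.eq_zero_of_forall_dual_eq_zero (R := ℝ) fun ℓ => ?_
  have hcont := hS.continuousOn_apply_mul hh x
  rw [symOp, clm_symInt ℓ hcont]
  exact symInt_eq_zero hσ (ℓ.continuous.comp_continuousOn hcont)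

theorem symOp_congr (hS : IsC0Semigroup S) (hh : 0 ≤ h) {σ τ : Symbol}
    (hστ : ∀ z, symEval z σ = symEval z τ) (x : X) : symOp S h σ x = symOp S h τ x := by
  refine sub_eq_zero.1 ((map_sub _ _ _).symm.trans (symOp_eq_zero hS hh (fun z => ?_) x))
  rw [map_sub, hστ, sub_self]

theorem sum_symOp_eq_zero (hS : IsC0Semigroup S) (hh : 0 ≤ h) {ι : Type*} (s : Finset ι)
    (σ : ι → Symbol) (x : ι → X) (hz : ∀ z, ∑ i ∈ s, symEval z (σ i) • x i = 0) :
    ∑ i ∈ s, symOp S h (σ i) (x i) = 0 := by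
  classical
  let e := Module.Basis.ofVectorSpace ℝ X
  set K := s.biUnion fun i => (e.repr (x i)).support
  let τ k : Symbol := ∑ i ∈ s, e.repr (x i) k • σ i
  have hτ k : symOp S h (τ k) (e k) = 0 := by
    refine symOp_eq_zero hS hh (fun z => ?_) _
    have hk := congrArg (fun y => e.repr y k) (hz z)
    simp only [map_sum, map_smul, Finsupp.coe_finsetSum, Finset.sum_apply, Finsupp.smul_apply,
      map_zero, Finsupp.coe_zero, Pi.zero_apply, smul_eq_mul] at hk
    simpa only [τ, map_sum, map_smul, smul_eq_mul, mul_comm] using hk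
  have hcoord i (hi : i ∈ s) :
      symOp S h (σ i) (x i) = ∑ k ∈ K, e.repr (x i) k • symOp S h (σ i) (e k) := by
    obtain ⟨T, hT⟩ := exists_clm_symOp hS hh (σ i)
    simp only [← hT]
    conv_lhs => rw [← e.linearCombination_repr (x i), Finsupp.linearCombination_apply,
      Finsupp.sum_of_support_subset _ (Finset.subset_biUnion_of_mem
        (fun i => (e.repr (x i)).support) hi) _ (by simp), map_sum]
    simp only [map_smul]
    rfl
  rw [Finset.sum_congr rfl hcoord, Finset.sum_comm]
  refine Finset.sum_eq_zero fun k _ => ?_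
  rw [← hτ k]
  simp only [symOp, τ, map_sum, map_smul]

end

theorem matExp_diagonal_apply {m : ℕ} (d : Fin m → ℝ) (t : ℝ) (x : Fin m → ℝ) (i : Fin m) :
    Method.matExp (Matrix.diagonal d) t x i = Real.exp (t * d i) * x i := by
  simp only [Method.matExp, LinearMap.coe_toContinuousLinearMap', Matrix.toLin'_apply]
  rw [← Matrix.diagonal_smul, Matrix.exp_diagonal, Matrix.mulVec_diagonal, Pi.coe_exp,
    Real.exp_eq_exp_ℝ]
  simp

theorem symOp_matExp_diagonal {m : ℕ} (d : Fin m → ℝ) (σ : Symbol) (x : Fin m → ℝ) (i : Fin m) :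
    symOp (Method.matExp (Matrix.diagonal d)) 1 σ x i = symEval (d i) σ * x i := by
  have hcont : Continuous fun r => Method.matExp (Matrix.diagonal d) r x :=
    continuous_pi fun j => by
      simp only [matExp_diagonal_apply]
      fun_prop
  have hcoord := clm_symInt (ContinuousLinearMap.proj (R := ℝ) (φ := fun _ : Fin m => ℝ) i)
    hcont.continuousOn σ
  have hfactor := clm_symInt ((ContinuousLinearMap.mul ℝ ℝ).flip (x i))
    (f := fun r => Real.exp (r * d i)) (by fun_prop) σ
  simp only [ContinuousLinearMap.proj_apply, matExp_diagonal_apply] at hcoord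
  simp only [symOp, mul_one, hcoord, symEval]
  exact hfactor.symm

/-! ### The order conditions for semigroups -/

namespace Method

variable [CompleteSpace X] {M : Method} {S : ℝ → X →L[ℝ] X} {h : ℝ}

theorem QuadratureCondition.apply {c : ℕ → ℝ} {d : ℝ} {k : ℕ}
    (H : M.QuadratureCondition c d (k + 1)) (hS : IsC0Semigroup S) (hh : 0 ≤ h) (x : X) :
    ∑ i ∈ Finset.Icc 2 M.s, c i • M.b S h i x = d • phi S (k + 1) h x := by
  have htransfer := symOp_congr hS hh (σ := ∑ i ∈ Finset.Icc 2 M.s, c i • M.bSym i)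
    (τ := d • phiSym k) (fun z => by
      have hz := congrFun (H 1 (Matrix.diagonal fun _ => z) (fun _ => 1)) 0
      simpa [← symOp_bSym, ← symOp_phiSym, Finset.sum_apply, symOp_matExp_diagonal] using hz) x
  simpa only [← symOp_bSym, ← symOp_phiSym, symOp, map_sum, map_smul] using htransfer

theorem C0.apply (H : M.C0) (hS : IsC0Semigroup S) (hh : 0 ≤ h) (x : X) :
    M.β 1 • M.psi S h (M.s + 1) 1 x = phi S 1 h x := by
  have htransfer := symOp_congr hS hh (σ := M.β 1 • M.psiSym (M.s + 1) 1) (τ := phiSym 0)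
    (fun z => by
      have hz := congrFun (H 1 (Matrix.diagonal fun _ => z) (fun _ => 1)) 0
      rw [← symOp_psiSym, ← symOp_phiSym _ _ 0] at hz
      simpa [symOp_matExp_diagonal] using hz) x
  rw [symOp_phiSym] at htransfer
  simpa only [← symOp_psiSym, symOp, map_smul] using htransfer

theorem C8.symEval_eq_zero (H : M.C8) (z w : ℝ) :
    ∑ i ∈ Finset.Icc 2 M.s,
      (M.α i 1 * M.P i 1) * (symEval z (M.bSym i) * symEval w (M.PsiSym i)) = 0 := by
  have hzw := congrFun (H 2 (Matrix.diagonal ![z, w]) !![0, 1; 0, 0] (fun _ => 1)) 0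
  simp only [← symOp_bSym, ← symOp_PsiSym, Finset.sum_apply, Pi.smul_apply,
    symOp_matExp_diagonal] at hzw
  simpa [Matrix.mulVec, dotProduct, Fin.sum_univ_two, symOp_matExp_diagonal] using hzw

theorem C8.apply (H : M.C8) (hS : IsC0Semigroup S) (hh : 0 ≤ h) (Q : X →L[ℝ] X) (x : X) :
    ∑ i ∈ Finset.Icc 2 M.s, (M.α i 1 * M.P i 1) • M.b S h i (Q (M.Psi S h i x)) = 0 := by
  -- `b_i` and `Ψ_i` are evaluated at `A` one after the other, first `Ψ_i`.
  have hPsi (z : ℝ) : ∑ i ∈ Finset.Icc 2 M.s,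
      symEval z (M.bSym i) • ((M.α i 1 * M.P i 1) • Q (M.Psi S h i x)) = 0 := by
    have hscalar (w : ℝ) : ∑ i ∈ Finset.Icc 2 M.s,
        symEval w (M.PsiSym i) * (M.α i 1 * M.P i 1 * symEval z (M.bSym i)) = 0 := by
      rw [← H.symEval_eq_zero z w]
      exact Finset.sum_congr rfl fun i _ => by ring
    have hsum := sum_symOp_eq_zero hS hh (Finset.Icc 2 M.s) M.PsiSym
      (fun i => (M.α i 1 * M.P i 1 * symEval z (M.bSym i)) • x) fun w => by
        simp only [smul_smul, ← Finset.sum_smul, hscalar, zero_smul]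
    have hQ := congrArg Q hsum
    simpa only [map_sum, map_zero, symOp_map_smul hS hh, symOp_PsiSym, map_smul, smul_smul,
      mul_comm] using hQ
  simpa only [symOp_map_smul hS hh, symOp_bSym] using
    sum_symOp_eq_zero hS hh (Finset.Icc 2 M.s) M.bSym _ hPsi

end Method

/-! ### Taylor expansions with uniform remainders -/

theorem exists_bound_near_compact {E Y : Type*} [SeminormedAddCommGroup E]
    [SeminormedAddCommGroup Y] {K U : Set E} (hK : IsCompact K) (hU : IsOpen U) (hKU : K ⊆ U)
    {f : E → Y} (hf : ContinuousOn f U) :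
    ∃ ε > 0, ∃ C, ∀ v ∈ K, ∀ w, ‖w‖ ≤ ε → v + w ∈ U ∧ ‖f (v + w)‖ ≤ C := by
  obtain ⟨C, hC⟩ := hK.exists_bound_of_continuousOn (hf.mono hKU)
  have hopen : IsOpen (U ∩ (fun x => ‖f x‖) ⁻¹' Iio (C + 1)) :=
    hf.norm.isOpen_inter_preimage hU isOpen_Iio
  obtain ⟨ε, hε, hsub⟩ := hK.exists_cthickening_subset_open hopen
    (fun x hx => ⟨hKU hx, (hC x hx).trans_lt (lt_add_one C)⟩)
  refine ⟨ε, hε, C + 1, fun v hv w hw => ?_⟩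
  have hvw : v + w ∈ Metric.cthickening ε K :=
    Metric.mem_cthickening_of_dist_le _ v _ _ hv (by simpa using hw)
  exact ⟨(hsub hvw).1, le_of_lt (hsub hvw).2⟩

section Taylor

variable {Y : Type*} [NormedAddCommGroup Y] [NormedSpace ℝ Y] [CompleteSpace Y]

theorem norm_sub_sum_iteratedFDeriv_le {f : X → Y} {v w : X} {n : ℕ} {C : ℝ}
    (hf : ∀ θ ∈ Icc (0 : ℝ) 1, ContDiffAt ℝ (n + 1) f (v + θ • w))
    (hC : ∀ θ ∈ Icc (0 : ℝ) 1, ‖iteratedFDeriv ℝ (n + 1) f (v + θ • w)‖ ≤ C) :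
    ‖f (v + w) - ∑ k ∈ Finset.range (n + 1),
      (k.factorial : ℝ)⁻¹ • iteratedFDeriv ℝ k f v (fun _ => w)‖ ≤ C * ‖w‖ ^ (n + 1) := by
  have hint : ‖∫ θ in (0 : ℝ)..1, (1 - θ) ^ n • iteratedFDeriv ℝ (n + 1) f (v + θ • w)
      fun _ => w‖ ≤ C * ‖w‖ ^ (n + 1) * |1 - 0| := by
    refine intervalIntegral.norm_integral_le_of_norm_le_const fun θ hθ => ?_
    rw [uIoc_of_le zero_le_one] at hθ
    have h1θ : 0 ≤ 1 - θ := sub_nonneg.2 hθ.2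
    rw [norm_smul, Real.norm_of_nonneg (by positivity)]
    refine (mul_le_of_le_one_left (norm_nonneg _)
      (pow_le_one₀ h1θ (by linarith [hθ.1]))).trans ?_
    simpa using ContinuousMultilinearMap.le_of_opNorm_le (hC θ ⟨hθ.1.le, hθ.2⟩) fun _ => w
  have hfact : ‖(n.factorial : ℝ)⁻¹‖ ≤ 1 := by
    rw [Real.norm_of_nonneg (by positivity)]
    exact inv_le_one_of_one_le₀ (by exact_mod_cast n.factorial_pos)
  rw [map_add_eq_sum_add_integral_iteratedFDeriv hf, add_sub_cancel_left, norm_smul]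
  exact (mul_le_of_le_one_left (norm_nonneg _) hfact).trans (by simpa using hint)

theorem exists_taylor_bound_near_compact {K U : Set X} (hK : IsCompact K) (hU : IsOpen U)
    (hKU : K ⊆ U) {f : X → Y} {n : ℕ} (hf : ContDiffOn ℝ (n + 1) f U) :
    ∃ ε > 0, ∃ C, ∀ v ∈ K, ∀ w, ‖w‖ ≤ ε →
      ‖f (v + w) - ∑ k ∈ Finset.range (n + 1),
        (k.factorial : ℝ)⁻¹ • iteratedFDeriv ℝ k f v (fun _ => w)‖ ≤ C * ‖w‖ ^ (n + 1) := by
  have hat : ∀ x ∈ U, ContDiffAt ℝ (n + 1) f x := fun x hx => hf.contDiffAt (hU.mem_nhds hx)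
  have hcont : ContinuousOn (iteratedFDeriv ℝ (n + 1) f) U := fun x hx =>
    ((hat x hx).iteratedFDeriv_right (i := n + 1) (m := 0)
      (by simp)).continuousAt.continuousWithinAt
  obtain ⟨ε, hε, C, hC⟩ := exists_bound_near_compact hK hU hKU hcont
  have hseg {w : X} (hw : ‖w‖ ≤ ε) {θ : ℝ} (hθ : θ ∈ Icc (0 : ℝ) 1) : ‖θ • w‖ ≤ ε := by
    rw [norm_smul, Real.norm_of_nonneg hθ.1]
    exact (mul_le_of_le_one_left (norm_nonneg _) hθ.2).trans hw
  exact ⟨ε, hε, C, fun v hv w hw => norm_sub_sum_iteratedFDeriv_le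
    (fun θ hθ => hat _ (hC v hv _ (hseg hw hθ)).1) fun θ hθ => (hC v hv _ (hseg hw hθ)).2⟩

end Taylor

theorem iteratedDerivWithin_Icc_left {n : ℕ} {t₀ t T : ℝ} {u : ℝ → X}
    (hu : ContDiffOn ℝ n u (Icc t₀ T)) (ht₀ : t₀ ≤ t) (ht : t < T) {r : ℝ} (hr : r ∈ Icc t T) :
    iteratedDerivWithin n u (Icc t T) r = iteratedDerivWithin n u (Icc t₀ T) r := by
  simp only [iteratedDerivWithin]
  rw [iteratedFDerivWithin_subset (Icc_subset_Icc_left ht₀) (uniqueDiffOn_Icc ht)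
    (uniqueDiffOn_Icc (ht₀.trans_lt ht)) hu hr]

theorem exists_taylor_bound_Icc {n : ℕ} {t₀ T : ℝ} (hT : t₀ < T) {u : ℝ → X}
    (hu : ContDiffOn ℝ (n + 1) u (Icc t₀ T)) :
    ∃ C, ∀ t ∈ Icc t₀ T, ∀ τ, 0 ≤ τ → t + τ ≤ T →
      ‖u (t + τ) - ∑ k ∈ Finset.range (n + 1),
        (τ ^ k / (k.factorial : ℝ)) • iteratedDerivWithin k u (Icc t₀ T) t‖
          ≤ C * τ ^ (n + 1) := by
  obtain ⟨C, hC⟩ := isCompact_Icc.exists_bound_of_continuousOn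
    (hu.continuousOn_iteratedDerivWithin (m := n + 1) le_rfl (uniqueDiffOn_Icc hT))
  refine ⟨C / n.factorial, fun t ht τ hτ hτT => ?_⟩
  rcases hτ.eq_or_lt with rfl | hτ
  · simp [Finset.sum_range_succ']
  have htT : t < T := by linarith
  have hsub {k : ℕ} (hk : k ≤ n + 1) {r : ℝ} (hr : r ∈ Icc t T) :=
    iteratedDerivWithin_Icc_left (hu.of_le (by exact_mod_cast hk)) ht.1 htT hr
  have htaylor := taylor_mean_remainder_bound (C := C) htT.le
    (hu.mono (Icc_subset_Icc_left ht.1)) (x := t + τ) ⟨by linarith, hτT⟩ fun r hr => by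
      rw [hsub le_rfl hr]
      exact hC r (Icc_subset_Icc_left ht.1 hr)
  rw [taylor_within_apply, add_sub_cancel_left] at htaylor
  convert htaylor using 3
  · refine Finset.sum_congr rfl fun k hk => ?_
    rw [hsub (Finset.mem_range.1 hk).le (left_mem_Icc.2 htT.le), div_eq_inv_mul]
  · ring

/-! ### Derivatives of the nonlinearity -/

theorem Ntilde_sub_eq (N : X → X) (v w : X) :
    Ntilde N v (v + w) - Ntilde N v v = N (v + w) - N v - fderiv ℝ N v w := by
  simp only [Ntilde, map_add]
  abel

theorem iteratedFDeriv_clm_eq_zero {Y : Type*} [NormedAddCommGroup Y] [NormedSpace ℝ Y]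
    (G : X →L[ℝ] Y) (k : ℕ) (x : X) : iteratedFDeriv ℝ (k + 2) G x = 0 := by
  ext m
  have hG : fderiv ℝ (⇑G) = fun _ => G := funext fun _ => G.fderiv
  rw [iteratedFDeriv_succ_apply_right, hG, iteratedFDeriv_const_of_ne (by simp)]
  simp

theorem iteratedFDeriv_Ntilde {N : X → X} {v : X} {k : ℕ} (hN : ContDiffAt ℝ (k + 2 : ℕ) N v) :
    iteratedFDeriv ℝ (k + 2) (Ntilde N v) v = iteratedFDeriv ℝ (k + 2) N v := by
  have hsub := iteratedFDeriv_sub_apply (i := k + 2) (g := ⇑(fderiv ℝ N v)) hN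
    (fderiv ℝ N v).contDiff.contDiffAt
  rwa [iteratedFDeriv_clm_eq_zero, sub_zero] at hsub

section Symmetry

variable {Y : Type*} [NormedAddCommGroup Y] [NormedSpace ℝ Y] {f : X → Y} {v : X}

theorem iteratedFDeriv_two_swap (hf : ContDiffAt ℝ 2 f v) (a b : X) :
    iteratedFDeriv ℝ 2 f v ![a, b] = iteratedFDeriv ℝ 2 f v ![b, a] :=
  IsSymmSndFDerivAt.iteratedFDeriv_cons (hf := hf.isSymmSndFDerivAt (by simp))

theorem iteratedFDeriv_three_swap_left (hf : ContDiffAt ℝ 3 f v) (a b c : X) :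
    iteratedFDeriv ℝ 3 f v ![a, b, c] = iteratedFDeriv ℝ 3 f v ![b, a, c] := by
  have hfderiv (a b : X) : iteratedFDeriv ℝ 3 f v ![a, b, c]
      = iteratedFDeriv ℝ 2 (fderiv ℝ f) v ![a, b] c := by
    rw [iteratedFDeriv_succ_apply_right]
    congr 2
    ext i
    fin_cases i <;> rfl
  rw [hfderiv, hfderiv, iteratedFDeriv_two_swap (hf.fderiv_right (by norm_num))]

theorem iteratedFDeriv_three_swap_right (hf : ContDiffAt ℝ 3 f v) (a b c : X) :
    iteratedFDeriv ℝ 3 f v ![a, b, c] = iteratedFDeriv ℝ 3 f v ![a, c, b] := by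
  have hd : DifferentiableAt ℝ (iteratedFDeriv ℝ 2 f) v :=
    hf.differentiableAt_iteratedFDeriv (by norm_cast)
  have hfderiv (b c : X) : iteratedFDeriv ℝ 3 f v ![a, b, c]
      = fderiv ℝ (fun y => iteratedFDeriv ℝ 2 f y ![b, c]) v a := by
    rw [hd.iteratedFDeriv_succ_apply_left']
    rfl
  have hev : (fun y => iteratedFDeriv ℝ 2 f y ![b, c])
      =ᶠ[𝓝 v] fun y => iteratedFDeriv ℝ 2 f y ![c, b] := by
    filter_upwards [(hf.of_le (by norm_num : (2 : WithTop ℕ∞) ≤ 3)).eventually (by simp)]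
      with y hy
    exact iteratedFDeriv_two_swap hy b c
  rw [hfderiv, hfderiv, hev.fderiv_eq]

end Symmetry

theorem hasDerivWithinAt_fderiv_apply {N : X → X} {s : Set ℝ} {t : ℝ} {u w : ℝ → X} {u' w' : X}
    (hN : ContDiffAt ℝ 2 N (u t)) (hu : HasDerivWithinAt u u' s t)
    (hw : HasDerivWithinAt w w' s t) :
    HasDerivWithinAt (fun r => fderiv ℝ N (u r) (w r))
      (iteratedFDeriv ℝ 2 N (u t) ![u', w t] + fderiv ℝ N (u t) w') s t := by
  have hfderiv : DifferentiableAt ℝ (fderiv ℝ N) (u t) :=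
    (hN.fderiv_right (m := 1) (by norm_num)).differentiableAt one_ne_zero
  simpa [iteratedFDeriv_two_apply] using
    (hfderiv.hasFDerivAt.comp_hasDerivWithinAt t hu).clm_apply hw

/-! ### Derivatives of the solution -/

theorem hasDerivWithinAt_iteratedDerivWithin {s : Set ℝ} (hs : UniqueDiffOn ℝ s) {f : ℝ → X}
    {n : WithTop ℕ∞} {k : ℕ} (hf : ContDiffOn ℝ n f s) (hk : (k : WithTop ℕ∞) < n) {t : ℝ}
    (ht : t ∈ s) :
    HasDerivWithinAt (iteratedDerivWithin k f s) (iteratedDerivWithin (k + 1) f s t) s t := by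
  rw [iteratedDerivWithin_succ]
  exact (hf.differentiableOn_iteratedDerivWithin hk hs t ht).hasDerivWithinAt

theorem contDiffOn_iteratedDerivWithin {s : Set ℝ} (hs : UniqueDiffOn ℝ s) {f : ℝ → X}
    {m n : WithTop ℕ∞} {k : ℕ} (hf : ContDiffOn ℝ n f s) (hk : m + k ≤ n) :
    ContDiffOn ℝ m (iteratedDerivWithin k f s) s := by
  rw [iteratedDerivWithin_eq_equiv_comp]
  exact (LinearIsometryEquiv.contDiff _).comp_contDiffOn fun t ht =>
    (hf t ht).iteratedFDerivWithin_right hs hk ht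

section Strip

variable {E : Type*} [NormedAddCommGroup E]

theorem subset_strip {t₀ T δ : ℝ} (hδ : 0 < δ) (u : ℝ → E) : u '' Icc t₀ T ⊆ strip t₀ T u δ :=
  Metric.self_subset_thickening hδ _

theorem isOpen_strip (t₀ T δ : ℝ) (u : ℝ → E) : IsOpen (strip t₀ T u δ) :=
  Metric.isOpen_thickening

end Strip

theorem contDiffAt_of_strip {N : X → X} {t₀ T δ : ℝ} {u : ℝ → X} {n : WithTop ℕ∞} (hδ : 0 < δ)
    (hN : ContDiffOn ℝ n N (strip t₀ T u δ)) {t : ℝ} (ht : t ∈ Icc t₀ T) :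
    ContDiffAt ℝ n N (u t) :=
  hN.contDiffAt ((isOpen_strip t₀ T δ u).mem_nhds (subset_strip hδ u (mem_image_of_mem u ht)))

theorem contDiffOn_iteratedFDeriv_two_apply {N : X → X} {t₀ T δ : ℝ} {u : ℝ → X}
    {n : WithTop ℕ∞} (hδ : 0 < δ) (hN : ContDiffOn ℝ (n + 2) N (strip t₀ T u δ)) {a b : ℝ → X}
    (hus : ContDiffOn ℝ n u (Icc t₀ T)) (ha : ContDiffOn ℝ n a (Icc t₀ T))
    (hb : ContDiffOn ℝ n b (Icc t₀ T)) :
    ContDiffOn ℝ n (fun t => iteratedFDeriv ℝ 2 N (u t) ![a t, b t]) (Icc t₀ T) := by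
  simp only [iteratedFDeriv_two_apply, Matrix.cons_val_zero, Matrix.cons_val_one]
  refine ContDiffOn.clm_apply (ContDiffOn.clm_apply (fun t ht => ?_) ha) hb
  refine ContDiffAt.comp_contDiffWithinAt t ?_ (hus t ht)
  exact ((contDiffAt_of_strip hδ hN ht).fderiv_right (m := n + 1)
    (by rw [add_assoc, one_add_one_eq_two])).fderiv_right le_rfl

section Graph

variable {L : X →ₗ.[ℝ] X} {S : ℝ → X →L[ℝ] X} {N : X → X}

theorem IsGenerator.deriv_mem_graph [CompleteSpace X] (hL : IsGenerator L S) {s : Set ℝ}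
    (hs : UniqueDiffOn ℝ s) {w v : ℝ → X} (hwv : ∀ r ∈ s, (w r, v r) ∈ L.graph) {t : ℝ}
    (ht : t ∈ s) {w' v' : X} (hw : HasDerivWithinAt w w' s t) (hv : HasDerivWithinAt v v' s t) :
    (w', v') ∈ L.graph := by
  rw [hasDerivWithinAt_iff_tendsto_slope] at hw hv
  have : (𝓝[s \ {t}] t).NeBot :=
    accPt_principal_iff_nhdsWithin.1 (uniqueDiffWithinAt_iff_accPt.1 (hs t ht))
  refine hL.mem_graph_of_tendsto ?_ hw hv
  filter_upwards [self_mem_nhdsWithin] with r hr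
  simpa [slope] using L.graph.smul_mem (r - t)⁻¹ (L.graph.sub_mem (hwv r hr.1) (hwv t ht))

theorem IsGenerator.deriv_mem_jacobian_graph [CompleteSpace X] (hL : IsGenerator L S)
    {s : Set ℝ} (hs : UniqueDiffOn ℝ s) {u w v : ℝ → X}
    (hwv : ∀ r ∈ s, (w r, v r) ∈ (jacobian L N (u r)).graph) {t : ℝ} (ht : t ∈ s)
    (hN : ContDiffAt ℝ 2 N (u t)) {u' w' v' : X} (hu : HasDerivWithinAt u u' s t)
    (hw : HasDerivWithinAt w w' s t) (hv : HasDerivWithinAt v v' s t) :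
    (w', v' - iteratedFDeriv ℝ 2 N (u t) ![u', w t]) ∈ (jacobian L N (u t)).graph := by
  refine mem_graph_vadd_iff.2 ?_
  rw [sub_sub]
  exact hL.deriv_mem_graph hs (fun r hr => mem_graph_vadd_iff.1 (hwv r hr)) ht hw
    (hv.fun_sub (hasDerivWithinAt_fderiv_apply hN hu hw))

end Graph

section Solution

variable {L : X →ₗ.[ℝ] X} {S : ℝ → X →L[ℝ] X} {N : X → X} {t₀ T : ℝ} {u₀ : X} {u : ℝ → X}
  {δ : ℝ}

theorem IsSolution.rhs_eq (hu : IsSolution L N t₀ T u₀ u) (hT : t₀ < T) {t : ℝ}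
    (ht : t ∈ Icc t₀ T) : rhs L N (u t) = iteratedDerivWithin 1 u (Icc t₀ T) t := by
  rw [iteratedDerivWithin_one]
  exact ((hu.hasDeriv t ht).derivWithin (uniqueDiffOn_Icc hT t ht)).symm

theorem IsSolution.mem_graph (hu : IsSolution L N t₀ T u₀ u) {t : ℝ} (ht : t ∈ Icc t₀ T) :
    (u t, rhs L N (u t) - N (u t)) ∈ L.graph := by
  rw [LinearPMap.mem_graph_iff]
  exact ⟨⟨u t, hu.mem_domain t ht⟩, rfl, by simp [rhs, hu.mem_domain t ht]⟩

theorem IsSolution.hasDerivWithinAt (hu : IsSolution L N t₀ T u₀ u) (hT : t₀ < T) {t : ℝ}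
    (ht : t ∈ Icc t₀ T) :
    HasDerivWithinAt u (iteratedDerivWithin 1 u (Icc t₀ T) t) (Icc t₀ T) t :=
  hu.rhs_eq hT ht ▸ hu.hasDeriv t ht

variable [CompleteSpace X]

theorem IsSolution.deriv_one_mem_jacobian_graph (hu : IsSolution L N t₀ T u₀ u)
    (hL : IsGenerator L S) (hT : t₀ < T) (hus : ContDiffOn ℝ 2 u (Icc t₀ T)) (hδ : 0 < δ)
    (hN : ContDiffOn ℝ 1 N (strip t₀ T u δ)) {t : ℝ} (ht : t ∈ Icc t₀ T) :
    (iteratedDerivWithin 1 u (Icc t₀ T) t, iteratedDerivWithin 2 u (Icc t₀ T) t)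
      ∈ (jacobian L N (u t)).graph := by
  have hs := uniqueDiffOn_Icc hT
  have hNt := (contDiffAt_of_strip hδ hN ht).differentiableAt one_ne_zero
  refine mem_graph_vadd_iff.2 (hL.deriv_mem_graph hs (fun r hr => ?_) ht
    (hu.hasDerivWithinAt hT ht) ((hasDerivWithinAt_iteratedDerivWithin (k := 1) hs hus
      (by norm_num) ht).fun_sub
        (hNt.hasFDerivAt.comp_hasDerivWithinAt t (hu.hasDerivWithinAt hT ht))))
  exact hu.rhs_eq hT hr ▸ hu.mem_graph hr

theorem IsSolution.deriv_two_mem_jacobian_graph (hu : IsSolution L N t₀ T u₀ u)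
    (hL : IsGenerator L S) (hT : t₀ < T) (hus : ContDiffOn ℝ 3 u (Icc t₀ T)) (hδ : 0 < δ)
    (hN : ContDiffOn ℝ 2 N (strip t₀ T u δ)) {t : ℝ} (ht : t ∈ Icc t₀ T) :
    (iteratedDerivWithin 2 u (Icc t₀ T) t, iteratedDerivWithin 3 u (Icc t₀ T) t
      - iteratedFDeriv ℝ 2 N (u t) ![iteratedDerivWithin 1 u (Icc t₀ T) t,
          iteratedDerivWithin 1 u (Icc t₀ T) t]) ∈ (jacobian L N (u t)).graph := by
  have hs := uniqueDiffOn_Icc hT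
  exact hL.deriv_mem_jacobian_graph hs
    (fun r hr => hu.deriv_one_mem_jacobian_graph hL hT (hus.of_le (by norm_num)) hδ
      (hN.of_le (by norm_num)) hr) ht (contDiffAt_of_strip hδ hN ht) (hu.hasDerivWithinAt hT ht)
    (hasDerivWithinAt_iteratedDerivWithin hs hus (by norm_num) ht)
    (hasDerivWithinAt_iteratedDerivWithin hs hus (by norm_num) ht)

theorem IsSolution.exists_deriv_three_mem_jacobian_graph (hu : IsSolution L N t₀ T u₀ u)
    (hL : IsGenerator L S) (hT : t₀ < T) (hus : ContDiffOn ℝ 4 u (Icc t₀ T)) (hδ : 0 < δ)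
    (hN : ContDiffOn ℝ 3 N (strip t₀ T u δ)) :
    ∃ u₄ : ℝ → X, (∃ C, ∀ t ∈ Icc t₀ T, ‖u₄ t‖ ≤ C) ∧ ∀ t ∈ Icc t₀ T,
      (iteratedDerivWithin 3 u (Icc t₀ T) t, u₄ t) ∈ (jacobian L N (u t)).graph := by
  have hs := uniqueDiffOn_Icc hT
  have hus' {k : ℕ} (hk : k ≤ 3) : ContDiffOn ℝ 1 (iteratedDerivWithin k u (Icc t₀ T))
      (Icc t₀ T) := contDiffOn_iteratedDerivWithin hs hus (by exact_mod_cast (by omega : 1 + k ≤ 4))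
  have hu1 : ContDiffOn ℝ 1 u (Icc t₀ T) := hus.of_le (by norm_num)
  have hN2 : ContDiffOn ℝ 2 N (strip t₀ T u δ) := hN.of_le (by norm_num)
  set v : ℝ → X := fun t => iteratedDerivWithin 3 u (Icc t₀ T) t
    - iteratedFDeriv ℝ 2 N (u t) ![iteratedDerivWithin 1 u (Icc t₀ T) t,
        iteratedDerivWithin 1 u (Icc t₀ T) t]
  have hv : ContDiffOn ℝ 1 v (Icc t₀ T) := (hus' le_rfl).sub
    (contDiffOn_iteratedFDeriv_two_apply hδ (hN.of_le (by norm_num)) hu1 (hus' (by norm_num))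
      (hus' (by norm_num)))
  refine ⟨fun t => derivWithin v (Icc t₀ T) t - iteratedFDeriv ℝ 2 N (u t)
    ![iteratedDerivWithin 1 u (Icc t₀ T) t, iteratedDerivWithin 2 u (Icc t₀ T) t],
    isCompact_Icc.exists_bound_of_continuousOn ?_, fun t ht => ?_⟩
  · refine (hv.continuousOn_derivWithin hs le_rfl).sub
      (contDiffOn_iteratedFDeriv_two_apply (n := 0) hδ (by simpa using hN2)
        (hu1.of_le zero_le_one) ((hus' ?_).of_le zero_le_one)
        ((hus' ?_).of_le zero_le_one)).continuousOn <;> norm_num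
  · exact hL.deriv_mem_jacobian_graph hs
      (fun r hr => hu.deriv_two_mem_jacobian_graph hL hT (hus.of_le (by norm_num)) hδ hN2 hr) ht
      (contDiffAt_of_strip hδ hN2 ht) (hu.hasDerivWithinAt hT ht)
      (hasDerivWithinAt_iteratedDerivWithin hs hus (by norm_num) ht)
      ((hv.differentiableOn one_ne_zero) t ht).hasDerivWithinAt

end Solution

/-! ### Asymptotic expansion of multilinear maps along a small increment -/

section Multilinear

variable {Y : Type*} [NormedAddCommGroup Y] [NormedSpace ℝ Y]

theorem map_const_two (D : X [×2]→L[ℝ] Y) (x : X) : D (fun _ => x) = D ![x, x] :=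
  congrArg D (by ext i; fin_cases i <;> rfl)

theorem map_const_three (D : X [×3]→L[ℝ] Y) (x : X) : D (fun _ => x) = D ![x, x, x] :=
  congrArg D (by ext i; fin_cases i <;> rfl)

theorem map_const_four (D : X [×4]→L[ℝ] Y) (x : X) : D (fun _ => x) = D ![x, x, x, x] :=
  congrArg D (by ext i; fin_cases i <;> rfl)

theorem map_two_add_left (D : X [×2]→L[ℝ] Y) (a a' b : X) :
    D ![a + a', b] = D ![a, b] + D ![a', b] :=
  D.cons_add ![b] a a'

theorem map_two_add_right (D : X [×2]→L[ℝ] Y) (a b b' : X) :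
    D ![a, b + b'] = D ![a, b] + D ![a, b'] :=
  (D.curryLeft a).cons_add ![] b b'

theorem map_two_smul_left (D : X [×2]→L[ℝ] Y) (c : ℝ) (a b : X) :
    D ![c • a, b] = c • D ![a, b] :=
  D.cons_smul ![b] c a

theorem map_two_smul_right (D : X [×2]→L[ℝ] Y) (c : ℝ) (a b : X) :
    D ![a, c • b] = c • D ![a, b] :=
  (D.curryLeft a).cons_smul ![] c b

theorem map_three_add_fst (D : X [×3]→L[ℝ] Y) (a a' b c : X) :
    D ![a + a', b, c] = D ![a, b, c] + D ![a', b, c] :=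
  D.cons_add ![b, c] a a'

theorem map_three_add_snd (D : X [×3]→L[ℝ] Y) (a b b' c : X) :
    D ![a, b + b', c] = D ![a, b, c] + D ![a, b', c] :=
  map_two_add_left (D.curryLeft a) b b' c

theorem map_three_add_trd (D : X [×3]→L[ℝ] Y) (a b c c' : X) :
    D ![a, b, c + c'] = D ![a, b, c] + D ![a, b, c'] :=
  map_two_add_right (D.curryLeft a) b c c'

theorem map_three_smul_fst (D : X [×3]→L[ℝ] Y) (r : ℝ) (a b c : X) :
    D ![r • a, b, c] = r • D ![a, b, c] :=
  D.cons_smul ![b, c] r a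

theorem map_three_smul_snd (D : X [×3]→L[ℝ] Y) (r : ℝ) (a b c : X) :
    D ![a, r • b, c] = r • D ![a, b, c] :=
  map_two_smul_left (D.curryLeft a) r b c

theorem map_three_smul_trd (D : X [×3]→L[ℝ] Y) (r : ℝ) (a b c : X) :
    D ![a, b, r • c] = r • D ![a, b, c] :=
  map_two_smul_right (D.curryLeft a) r b c

theorem map_four_smul_diag (D : X [×4]→L[ℝ] Y) (r : ℝ) (x : X) :
    D ![r • x, r • x, r • x, r • x] = r ^ 4 • D ![x, x, x, x] := by
  have diag : ![r • x, r • x, r • x, r • x] = fun i => r • ![x, x, x, x] i := by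
    ext i; fin_cases i <;> rfl
  simpa [diag] using D.map_smul_univ (fun _ => r) ![x, x, x, x]

end Multilinear

section Expansion

open Asymptotics

variable {Y : Type*} [NormedAddCommGroup Y] [NormedSpace ℝ Y]
  {α : Type*} {l : Filter α} {h : α → ℝ}

theorem isBigO_pow_of_le (hh : h =O[l] fun _ => (1 : ℝ)) {m n : ℕ} (hmn : n ≤ m) :
    (fun a => h a ^ m) =O[l] fun a => h a ^ n := by
  obtain ⟨k, rfl⟩ := Nat.exists_eq_add_of_le hmn
  simpa only [pow_add, one_pow, mul_one] using (isBigO_refl (fun a => h a ^ n) l).mul (hh.pow k)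

theorem isBigO_pow_smul {f : α → X} {n : ℕ} (m : ℕ) (hf : f =O[l] fun a => h a ^ n) :
    (fun a => h a ^ m • f a) =O[l] fun a => h a ^ (m + n) := by
  simpa only [pow_add, smul_eq_mul] using (isBigO_refl (fun a => h a ^ m) l).smul hf

theorem isBigO_pow_smul_of_bounded (hh : h =O[l] fun _ => (1 : ℝ)) {f : α → X}
    (hf : f =O[l] fun _ => (1 : ℝ)) {m n : ℕ} (hmn : n ≤ m) :
    (fun a => h a ^ m • f a) =O[l] fun a => h a ^ n := by
  simpa only [smul_eq_mul, mul_one] using (isBigO_pow_of_le hh hmn).smul hf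

theorem isBigO_pow_of_isBigO_smul (h_pos : ∀ᶠ a in l, 0 < h a) {f : α → X} {n : ℕ}
    (hf : (fun a => h a • f a) =O[l] fun a => h a ^ (n + 1)) : f =O[l] fun a => h a ^ n := by
  refine ((isBigO_refl (fun a => (h a)⁻¹) l).smul hf).congr' ?_ ?_
  all_goals filter_upwards [h_pos] with a ha
  · rw [inv_smul_smul₀ ha.ne']
  · rw [pow_succ', smul_eq_mul, inv_mul_cancel_left₀ ha.ne']

theorem isBigO_one_multilinear {n : ℕ} {D : α → X [×n]→L[ℝ] Y} (hD : D =O[l] fun _ => (1 : ℝ))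
    {v : α → Fin n → X} (hv : ∀ i, (fun a => v a i) =O[l] fun _ => (1 : ℝ)) :
    (fun a => D a (v a)) =O[l] fun _ => (1 : ℝ) := by
  have opNorm : (fun a => D a (v a)) =O[l] fun a => ‖D a‖ * ∏ i, ‖v a i‖ :=
    isBigO_of_le l fun a => ((D a).le_opNorm (v a)).trans (le_abs_self _)
  have prod : (fun a => ∏ i, ‖v a i‖) =O[l] fun _ => ∏ _i : Fin n, (1 : ℝ) :=
    IsBigO.finsetProd fun i _ => (hv i).norm_left
  exact opNorm.trans (by simpa using hD.norm_left.mul prod)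

theorem isBigO_one_map_two {D : α → X [×2]→L[ℝ] Y} (hD : D =O[l] fun _ => (1 : ℝ))
    {x y : α → X} (hx : x =O[l] fun _ => (1 : ℝ)) (hy : y =O[l] fun _ => (1 : ℝ)) :
    (fun a => D a ![x a, y a]) =O[l] fun _ => (1 : ℝ) :=
  isBigO_one_multilinear hD (Fin.forall_fin_two.2 ⟨hx, hy⟩)

theorem isBigO_one_map_three {D : α → X [×3]→L[ℝ] Y} (hD : D =O[l] fun _ => (1 : ℝ))
    {x y z : α → X} (hx : x =O[l] fun _ => (1 : ℝ)) (hy : y =O[l] fun _ => (1 : ℝ))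
    (hz : z =O[l] fun _ => (1 : ℝ)) :
    (fun a => D a ![x a, y a, z a]) =O[l] fun _ => (1 : ℝ) :=
  isBigO_one_multilinear hD (Fin.forall_fin_succ.2 ⟨hx, Fin.forall_fin_two.2 ⟨hy, hz⟩⟩)

theorem isBigO_map_diag_sub {n k : ℕ} {D : α → X [×n]→L[ℝ] Y}
    (hD : D =O[l] fun _ => (1 : ℝ)) {w p : α → X} (hw : w =O[l] h) (hp : p =O[l] h)
    (hwp : (fun a => w a - p a) =O[l] fun a => h a ^ k) :
    (fun a => D a (fun _ => w a) - D a (fun _ => p a)) =O[l] fun a => h a ^ (n - 1 + k) := by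
  rcases n.eq_zero_or_pos with rfl | hn
  · have heq : ∀ a, D a (fun _ => w a) = D a (fun _ => p a) := fun a =>
      congrArg (D a) (Subsingleton.elim _ _)
    simpa only [heq, sub_self] using isBigO_zero _ l
  have : Nonempty (Fin n) := ⟨⟨0, hn⟩⟩
  have lipschitz : ∀ a, ‖D a (fun _ => w a) - D a (fun _ => p a)‖
      ≤ ‖‖D a‖ * (n : ℝ) * (‖w a‖ + ‖p a‖) ^ (n - 1) * ‖w a - p a‖‖ := fun a => by
    have bound := (D a).norm_image_sub_le (fun _ => w a) (fun _ => p a)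
    have diff : (fun _ : Fin n => w a) - (fun _ => p a) = fun _ => w a - p a := rfl
    simp only [diff, pi_norm_const, Fintype.card_fin] at bound
    refine bound.trans (le_trans ?_ (le_abs_self _))
    gcongr
    exact max_le_add_of_nonneg (norm_nonneg _) (norm_nonneg _)
  have factor : (fun a => ‖D a‖ * (n : ℝ)) =O[l] fun _ => (1 : ℝ) := by
    simpa only [one_mul] using hD.norm_left.mul (isBigO_const_const (n : ℝ) one_ne_zero l)
  refine (isBigO_of_le l lipschitz).trans ?_
  simpa only [one_mul, pow_add] using
    (factor.mul ((hw.norm_left.add hp.norm_left).pow (n - 1))).mul hwp.norm_left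

theorem isBigO_cubic_increment (hh : h =O[l] fun _ => (1 : ℝ)) {x₁ x₂ x₃ : α → X}
    (h₁ : x₁ =O[l] fun _ => (1 : ℝ)) (h₂ : x₂ =O[l] fun _ => (1 : ℝ))
    (h₃ : x₃ =O[l] fun _ => (1 : ℝ)) :
    (fun a => h a • x₁ a + h a ^ 2 • x₂ a + h a ^ 3 • x₃ a) =O[l] h := by
  simpa only [pow_one] using ((isBigO_pow_smul_of_bounded hh h₁ (le_refl 1)).add
    (isBigO_pow_smul_of_bounded hh h₂ one_le_two)).add
    (isBigO_pow_smul_of_bounded hh h₃ (by lia : 1 ≤ 3))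

theorem quadratic_expansion (hh : h =O[l] fun _ => (1 : ℝ))
    {D : α → X [×2]→L[ℝ] Y} (hD : D =O[l] fun _ => (1 : ℝ))
    {w x₁ x₂ x₃ : α → X} (h₁ : x₁ =O[l] fun _ => (1 : ℝ)) (h₂ : x₂ =O[l] fun _ => (1 : ℝ))
    (h₃ : x₃ =O[l] fun _ => (1 : ℝ)) (hw : w =O[l] h)
    (hwx : (fun a => w a - (h a • x₁ a + h a ^ 2 • x₂ a + h a ^ 3 • x₃ a))
      =O[l] fun a => h a ^ 4) :
    (fun a => D a ![w a, w a] - (h a ^ 2 • D a ![x₁ a, x₁ a]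
      + h a ^ 3 • (D a ![x₁ a, x₂ a] + D a ![x₂ a, x₁ a])
      + h a ^ 4 • (D a ![x₁ a, x₃ a] + D a ![x₃ a, x₁ a] + D a ![x₂ a, x₂ a])))
      =O[l] fun a => h a ^ 5 := by
  have perturb := isBigO_map_diag_sub hD hw (isBigO_cubic_increment hh h₁ h₂ h₃) hwx
  have order_five := isBigO_pow_smul_of_bounded hh
    ((isBigO_one_map_two hD h₂ h₃).add (isBigO_one_map_two hD h₃ h₂)) (le_refl 5)
  have order_six := isBigO_pow_smul_of_bounded hh (isBigO_one_map_two hD h₃ h₃) (by lia : 5 ≤ 6)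
  refine ((perturb.add order_five).add order_six).congr_left fun a => ?_
  rw [map_const_two, map_const_two]
  simp only [map_two_add_left, map_two_add_right, map_two_smul_left, map_two_smul_right]
  module

theorem cubic_expansion (hh : h =O[l] fun _ => (1 : ℝ))
    {D : α → X [×3]→L[ℝ] Y} (hD : D =O[l] fun _ => (1 : ℝ))
    {w x₁ x₂ : α → X} (h₁ : x₁ =O[l] fun _ => (1 : ℝ)) (h₂ : x₂ =O[l] fun _ => (1 : ℝ))
    (hw : w =O[l] h)
    (hwx : (fun a => w a - (h a • x₁ a + h a ^ 2 • x₂ a)) =O[l] fun a => h a ^ 3) :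
    (fun a => D a ![w a, w a, w a] - (h a ^ 3 • D a ![x₁ a, x₁ a, x₁ a]
      + h a ^ 4 • (D a ![x₁ a, x₁ a, x₂ a] + D a ![x₁ a, x₂ a, x₁ a]
        + D a ![x₂ a, x₁ a, x₁ a]))) =O[l] fun a => h a ^ 5 := by
  have hp : (fun a => h a • x₁ a + h a ^ 2 • x₂ a) =O[l] h := by
    simpa using isBigO_cubic_increment hh h₁ h₂ (isBigO_zero _ _)
  have perturb := isBigO_map_diag_sub hD hw hp hwx
  have order_five := isBigO_pow_smul_of_bounded hh (((isBigO_one_map_three hD h₁ h₂ h₂).add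
    (isBigO_one_map_three hD h₂ h₁ h₂)).add (isBigO_one_map_three hD h₂ h₂ h₁)) (le_refl 5)
  have order_six := isBigO_pow_smul_of_bounded hh (isBigO_one_map_three hD h₂ h₂ h₂)
    (by lia : 5 ≤ 6)
  refine ((perturb.add order_five).add order_six).congr_left fun a => ?_
  rw [map_const_three, map_const_three]
  simp only [map_three_add_fst, map_three_add_snd, map_three_add_trd, map_three_smul_fst,
    map_three_smul_snd, map_three_smul_trd]
  module

theorem quartic_expansion {D : α → X [×4]→L[ℝ] Y} (hD : D =O[l] fun _ => (1 : ℝ))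
    {w x₁ : α → X} (h₁ : x₁ =O[l] fun _ => (1 : ℝ)) (hw : w =O[l] h)
    (hwx : (fun a => w a - h a • x₁ a) =O[l] fun a => h a ^ 2) :
    (fun a => D a ![w a, w a, w a, w a] - h a ^ 4 • D a ![x₁ a, x₁ a, x₁ a, x₁ a])
      =O[l] fun a => h a ^ 5 := by
  have hp : (fun a => h a • x₁ a) =O[l] h := by simpa using (isBigO_refl h l).smul h₁
  refine (isBigO_map_diag_sub hD hw hp hwx).congr_left fun a => ?_
  rw [map_const_four, map_const_four, map_four_smul_diag]

theorem residual_leading_term {R : α → X → Y} {D : α → X [×2]→L[ℝ] Y}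
    (hD : D =O[l] fun _ => (1 : ℝ)) {v w x : α → X} (hx : x =O[l] fun _ => (1 : ℝ))
    (hR : (fun a => R a (v a + w a) - R a (v a) - (1 / 2 : ℝ) • D a ![w a, w a])
      =O[l] fun a => h a ^ 3)
    (hw : w =O[l] h) (hwx : (fun a => w a - h a • x a) =O[l] fun a => h a ^ 2) :
    (fun a => R a (v a + w a) - R a (v a) - (h a ^ 2 / 2) • D a ![x a, x a])
      =O[l] fun a => h a ^ 3 := by
  have hp : (fun a => h a • x a) =O[l] h := by simpa using (isBigO_refl h l).smul hx
  have perturb := (isBigO_map_diag_sub hD hw hp hwx).const_smul_left (1 / 2 : ℝ)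
  refine (hR.add perturb).congr_left fun a => ?_
  rw [Pi.smul_apply, map_const_two, map_const_two, map_two_smul_left, map_two_smul_right]
  module

theorem isBigO_sub_leading_terms (hh : h =O[l] fun _ => (1 : ℝ)) {w x₁ x₂ x₃ : α → X}
    (h₁ : x₁ =O[l] fun _ => (1 : ℝ)) (h₂ : x₂ =O[l] fun _ => (1 : ℝ))
    (h₃ : x₃ =O[l] fun _ => (1 : ℝ))
    (hwx : (fun a => w a - (h a • x₁ a + h a ^ 2 • x₂ a + h a ^ 3 • x₃ a))
      =O[l] fun a => h a ^ 4) :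
    w =O[l] h ∧ (fun a => w a - h a • x₁ a) =O[l] (fun a => h a ^ 2) ∧
      (fun a => w a - (h a • x₁ a + h a ^ 2 • x₂ a)) =O[l] fun a => h a ^ 3 := by
  have third : (fun a => w a - (h a • x₁ a + h a ^ 2 • x₂ a)) =O[l] fun a => h a ^ 3 :=
    ((hwx.trans (isBigO_pow_of_le hh (by lia))).add
      (isBigO_pow_smul_of_bounded hh h₃ le_rfl)).congr_left fun a => by abel
  have second : (fun a => w a - h a • x₁ a) =O[l] fun a => h a ^ 2 :=
    ((third.trans (isBigO_pow_of_le hh (by lia))).add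
      (isBigO_pow_smul_of_bounded hh h₂ le_rfl)).congr_left fun a => by abel
  have first : w =O[l] fun a => h a ^ 1 :=
    ((second.trans (isBigO_pow_of_le hh (by lia))).add
      (isBigO_pow_smul_of_bounded hh h₁ le_rfl)).congr_left fun a => by simp
  exact ⟨by simpa only [pow_one] using first, second, third⟩

/-- The part of degree at most `4` in `h` of
`D₂ ![w, w] / 2! + D₃ ![w, w, w] / 3! + D₄ ![w, w, w, w] / 4!` for symmetric `D₂`, `D₃`, `D₄` and
`w = h x₁ + h² x₂ + h³ x₃`: the expansion of `R (v + w) - R v` for a map `R` whose derivatives at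
`v` are `0`, `D₂`, `D₃`, `D₄`. -/
def incrementPolynomial {E F : Type*} [AddCommGroup F] [Module ℝ F] (h : ℝ) (x₁ x₂ x₃ : E)
    (D₂ : (Fin 2 → E) → F) (D₃ : (Fin 3 → E) → F) (D₄ : (Fin 4 → E) → F) : F :=
  (h ^ 2 / 2) • D₂ ![x₁, x₁] + h ^ 3 • D₂ ![x₁, x₂] + (h ^ 3 / 6) • D₃ ![x₁, x₁, x₁]
    + h ^ 4 • D₂ ![x₁, x₃] + (h ^ 4 / 2) • D₂ ![x₂, x₂] + (h ^ 4 / 2) • D₃ ![x₁, x₁, x₂]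
    + (h ^ 4 / 24) • D₄ ![x₁, x₁, x₁, x₁]

theorem residual_expansion (hh : h =O[l] fun _ => (1 : ℝ)) {R : α → X → Y}
    {D₂ : α → X [×2]→L[ℝ] Y} {D₃ : α → X [×3]→L[ℝ] Y} {D₄ : α → X [×4]→L[ℝ] Y}
    (hD₂ : D₂ =O[l] fun _ => (1 : ℝ)) (hD₃ : D₃ =O[l] fun _ => (1 : ℝ))
    (hD₄ : D₄ =O[l] fun _ => (1 : ℝ))
    (swap₂ : ∀ᶠ a in l, ∀ x y, D₂ a ![x, y] = D₂ a ![y, x])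
    (swap₃_left : ∀ᶠ a in l, ∀ x y z, D₃ a ![x, y, z] = D₃ a ![y, x, z])
    (swap₃_right : ∀ᶠ a in l, ∀ x y z, D₃ a ![x, y, z] = D₃ a ![x, z, y])
    {v w x₁ x₂ x₃ : α → X} (h₁ : x₁ =O[l] fun _ => (1 : ℝ)) (h₂ : x₂ =O[l] fun _ => (1 : ℝ))
    (h₃ : x₃ =O[l] fun _ => (1 : ℝ))
    (hR : ∀ w : α → X, w =O[l] h →
      (fun a => R a (v a + w a) - R a (v a) - ((1 / 2 : ℝ) • D₂ a ![w a, w a]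
        + (1 / 6 : ℝ) • D₃ a ![w a, w a, w a] + (1 / 24 : ℝ) • D₄ a ![w a, w a, w a, w a]))
        =O[l] fun a => h a ^ 5)
    (hwx : (fun a => w a - (h a • x₁ a + h a ^ 2 • x₂ a + h a ^ 3 • x₃ a))
      =O[l] fun a => h a ^ 4) :
    (fun a => R a (v a + w a) - R a (v a)
      - incrementPolynomial (h a) (x₁ a) (x₂ a) (x₃ a) (D₂ a) (D₃ a) (D₄ a))
      =O[l] fun a => h a ^ 5 := by
  obtain ⟨hw, hwx₁, hwx₂⟩ := isBigO_sub_leading_terms hh h₁ h₂ h₃ hwx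
  have quadratic := (quadratic_expansion hh hD₂ h₁ h₂ h₃ hw hwx).const_smul_left (1 / 2 : ℝ)
  have cubic := (cubic_expansion hh hD₃ h₁ h₂ hw hwx₂).const_smul_left (1 / 6 : ℝ)
  have quartic := (quartic_expansion hD₄ h₁ hw hwx₁).const_smul_left (1 / 24 : ℝ)
  refine ((((hR w hw).add quadratic).add cubic).add quartic).congr' ?_ EventuallyEq.rfl
  filter_upwards [swap₂, swap₃_left, swap₃_right] with a s₂ s₃ s₃'
  simp only [Pi.smul_apply, incrementPolynomial]
  rw [s₂ (x₂ a) (x₁ a), s₂ (x₃ a) (x₁ a), s₃ (x₂ a) (x₁ a) (x₁ a), s₃' (x₁ a) (x₂ a) (x₁ a)]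
  module

end Expansion

/-! ### Expansion of the internal stages -/

theorem phi_map_sub [CompleteSpace X] {S : ℝ → X →L[ℝ] X} (hS : IsC0Semigroup S) {τ : ℝ}
    (hτ : 0 ≤ τ) (k : ℕ) (x y : X) :
    phi S (k + 1) τ (x - y) = phi S (k + 1) τ x - phi S (k + 1) τ y := by
  simpa only [symOp_phiSym] using symOp_map_sub hS hτ (phiSym k) x y

/-- The symbol of the remainder operator `∑ₖ g_{i1}³ p_{i1k} φ_{k+3}(g_{i1} z)` that is left when
`ψ_{i1}(g_{i1} z)` is expanded to third order. -/
def Method.psiRemSym (M : Method) (i : ℕ) : Symbol :=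
  ∑ k ∈ Finset.Icc 1 M.K,
    (M.g i 1 ^ 3 * M.p i 1 k) • Finsupp.single (k + 2, ⟨M.g i 1, M.g_nonneg i 1⟩) 1

theorem Method.symOp_psiRemSym (M : Method) (S : ℝ → X →L[ℝ] X) (h : ℝ) (i : ℕ) (x : X) :
    symOp S h (M.psiRemSym i) x
      = ∑ k ∈ Finset.Icc 1 M.K, (M.g i 1 ^ 3 * M.p i 1 k) • phi S (k + 3) (M.g i 1 * h) x := by
  have phi_eq (k : ℕ) : phi S (k + 3) (M.g i 1 * h) x
      = symOp S h (Finsupp.single (k + 2, ⟨M.g i 1, M.g_nonneg i 1⟩) 1) x :=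
    ((symOp_single S h (k + 2) ⟨M.g i 1, M.g_nonneg i 1⟩ 1 x).trans (one_smul ℝ _)).symm
  simp only [phi_eq, symOp, psiRemSym, map_sum, map_smul]

theorem Method.psi_expansion [CompleteSpace X] (M : Method) {A : X →ₗ.[ℝ] X}
    {S : ℝ → X →L[ℝ] X} (hA : IsGenerator A S) {h : ℝ} (hh : 0 ≤ h) {u₁ u₂ u₃ u₄ d : X}
    (h₁ : (u₁, u₂) ∈ A.graph) (h₂ : (u₂, u₃ - d) ∈ A.graph) (h₃ : (u₃, u₄) ∈ A.graph) (i : ℕ) :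
    M.psi S h i 1 u₁ = M.P i 1 • u₁ + (h * (M.g i 1 * M.P i 2)) • u₂
      + (h ^ 2 * (M.g i 1 ^ 2 * M.P i 3)) • u₃
      - (h ^ 2 * M.g i 1 ^ 2) • ∑ k ∈ Finset.Icc 1 M.K, M.p i 1 k • phi S (k + 2) (M.g i 1 * h) d
      + h ^ 3 • symOp S h (M.psiRemSym i) u₄ := by
  have hτ : 0 ≤ M.g i 1 * h := mul_nonneg (M.g_nonneg i 1) hh
  rw [M.symOp_psiRemSym]
  simp only [Method.psi, Method.P, Finset.sum_smul, Finset.mul_sum, Finset.smul_sum]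
  rw [← Finset.sum_add_distrib, ← Finset.sum_add_distrib, ← Finset.sum_sub_distrib,
    ← Finset.sum_add_distrib]
  refine Finset.sum_congr rfl fun k hk => ?_
  obtain ⟨k, rfl⟩ := Nat.exists_eq_add_of_le' (Finset.mem_Icc.1 hk).1
  have expand₁ := hA.phi_eq_add_smul_phi_succ h₁ k hτ
  have expand₂ := hA.phi_eq_add_smul_phi_succ h₂ (k + 1) hτ
  have expand₃ := hA.phi_eq_add_smul_phi_succ h₃ (k + 2) hτ
  rw [phi_map_sub hA.semigroup hτ] at expand₂
  simp only [add_assoc, Nat.reduceAdd] at expand₁ expand₂ expand₃ ⊢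
  simp only [show k + 2 - 1 = k + 1 by lia, show k + 3 - 1 = k + 2 by lia,
    show k + 4 - 1 = k + 3 by lia]
  rw [expand₁, expand₂, expand₃]
  simp only [div_eq_mul_inv]
  module

theorem Method.stage_sub_eq [CompleteSpace X] (M : Method) {A : X →ₗ.[ℝ] X}
    {S : ℝ → X →L[ℝ] X} (hA : IsGenerator A S) {h : ℝ} (hh : 0 ≤ h) {u₁ u₂ u₃ u₄ d : X}
    (h₁ : (u₁, u₂) ∈ A.graph) (h₂ : (u₂, u₃ - d) ∈ A.graph) (h₃ : (u₃, u₄) ∈ A.graph)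
    (R : X → X) (v : X) (i : ℕ) :
    M.stage S h u₁ R v i - v - (h • ((M.α i 1 * M.P i 1) • u₁)
        + h ^ 2 • ((M.α i 1 * M.g i 1 * M.P i 2) • u₂)
        + h ^ 3 • ((M.α i 1 * M.g i 1 ^ 2 * M.P i 3) • u₃ + M.Psi S h i d))
      = h • ∑ j ∈ Finset.Ico 2 i, symOp S h (M.aSym i j)
          (R (M.stage S h u₁ R v j) - R v - (h ^ 2 / 2) • (M.α j 1 ^ 2 * M.P j 1 ^ 2) • d)
        + h ^ 4 • M.α i 1 • symOp S h (M.psiRemSym i) u₄ := by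
  rw [Method.stage, M.psi_expansion hA hh h₁ h₂ h₃,
    Finset.sum_attach (Finset.Ico 2 i) fun j => M.a S h i j (R (M.stage S h u₁ R v j) - R v)]
  simp only [← Method.symOp_aSym, symOp_map_sub hA.semigroup hh, symOp_map_smul hA.semigroup hh,
    Finset.sum_sub_distrib, Method.Psi, ← Finset.smul_sum]
  module

section Asymptotic

open Asymptotics

variable {α : Type*} {l : Filter α} {h : α → ℝ} {S : α → ℝ → X →L[ℝ] X}

/-- A family of strongly continuous semigroups with a common exponential bound, together with
step sizes in `(0, 1]`. The entries of the family matter only eventually along the filter `l`. -/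
structure UniformFamily (l : Filter α) (h : α → ℝ) (S : α → ℝ → X →L[ℝ] X) : Prop where
  pos : ∀ᶠ a in l, 0 < h a
  le_one : ∀ᶠ a in l, h a ≤ 1
  semigroup : ∀ᶠ a in l, IsC0Semigroup (S a)
  bound : ∃ C ω : ℝ, 0 ≤ ω ∧ ∀ᶠ a in l, ∀ t, 0 ≤ t → ‖S a t‖ ≤ C * Real.exp (ω * t)

theorem UniformFamily.step_isBigO (H : UniformFamily l h S) : h =O[l] fun _ => (1 : ℝ) := by
  refine IsBigO.of_bound 1 ?_
  filter_upwards [H.pos, H.le_one] with a h_pos h_le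
  rw [Real.norm_of_nonneg h_pos.le]
  simpa using h_le

theorem UniformFamily.symOp_isBigO (H : UniformFamily l h S) (σ : Symbol) {f : α → X} {g : α → ℝ}
    (hf : f =O[l] g) : (fun a => symOp (S a) (h a) σ (f a)) =O[l] g := by
  obtain ⟨C, ω, hω, hS⟩ := H.bound
  obtain ⟨D, -, hD⟩ := exists_norm_symOp_le (X := X) σ C hω
  refine IsBigO.trans (IsBigO.of_bound D ?_) hf
  filter_upwards [H.pos, H.le_one, hS] with a h_pos h_le hSa
  exact hD (S a) hSa (h a) ⟨h_pos.le, h_le⟩ (f a)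

variable [CompleteSpace X]

theorem Method.stage_expansion (M : Method) (H : UniformFamily l h S) {A : α → X →ₗ.[ℝ] X}
    (hA : ∀ᶠ a in l, IsGenerator (A a) (S a)) {u₁ u₂ u₃ u₄ v : α → X} {R : α → X → X}
    {D : α → X [×2]→L[ℝ] X} (hu₁ : u₁ =O[l] fun _ => (1 : ℝ)) (hu₂ : u₂ =O[l] fun _ => (1 : ℝ))
    (hu₃ : u₃ =O[l] fun _ => (1 : ℝ)) (hu₄ : u₄ =O[l] fun _ => (1 : ℝ))
    (hD : D =O[l] fun _ => (1 : ℝ)) (h₁ : ∀ᶠ a in l, (u₁ a, u₂ a) ∈ (A a).graph)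
    (h₂ : ∀ᶠ a in l, (u₂ a, u₃ a - D a ![u₁ a, u₁ a]) ∈ (A a).graph)
    (h₃ : ∀ᶠ a in l, (u₃ a, u₄ a) ∈ (A a).graph)
    (hR : ∀ w : α → X, w =O[l] h →
      (fun a => R a (v a + w a) - R a (v a) - (1 / 2 : ℝ) • D a ![w a, w a])
        =O[l] fun a => h a ^ 3) (i : ℕ) :
    (fun a => M.stage (S a) (h a) (u₁ a) (R a) (v a) i - v a
      - (h a • ((M.α i 1 * M.P i 1) • u₁ a)
        + h a ^ 2 • ((M.α i 1 * M.g i 1 * M.P i 2) • u₂ a)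
        + h a ^ 3 • ((M.α i 1 * M.g i 1 ^ 2 * M.P i 3) • u₃ a
          + M.Psi (S a) (h a) i (D a ![u₁ a, u₁ a])))) =O[l] fun a => h a ^ 4 := by
  have hh := H.step_isBigO
  have hd := isBigO_one_map_two hD hu₁ hu₁
  induction i using Nat.strong_induction_on with
  | _ i ih =>
  have residual : ∀ j ∈ Finset.Ico 2 i, (fun a =>
      R a (M.stage (S a) (h a) (u₁ a) (R a) (v a) j) - R a (v a)
        - (h a ^ 2 / 2) • (M.α j 1 ^ 2 * M.P j 1 ^ 2) • D a ![u₁ a, u₁ a])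
      =O[l] fun a => h a ^ 3 := fun j hj => by
    have hPsi : (fun a => M.Psi (S a) (h a) j (D a ![u₁ a, u₁ a])) =O[l] fun _ => (1 : ℝ) := by
      simpa only [Method.symOp_PsiSym] using H.symOp_isBigO (M.PsiSym j) hd
    have hx₁ := hu₁.const_smul_left (M.α j 1 * M.P j 1)
    obtain ⟨hw, hwx, -⟩ := isBigO_sub_leading_terms hh hx₁ (hu₂.const_smul_left _)
      ((hu₃.const_smul_left _).add hPsi) (ih j (Finset.mem_Ico.1 hj).2)
    refine (residual_leading_term hD hx₁ (hR _ hw) hw hwx).congr_left fun a => ?_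
    simp only [add_sub_cancel, Pi.smul_apply, map_two_smul_left, map_two_smul_right]
    module
  have stages := isBigO_pow_smul 1
    (IsBigO.fun_sum fun j hj => H.symOp_isBigO (M.aSym i j) (residual j hj))
  have remainder := isBigO_pow_smul_of_bounded hh
    ((H.symOp_isBigO (M.psiRemSym i) hu₄).const_smul_left (M.α i 1)) (le_refl 4)
  refine (stages.add remainder).congr' ?_ EventuallyEq.rfl
  filter_upwards [H.pos, hA, h₁, h₂, h₃] with a h_pos hAa graph₁ graph₂ graph₃
  rw [M.stage_sub_eq hAa h_pos.le graph₁ graph₂ graph₃, pow_one, Pi.smul_apply]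

end Asymptotic

/-! ### Uniform asymptotics along the solution -/

section StepFilter

open Asymptotics

/-- The filter of pairs `(h, t)` with `h ↓ 0`, uniformly in `t ∈ I`, subject to `(h, t) ∈ Q`. -/
def stepFilter (I : Set ℝ) (Q : Set (ℝ × ℝ)) : Filter (ℝ × ℝ) := (𝓝[>] 0 ×ˢ 𝓟 I) ⊓ 𝓟 Q

/-- The pairs `(h, t)` for which the step from `t` to `t + h` ends before time `T`. -/
def admissibleSteps (T : ℝ) : Set (ℝ × ℝ) := {a | a.2 + a.1 ≤ T}

variable {I : Set ℝ} {Q : Set (ℝ × ℝ)}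

theorem eventually_stepFilter_iff {P : ℝ × ℝ → Prop} :
    (∀ᶠ a in stepFilter I Q, P a) ↔
      ∃ h₀, 0 < h₀ ∧ ∀ t ∈ I, ∀ h, 0 < h → h ≤ h₀ → (h, t) ∈ Q → P (h, t) := by
  rw [stepFilter, eventually_inf_principal, eventually_prod_principal_iff, Filter.Eventually,
    mem_nhdsGT_iff_exists_Ioc_subset]
  constructor
  · rintro ⟨h₀, h₀_pos, subset⟩
    exact ⟨h₀, h₀_pos, fun t ht h h_pos h_le hQ => subset ⟨h_pos, h_le⟩ t ht hQ⟩
  · rintro ⟨h₀, h₀_pos, holds⟩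
    exact ⟨h₀, h₀_pos, fun h hh t ht hQ => holds t ht h hh.1 hh.2 hQ⟩

theorem isBigO_stepFilter_iff {E : Type*} [NormedAddCommGroup E] {f : ℝ × ℝ → E} {m : ℕ} :
    f =O[stepFilter I Q] (fun a => a.1 ^ m) ↔
      ∃ C h₀ : ℝ, 0 < h₀ ∧ ∀ t ∈ I, ∀ h, 0 < h → h ≤ h₀ → (h, t) ∈ Q →
        ‖f (h, t)‖ ≤ C * h ^ m := by
  simp only [isBigO_iff, eventually_stepFilter_iff]
  refine exists₂_congr fun C h₀ => and_congr_right fun _ => forall₅_congr fun t _ h h_pos _ => ?_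
  rw [Real.norm_of_nonneg (pow_nonneg h_pos.le m)]

theorem exists_bound_of_forall_isBigO_stepFilter {ι E : Type*} [NormedAddCommGroup E] {s : Finset ι}
    {f : ι → ℝ × ℝ → E} {m : ℕ}
    (hf : ∀ i ∈ s, f i =O[stepFilter I univ] fun a => a.1 ^ m) :
    ∃ C h₀ : ℝ, 0 < h₀ ∧ ∀ t ∈ I, ∀ h : ℝ, 0 < h → h ≤ h₀ → ∀ i ∈ s,
      ‖f i (h, t)‖ ≤ C * h ^ m := by
  have total : (fun a => ∑ i ∈ s, ‖f i a‖) =O[stepFilter I univ] fun a => a.1 ^ m :=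
    IsBigO.fun_sum fun i hi => (hf i hi).norm_left
  obtain ⟨C, h₀, h₀_pos, bound⟩ := isBigO_stepFilter_iff.1 total
  refine ⟨C, h₀, h₀_pos, fun t ht h h_pos h_le i hi => ?_⟩
  calc ‖f i (h, t)‖ ≤ ∑ j ∈ s, ‖f j (h, t)‖ :=
        Finset.single_le_sum (f := fun j => ‖f j (h, t)‖) (fun j _ => norm_nonneg _) hi
    _ ≤ C * h ^ m := (le_abs_self _).trans (bound t ht h h_pos h_le (mem_univ _))

theorem tendsto_fst_stepFilter : Tendsto Prod.fst (stepFilter I Q) (𝓝 (0 : ℝ)) :=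
  (tendsto_fst.mono_left inf_le_left).mono_right nhdsWithin_le_nhds

theorem eventually_mem_stepFilter : ∀ᶠ a in stepFilter I Q, 0 < a.1 ∧ a.1 ≤ 1 ∧ a.2 ∈ I :=
  eventually_stepFilter_iff.2 ⟨1, one_pos, fun _ ht _ h_pos h_le _ => ⟨h_pos, h_le, ht⟩⟩

theorem isBigO_one_fst_stepFilter : Prod.fst =O[stepFilter I Q] fun _ => (1 : ℝ) :=
  tendsto_fst_stepFilter.isBigO_one ℝ

theorem isBigO_one_snd_stepFilter {E : Type*} [NormedAddCommGroup E] {f : ℝ → E}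
    (hf : ∃ C, ∀ t ∈ I, ‖f t‖ ≤ C) :
    (fun a : ℝ × ℝ => f a.2) =O[stepFilter I Q] fun _ => (1 : ℝ) := by
  obtain ⟨C, hC⟩ := hf
  refine IsBigO.of_bound C ?_
  filter_upwards [eventually_mem_stepFilter] with a ⟨_, _, ht⟩
  simpa using hC a.2 ht

end StepFilter

section AlongSolution

open Asymptotics

variable {N : X → X} {t₀ T : ℝ} {u : ℝ → X} {δ : ℝ} {Q : Set (ℝ × ℝ)}

theorem isBigO_iteratedDerivWithin (hT : t₀ < T) {n : ℕ} (hu : ContDiffOn ℝ n u (Icc t₀ T))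
    {k : ℕ} (hk : k ≤ n) :
    (fun a : ℝ × ℝ => iteratedDerivWithin k u (Icc t₀ T) a.2)
      =O[stepFilter (Icc t₀ T) Q] fun _ => (1 : ℝ) :=
  isBigO_one_snd_stepFilter <| isCompact_Icc.exists_bound_of_continuousOn <|
    hu.continuousOn_iteratedDerivWithin (by exact_mod_cast hk) (uniqueDiffOn_Icc hT)

theorem continuousOn_iteratedFDeriv_comp (hδ : 0 < δ) (huc : ContinuousOn u (Icc t₀ T)) {k : ℕ}
    (hN : ContDiffOn ℝ k N (strip t₀ T u δ)) :
    ContinuousOn (fun t => iteratedFDeriv ℝ k N (u t)) (Icc t₀ T) := fun t ht =>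
  ((contDiffAt_of_strip hδ hN ht).iteratedFDeriv_right (i := k) (m := 0)
    (by rw [zero_add])).continuousAt.comp_continuousWithinAt (f := u) (huc t ht)

theorem isBigO_iteratedFDeriv_Ntilde (hδ : 0 < δ) (huc : ContinuousOn u (Icc t₀ T)) {k : ℕ}
    (hN : ContDiffOn ℝ (k + 2 : ℕ) N (strip t₀ T u δ)) :
    (fun a : ℝ × ℝ => iteratedFDeriv ℝ (k + 2) (Ntilde N (u a.2)) (u a.2))
      =O[stepFilter (Icc t₀ T) Q] fun _ => (1 : ℝ) := by
  refine (isBigO_one_snd_stepFilter (isCompact_Icc.exists_bound_of_continuousOn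
    (continuousOn_iteratedFDeriv_comp hδ huc hN))).congr' ?_ EventuallyEq.rfl
  filter_upwards [eventually_mem_stepFilter] with a ⟨_, _, ht⟩
  exact (iteratedFDeriv_Ntilde (contDiffAt_of_strip hδ hN ht)).symm

section Semigroup

variable {L : X →ₗ.[ℝ] X}

theorem isGenerator_expSemigroup {A : X →ₗ.[ℝ] X} (hA : ∃ S, IsGenerator A S) :
    IsGenerator A (expSemigroup A) := by
  rw [expSemigroup, dif_pos hA]
  exact hA.choose_spec

theorem exists_expJ_bound [CompleteSpace X] (hL : ∃ S : ℝ → X →L[ℝ] X, IsGenerator L S)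
    (hδ : 0 < δ) (huc : ContinuousOn u (Icc t₀ T)) (hN : ContDiffOn ℝ 1 N (strip t₀ T u δ)) :
    ∃ C ω : ℝ, 0 ≤ ω ∧ ∀ t ∈ Icc t₀ T,
      IsGenerator (jacobian L N (u t)) (Method.expJ L N u t) ∧
      ∀ s, 0 ≤ s → ‖Method.expJ L N u t s‖ ≤ C * Real.exp (ω * s) := by
  obtain ⟨S, hS⟩ := hL
  have hcont : ContinuousOn (fun t => fderiv ℝ N (u t)) (Icc t₀ T) := fun t ht =>
    ((contDiffAt_of_strip hδ hN ht).fderiv_right (m := 0)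
      (by norm_num)).continuousAt.comp_continuousWithinAt (f := u) (huc t ht)
  obtain ⟨R, hR⟩ := isCompact_Icc.exists_bound_of_continuousOn hcont
  obtain ⟨C, ω, hω, perturbation⟩ := hS.exists_vadd R
  refine ⟨C, ω, hω, fun t ht => ?_⟩
  obtain ⟨W, hW, hbound⟩ := perturbation (fderiv ℝ N (u t)) (hR t ht)
  have hgen : IsGenerator (jacobian L N (u t)) (Method.expJ L N u t) :=
    isGenerator_expSemigroup ⟨W, hW⟩
  exact ⟨hgen, fun s hs => hgen.semigroup_unique hW hs ▸ hbound s hs⟩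

theorem uniformFamily_expJ {I : Set ℝ} {C ω : ℝ} (hω : 0 ≤ ω)
    (H : ∀ t ∈ I, IsGenerator (jacobian L N (u t)) (Method.expJ L N u t) ∧
      ∀ s, 0 ≤ s → ‖Method.expJ L N u t s‖ ≤ C * Real.exp (ω * s)) :
    UniformFamily (stepFilter I Q) Prod.fst (fun a => Method.expJ L N u a.2) where
  pos := eventually_mem_stepFilter.mono fun _ ha => ha.1
  le_one := eventually_mem_stepFilter.mono fun _ ha => ha.2.1
  semigroup := eventually_mem_stepFilter.mono fun a ha => (H a.2 ha.2.2).1.semigroup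
  bound := ⟨C, ω, hω, eventually_mem_stepFilter.mono fun a ha => (H a.2 ha.2.2).2⟩

end Semigroup

variable [CompleteSpace X]

theorem taylor_isBigO (hδ : 0 < δ) (huc : ContinuousOn u (Icc t₀ T)) {n : ℕ}
    (hN : ContDiffOn ℝ (n + 1) N (strip t₀ T u δ)) {w : ℝ × ℝ → X}
    (hw : w =O[stepFilter (Icc t₀ T) Q] Prod.fst) :
    (fun a => N (u a.2 + w a) - ∑ k ∈ Finset.range (n + 1),
      (k.factorial : ℝ)⁻¹ • iteratedFDeriv ℝ k N (u a.2) (fun _ => w a))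
      =O[stepFilter (Icc t₀ T) Q] fun a => a.1 ^ (n + 1) := by
  obtain ⟨ε, hε, C, hC⟩ := exists_taylor_bound_near_compact
    (isCompact_Icc.image_of_continuousOn huc) (isOpen_strip t₀ T δ u) (subset_strip hδ u) hN
  have small : ∀ᶠ a in stepFilter (Icc t₀ T) Q, ‖w a‖ ≤ ε := by
    have := (hw.trans_tendsto tendsto_fst_stepFilter).norm
    rw [norm_zero] at this
    exact this.eventually_le_const hε
  refine (IsBigO.of_bound C ?_).trans (hw.norm_left.pow (n + 1))
  filter_upwards [small, eventually_mem_stepFilter] with a hsmall ⟨_, _, ht⟩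
  rw [Real.norm_of_nonneg (by positivity)]
  exact hC (u a.2) (mem_image_of_mem u ht) (w a) hsmall

theorem Ntilde_taylor_three (hδ : 0 < δ) (huc : ContinuousOn u (Icc t₀ T))
    (hN : ContDiffOn ℝ 3 N (strip t₀ T u δ)) {w : ℝ × ℝ → X}
    (hw : w =O[stepFilter (Icc t₀ T) Q] Prod.fst) :
    (fun a => Ntilde N (u a.2) (u a.2 + w a) - Ntilde N (u a.2) (u a.2)
      - (1 / 2 : ℝ) • iteratedFDeriv ℝ 2 (Ntilde N (u a.2)) (u a.2) ![w a, w a])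
      =O[stepFilter (Icc t₀ T) Q] fun a => a.1 ^ 3 := by
  refine (taylor_isBigO (n := 2) hδ huc (by norm_num; exact hN) hw).congr' ?_ EventuallyEq.rfl
  filter_upwards [eventually_mem_stepFilter] with a ⟨_, _, ht⟩
  have hNt := contDiffAt_of_strip hδ hN ht
  rw [iteratedFDeriv_Ntilde (k := 0) (hNt.of_le (by norm_num)), Ntilde_sub_eq]
  simp only [Finset.sum_range_succ, Finset.sum_range_zero, iteratedFDeriv_zero_apply,
    iteratedFDeriv_one_apply, map_const_two, Nat.factorial, zero_add]
  norm_num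
  module

theorem Ntilde_taylor_five (hδ : 0 < δ) (huc : ContinuousOn u (Icc t₀ T))
    (hN : ContDiffOn ℝ 5 N (strip t₀ T u δ)) {w : ℝ × ℝ → X}
    (hw : w =O[stepFilter (Icc t₀ T) Q] Prod.fst) :
    (fun a => Ntilde N (u a.2) (u a.2 + w a) - Ntilde N (u a.2) (u a.2)
      - ((1 / 2 : ℝ) • iteratedFDeriv ℝ 2 (Ntilde N (u a.2)) (u a.2) ![w a, w a]
        + (1 / 6 : ℝ) • iteratedFDeriv ℝ 3 (Ntilde N (u a.2)) (u a.2) ![w a, w a, w a]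
        + (1 / 24 : ℝ) • iteratedFDeriv ℝ 4 (Ntilde N (u a.2)) (u a.2) ![w a, w a, w a, w a]))
      =O[stepFilter (Icc t₀ T) Q] fun a => a.1 ^ 5 := by
  refine (taylor_isBigO (n := 4) hδ huc (by norm_num; exact hN) hw).congr' ?_ EventuallyEq.rfl
  filter_upwards [eventually_mem_stepFilter] with a ⟨_, _, ht⟩
  have hNt := contDiffAt_of_strip hδ hN ht
  rw [iteratedFDeriv_Ntilde (k := 0) (hNt.of_le (by norm_num)),
    iteratedFDeriv_Ntilde (k := 1) (hNt.of_le (by norm_num)),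
    iteratedFDeriv_Ntilde (k := 2) (hNt.of_le (by norm_num)), Ntilde_sub_eq]
  simp only [Finset.sum_range_succ, Finset.sum_range_zero, iteratedFDeriv_zero_apply,
    iteratedFDeriv_one_apply, map_const_two, map_const_three, map_const_four, Nat.factorial,
    zero_add]
  norm_num
  module

theorem residual_expansion_along (hδ : 0 < δ) (huc : ContinuousOn u (Icc t₀ T))
    (hN : ContDiffOn ℝ 5 N (strip t₀ T u δ)) {w x₁ x₂ x₃ : ℝ × ℝ → X}
    (h₁ : x₁ =O[stepFilter (Icc t₀ T) Q] fun _ => (1 : ℝ))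
    (h₂ : x₂ =O[stepFilter (Icc t₀ T) Q] fun _ => (1 : ℝ))
    (h₃ : x₃ =O[stepFilter (Icc t₀ T) Q] fun _ => (1 : ℝ))
    (hw : (fun a => w a - (a.1 • x₁ a + a.1 ^ 2 • x₂ a + a.1 ^ 3 • x₃ a))
      =O[stepFilter (Icc t₀ T) Q] fun a => a.1 ^ 4) :
    (fun a => Ntilde N (u a.2) (u a.2 + w a) - Ntilde N (u a.2) (u a.2)
      - incrementPolynomial a.1 (x₁ a) (x₂ a) (x₃ a)
        (iteratedFDeriv ℝ 2 (Ntilde N (u a.2)) (u a.2))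
        (iteratedFDeriv ℝ 3 (Ntilde N (u a.2)) (u a.2))
        (iteratedFDeriv ℝ 4 (Ntilde N (u a.2)) (u a.2)))
      =O[stepFilter (Icc t₀ T) Q] fun a => a.1 ^ 5 := by
  have hNt : ∀ᶠ a in stepFilter (Icc t₀ T) Q, ContDiffAt ℝ 3 (Ntilde N (u a.2)) (u a.2) :=
    eventually_mem_stepFilter.mono fun a ⟨_, _, ht⟩ =>
      ((contDiffAt_of_strip hδ hN ht).of_le (by norm_num)).sub
        (fderiv ℝ N (u a.2)).contDiff.contDiffAt
  exact residual_expansion (R := fun a => Ntilde N (u a.2)) (v := fun a => u a.2)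
    isBigO_one_fst_stepFilter
    (isBigO_iteratedFDeriv_Ntilde (k := 0) hδ huc (hN.of_le (by norm_num)))
    (isBigO_iteratedFDeriv_Ntilde (k := 1) hδ huc (hN.of_le (by norm_num)))
    (isBigO_iteratedFDeriv_Ntilde (k := 2) hδ huc (hN.of_le (by norm_num)))
    (hNt.mono fun a ha x y => iteratedFDeriv_two_swap (ha.of_le (by norm_num)) x y)
    (hNt.mono fun a ha x y z => iteratedFDeriv_three_swap_left ha x y z)
    (hNt.mono fun a ha x y z => iteratedFDeriv_three_swap_right ha x y z)
    h₁ h₂ h₃ (fun _ => Ntilde_taylor_five hδ huc hN) hw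

end AlongSolution

/-! ### One step of the method and of the exact flow -/

/-- The derivatives of order `2`, `3`, `4` of `τ ↦ R (u (t + τ))` at `τ = 0` by the chain rule,
where `u₁`, `u₂`, `u₃` are the derivatives of `u` at `t` and `0`, `D₂`, `D₃`, `D₄` those of `R` at
`u t`. The value at any other order is the junk value `0`. -/
def residualDeriv {E F : Type*} [AddCommGroup F] [Module ℝ F] (u₁ u₂ u₃ : E)
    (D₂ : (Fin 2 → E) → F) (D₃ : (Fin 3 → E) → F) (D₄ : (Fin 4 → E) → F) : ℕ → F
  | 2 => D₂ ![u₁, u₁]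
  | 3 => (3 : ℝ) • D₂ ![u₁, u₂] + D₃ ![u₁, u₁, u₁]
  | 4 => (4 : ℝ) • D₂ ![u₁, u₃] + (3 : ℝ) • D₂ ![u₂, u₂] + (6 : ℝ) • D₃ ![u₁, u₁, u₂]
      + D₄ ![u₁, u₁, u₁, u₁]
  | _ => 0

theorem sum_Icc_two_four {E : Type*} [AddCommMonoid E] (f : ℕ → E) :
    ∑ k ∈ Finset.Icc 2 4, f k = f 2 + f 3 + f 4 := by
  simp [Finset.sum_Icc_succ_top]

theorem incrementPolynomial_eq_sum_residualDeriv {Y : Type*} [NormedAddCommGroup Y]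
    [NormedSpace ℝ Y] (h : ℝ) (u₁ u₂ u₃ : X) (D₂ : X [×2]→L[ℝ] Y) (D₃ : X [×3]→L[ℝ] Y)
    (D₄ : X [×4]→L[ℝ] Y) :
    incrementPolynomial h u₁ ((1 / 2 : ℝ) • u₂) ((1 / 6 : ℝ) • u₃) D₂ D₃ D₄
      = ∑ k ∈ Finset.Icc 2 4, (h ^ k / (k.factorial : ℝ)) • residualDeriv u₁ u₂ u₃ D₂ D₃ D₄ k := by
  rw [sum_Icc_two_four]
  simp only [incrementPolynomial, residualDeriv, map_two_smul_left, map_two_smul_right,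
    map_three_smul_trd, Nat.factorial]
  push_cast
  module

theorem IsC0Semigroup.integral_sub_sum_pow_smul [CompleteSpace X] {S : ℝ → X →L[ℝ] X}
    (hS : IsC0Semigroup S) {h : ℝ} (hh : 0 ≤ h) {R : ℝ → X} (hR : ContinuousOn R (Icc 0 h))
    (s : Finset ℕ) (c : ℕ → X) :
    ∫ τ in (0 : ℝ)..h, S (h - τ) (R τ - ∑ k ∈ s, (τ ^ k / (k.factorial : ℝ)) • c k)
      = (∫ τ in (0 : ℝ)..h, S (h - τ) (R τ))
        - ∑ k ∈ s, h ^ (k + 1) • phi S (k + 1) h (c k) := by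
  have integrable_monomial (k : ℕ) := hS.intervalIntegrable_convolution hh
    (w := fun τ => (τ ^ k / (k.factorial : ℝ)) • c k) (by fun_prop)
  have integrable_sum := IntervalIntegrable.sum s fun k _ => integrable_monomial k
  rw [Finset.sum_fn] at integrable_sum
  simp only [map_sub, map_sum]
  rw [intervalIntegral.integral_sub (hS.intervalIntegrable_convolution hh hR) integrable_sum,
    intervalIntegral.integral_finsetSum fun k _ => integrable_monomial k]
  simp only [integral_pow_smul_eq_phi]

theorem norm_integral_convolution_le {S : ℝ → X →L[ℝ] X} {C ω : ℝ} (hω : 0 ≤ ω)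
    (hS : ∀ τ, 0 ≤ τ → ‖S τ‖ ≤ C * Real.exp (ω * τ)) {h : ℝ} (hh : 0 ≤ h) (hh₁ : h ≤ 1)
    {R : ℝ → X} {B : ℝ} {n : ℕ} (hR : ∀ τ ∈ Ioc 0 h, ‖R τ‖ ≤ B * τ ^ n) :
    ‖∫ τ in (0 : ℝ)..h, S (h - τ) (R τ)‖ ≤ |C| * Real.exp ω * |B| * h ^ (n + 1) := by
  have integrand_le : ∀ τ ∈ uIoc 0 h, ‖S (h - τ) (R τ)‖ ≤ |C| * Real.exp ω * |B| * h ^ n := by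
    intro τ hτ
    rw [uIoc_of_le hh] at hτ
    have semigroup_le : ‖S (h - τ)‖ ≤ |C| * Real.exp ω :=
      (hS (h - τ) (sub_nonneg.2 hτ.2)).trans (by
        gcongr
        · exact le_abs_self C
        · nlinarith [hτ.1])
    have residual_le : ‖R τ‖ ≤ |B| * h ^ n :=
      (hR τ hτ).trans (mul_le_mul (le_abs_self B) (pow_le_pow_left₀ hτ.1.le hτ.2 n)
        (pow_nonneg hτ.1.le n) (abs_nonneg B))
    simpa only [mul_assoc] using
      (S (h - τ)).le_of_opNorm_le_of_le semigroup_le residual_le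
  refine (intervalIntegral.norm_integral_le_of_norm_le_const integrand_le).trans_eq ?_
  rw [sub_zero, abs_of_nonneg hh, pow_succ]
  ring

section ExactStep

variable {L : X →ₗ.[ℝ] X} {N : X → X} {t₀ T : ℝ} {u₀ : X} {u : ℝ → X} {δ : ℝ}

theorem IsSolution.continuousOn_shift (hu : IsSolution L N t₀ T u₀ u) {t h : ℝ}
    (ht : t ∈ Icc t₀ T) (hth : t + h ≤ T) : ContinuousOn (fun τ => u (t + τ)) (Icc 0 h) :=
  ContinuousOn.comp (fun r hr => (hu.hasDeriv r hr).continuousWithinAt) (by fun_prop)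
    fun τ hτ => ⟨by linarith [ht.1, hτ.1], by linarith [hτ.2]⟩

theorem IsSolution.continuousOn_residual (hu : IsSolution L N t₀ T u₀ u) (hδ : 0 < δ)
    (hN : ContDiffOn ℝ 1 N (strip t₀ T u δ)) {t h : ℝ} (ht : t ∈ Icc t₀ T) (hth : t + h ≤ T) :
    ContinuousOn (fun τ => Ntilde N (u t) (u (t + τ)) - Ntilde N (u t) (u t)) (Icc 0 h) := by
  have shift := hu.continuousOn_shift ht hth
  have nonlinearity : ContinuousOn (fun τ => N (u (t + τ))) (Icc 0 h) :=
    hN.continuousOn.comp shift fun τ hτ => subset_strip hδ u <| mem_image_of_mem u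
      ⟨by linarith [ht.1, hτ.1], by linarith [hτ.2]⟩
  exact (nonlinearity.sub ((fderiv ℝ N (u t)).continuous.comp_continuousOn shift)).sub
    continuousOn_const

theorem IsSolution.hasDerivWithinAt_shift_Ioi (hu : IsSolution L N t₀ T u₀ u) {t τ : ℝ}
    (ht : t + τ ∈ Ico t₀ T) :
    HasDerivWithinAt (fun τ => u (t + τ)) (rhs L N (u (t + τ))) (Ioi τ) τ := by
  have right_deriv : HasDerivWithinAt u (rhs L N (u (t + τ))) (Ioi (t + τ)) (t + τ) :=
    (hu.hasDeriv _ (Ico_subset_Icc_self ht)).mono_of_mem_nhdsWithin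
      (mem_of_superset (Ioc_mem_nhdsGT ht.2) fun _ hr => ⟨ht.1.trans hr.1.le, hr.2⟩)
  simpa only [one_smul] using! right_deriv.scomp τ
    ((hasDerivAt_id τ).const_add t).hasDerivWithinAt fun r hr => by simpa using hr

theorem IsSolution.sub_eq_smul_phi_one_add_integral [CompleteSpace X]
    (hu : IsSolution L N t₀ T u₀ u) (hδ : 0 < δ) (hN : ContDiffOn ℝ 1 N (strip t₀ T u δ))
    {t : ℝ} (ht : t ∈ Icc t₀ T) {S : ℝ → X →L[ℝ] X}
    (hJ : IsGenerator (jacobian L N (u t)) S) {h : ℝ} (hh : 0 ≤ h) (hth : t + h ≤ T) :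
    u (t + h) - u t = h • phi S 1 h (rhs L N (u t))
      + ∫ τ in (0 : ℝ)..h, S (h - τ) (Ntilde N (u t) (u (t + τ)) - Ntilde N (u t) (u t)) := by
  have residual := hu.continuousOn_residual hδ hN ht hth
  have voc := hJ.variation_of_constants hh (w := fun τ => u (t + τ) - u t)
    (F := fun τ => rhs L N (u t) + (Ntilde N (u t) (u (t + τ)) - Ntilde N (u t) (u t)))
    ((hu.continuousOn_shift ht hth).sub continuousOn_const) (continuousOn_const.add residual)
    fun τ hτ => by
      have hτt : t + τ ∈ Ico t₀ T := ⟨by linarith [ht.1, hτ.1], by linarith [hτ.2]⟩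
      refine ⟨rhs L N (u (t + τ)) - N (u (t + τ)) - (rhs L N (u t) - N (u t))
        + fderiv ℝ N (u t) (u (t + τ) - u t), mem_graph_vadd_iff.2 ?_, ?_⟩
      · rw [add_sub_cancel_right]
        exact L.graph.sub_mem (hu.mem_graph (Ico_subset_Icc_self hτt)) (hu.mem_graph ht)
      · refine ((hu.hasDerivWithinAt_shift_Ioi hτt).sub_const (u t)).congr_deriv ?_
        simp only [Ntilde, map_sub]
        abel
  simp only [add_zero, sub_self, ContinuousLinearMap.map_zero, zero_add,
    ContinuousLinearMap.map_add] at voc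
  rw [voc, intervalIntegral.integral_add
    (hJ.semigroup.intervalIntegrable_convolution hh continuousOn_const)
    (hJ.semigroup.intervalIntegrable_convolution hh residual)]
  simpa using integral_pow_smul_eq_phi S 0 h (rhs L N (u t))

end ExactStep

section OneStep

open Asymptotics

variable [CompleteSpace X] {L : X →ₗ.[ℝ] X} {N : X → X} {t₀ T : ℝ} {u₀ : X} {u : ℝ → X} {δ : ℝ}
  {Q : Set (ℝ × ℝ)}

theorem Method.Uhat_expansion (M : Method) (hL : ∃ S : ℝ → X →L[ℝ] X, IsGenerator L S)
    (hT : t₀ < T) (hu : IsSolution L N t₀ T u₀ u) (hu_smooth : ContDiffOn ℝ 4 u (Icc t₀ T))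
    (hδ : 0 < δ) (hN : ContDiffOn ℝ 3 N (strip t₀ T u δ)) (i : ℕ) :
    (fun a : ℝ × ℝ => M.Uhat L N u a.2 a.1 i - u a.2
      - (a.1 • ((M.α i 1 * M.P i 1) • iteratedDerivWithin 1 u (Icc t₀ T) a.2)
        + a.1 ^ 2 • ((M.α i 1 * M.g i 1 * M.P i 2) • iteratedDerivWithin 2 u (Icc t₀ T) a.2)
        + a.1 ^ 3 • ((M.α i 1 * M.g i 1 ^ 2 * M.P i 3) • iteratedDerivWithin 3 u (Icc t₀ T) a.2
          + M.Psi (Method.expJ L N u a.2) a.1 i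
            (iteratedFDeriv ℝ 2 (Ntilde N (u a.2)) (u a.2)
              ![iteratedDerivWithin 1 u (Icc t₀ T) a.2,
                iteratedDerivWithin 1 u (Icc t₀ T) a.2]))))
      =O[stepFilter (Icc t₀ T) Q] fun a => a.1 ^ 4 := by
  obtain ⟨C, ω, hω, H⟩ :=
    exists_expJ_bound hL hδ hu_smooth.continuousOn (hN.of_le (by norm_num))
  obtain ⟨S, hS⟩ := hL
  obtain ⟨u₄, hu₄, graph₃⟩ :=
    hu.exists_deriv_three_mem_jacobian_graph hS hT hu_smooth hδ hN
  have graph₂ : ∀ t ∈ Icc t₀ T, (iteratedDerivWithin 2 u (Icc t₀ T) t,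
      iteratedDerivWithin 3 u (Icc t₀ T) t - iteratedFDeriv ℝ 2 (Ntilde N (u t)) (u t)
        ![iteratedDerivWithin 1 u (Icc t₀ T) t, iteratedDerivWithin 1 u (Icc t₀ T) t])
      ∈ (jacobian L N (u t)).graph := fun t ht => by
    rw [iteratedFDeriv_Ntilde (k := 0) ((contDiffAt_of_strip hδ hN ht).of_le (by norm_num))]
    exact hu.deriv_two_mem_jacobian_graph hS hT (hu_smooth.of_le (by norm_num)) hδ
      (hN.of_le (by norm_num)) ht
  have eventually_of_mem {P : ℝ → Prop} (hP : ∀ t ∈ Icc t₀ T, P t) :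
      ∀ᶠ a in stepFilter (Icc t₀ T) Q, P a.2 :=
    eventually_mem_stepFilter.mono fun a ha => hP a.2 ha.2.2
  have derivative_isBigO {k : ℕ} (hk : k ≤ 4) :=
    isBigO_iteratedDerivWithin (n := 4) (Q := Q) hT hu_smooth hk
  have expansion := M.stage_expansion (uniformFamily_expJ (Q := Q) hω H)
    (A := fun a => jacobian L N (u a.2)) (eventually_of_mem fun t ht => (H t ht).1)
    (derivative_isBigO (by norm_num : 1 ≤ 4)) (derivative_isBigO (by norm_num : 2 ≤ 4))
    (derivative_isBigO (by norm_num : 3 ≤ 4)) (isBigO_one_snd_stepFilter hu₄)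
    (isBigO_iteratedFDeriv_Ntilde (k := 0) hδ hu_smooth.continuousOn (hN.of_le (by norm_num)))
    (eventually_of_mem fun t ht => hu.deriv_one_mem_jacobian_graph hS hT
      (hu_smooth.of_le (by norm_num)) hδ (hN.of_le (by norm_num)) ht)
    (eventually_of_mem graph₂) (eventually_of_mem graph₃)
    (v := fun a => u a.2) (R := fun a => Ntilde N (u a.2))
    (fun _ => Ntilde_taylor_three hδ hu_smooth.continuousOn hN) i
  refine expansion.congr' ?_ EventuallyEq.rfl
  filter_upwards [eventually_mem_stepFilter] with a ⟨_, _, ht⟩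
  rw [Method.Uhat, hu.rhs_eq hT ht]

/-- The derivatives of order `2`, `3`, `4` at `τ = 0` of the residual `τ ↦ Ñ (u (t + τ))` along the
solution. -/
def solutionResidualDeriv (N : X → X) (t₀ T : ℝ) (u : ℝ → X) (t : ℝ) : ℕ → X :=
  residualDeriv (iteratedDerivWithin 1 u (Icc t₀ T) t) (iteratedDerivWithin 2 u (Icc t₀ T) t)
    (iteratedDerivWithin 3 u (Icc t₀ T) t) (iteratedFDeriv ℝ 2 (Ntilde N (u t)) (u t))
    (iteratedFDeriv ℝ 3 (Ntilde N (u t)) (u t)) (iteratedFDeriv ℝ 4 (Ntilde N (u t)) (u t))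

theorem residual_along_solution_isBigO (hT : t₀ < T) (hu : ContDiffOn ℝ 4 u (Icc t₀ T))
    (hδ : 0 < δ) (hN : ContDiffOn ℝ 5 N (strip t₀ T u δ)) :
    (fun a : ℝ × ℝ => Ntilde N (u a.2) (u (a.2 + a.1)) - Ntilde N (u a.2) (u a.2)
      - ∑ k ∈ Finset.Icc 2 4, (a.1 ^ k / (k.factorial : ℝ)) •
          solutionResidualDeriv N t₀ T u a.2 k)
      =O[stepFilter (Icc t₀ T) (admissibleSteps T)] fun a => a.1 ^ 5 := by
  have derivative_isBigO {k : ℕ} (hk : k ≤ 4) :=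
    isBigO_iteratedDerivWithin (n := 4) (Q := admissibleSteps T) hT hu hk
  obtain ⟨C, taylor⟩ := exists_taylor_bound_Icc (n := 3) hT (hu.of_le (by norm_num))
  have expansion := residual_expansion_along hδ hu.continuousOn hN
    (w := fun a => u (a.2 + a.1) - u a.2) (derivative_isBigO (by norm_num : 1 ≤ 4))
    ((derivative_isBigO (by norm_num : 2 ≤ 4)).const_smul_left (1 / 2 : ℝ))
    ((derivative_isBigO (by norm_num : 3 ≤ 4)).const_smul_left (1 / 6 : ℝ))
    (isBigO_stepFilter_iff.2 ⟨C, 1, one_pos, fun t ht h h_pos _ hth => by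
      convert taylor t ht h h_pos.le hth using 2
      simp only [Pi.smul_apply, Finset.sum_range_succ, Finset.sum_range_zero, Nat.factorial,
        iteratedDerivWithin_zero]
      push_cast
      module⟩)
  simpa only [Pi.smul_apply, add_sub_cancel, incrementPolynomial_eq_sum_residualDeriv,
    solutionResidualDeriv] using expansion

theorem IsSolution.step_expansion (hL : ∃ S : ℝ → X →L[ℝ] X, IsGenerator L S) (hT : t₀ < T)
    (hu : IsSolution L N t₀ T u₀ u) (hu_smooth : ContDiffOn ℝ 4 u (Icc t₀ T)) (hδ : 0 < δ)
    (hN : ContDiffOn ℝ 5 N (strip t₀ T u δ)) :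
    (fun a : ℝ × ℝ => u (a.2 + a.1) - u a.2
      - (a.1 • phi (Method.expJ L N u a.2) 1 a.1 (rhs L N (u a.2))
        + ∑ k ∈ Finset.Icc 2 4, a.1 ^ (k + 1) •
            phi (Method.expJ L N u a.2) (k + 1) a.1 (solutionResidualDeriv N t₀ T u a.2 k)))
      =O[stepFilter (Icc t₀ T) (admissibleSteps T)] fun a => a.1 ^ 6 := by
  have hN₁ : ContDiffOn ℝ 1 N (strip t₀ T u δ) := hN.of_le (by norm_num)
  obtain ⟨C, ω, hω, H⟩ := exists_expJ_bound hL hδ hu_smooth.continuousOn hN₁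
  obtain ⟨B, h₀, h₀_pos, residual_le⟩ :=
    isBigO_stepFilter_iff.1 (residual_along_solution_isBigO hT hu_smooth hδ hN)
  refine isBigO_stepFilter_iff.2 ⟨|C| * Real.exp ω * |B|, min h₀ 1, lt_min h₀_pos one_pos,
    fun t ht h h_pos h_le hth => ?_⟩
  have step_le : t + h ≤ T := hth
  rw [hu.sub_eq_smul_phi_one_add_integral hδ hN₁ ht (H t ht).1 h_pos.le step_le,
    add_sub_add_left_eq_sub, ← (H t ht).1.semigroup.integral_sub_sum_pow_smul h_pos.le
      (hu.continuousOn_residual hδ hN₁ ht step_le)]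
  refine norm_integral_convolution_le hω (H t ht).2 h_pos.le (h_le.trans (min_le_right _ _))
    fun τ hτ => residual_le t ht τ hτ.1 (hτ.2.trans (h_le.trans (min_le_left _ _))) ?_
  exact (add_le_add_right hτ.2 t).trans step_le

end OneStep

/-! ### The local error -/

section LocalError

open Asymptotics

variable [CompleteSpace X]

theorem phi_map_add {S : ℝ → X →L[ℝ] X} (hS : IsC0Semigroup S) {τ : ℝ} (hτ : 0 ≤ τ) (k : ℕ)
    (x y : X) : phi S (k + 1) τ (x + y) = phi S (k + 1) τ x + phi S (k + 1) τ y := by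
  simpa only [symOp_phiSym] using symOp_map_add hS hτ (phiSym k) x y

theorem phi_map_smul {S : ℝ → X →L[ℝ] X} (hS : IsC0Semigroup S) {τ : ℝ} (hτ : 0 ≤ τ) (k : ℕ)
    (c : ℝ) (x : X) : phi S (k + 1) τ (c • x) = c • phi S (k + 1) τ x := by
  simpa only [symOp_phiSym] using symOp_map_smul hS hτ (phiSym k) c x

theorem Method.b_map_add (M : Method) {S : ℝ → X →L[ℝ] X} (hS : IsC0Semigroup S) {h : ℝ}
    (hh : 0 ≤ h) (i : ℕ) (x y : X) : M.b S h i (x + y) = M.b S h i x + M.b S h i y := by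
  simpa only [Method.symOp_bSym] using symOp_map_add hS hh (M.bSym i) x y

theorem Method.b_map_smul (M : Method) {S : ℝ → X →L[ℝ] X} (hS : IsC0Semigroup S) {h : ℝ}
    (hh : 0 ≤ h) (i : ℕ) (c : ℝ) (x : X) : M.b S h i (c • x) = c • M.b S h i x := by
  simpa only [Method.symOp_bSym] using symOp_map_smul hS hh (M.bSym i) c x

theorem Method.smul_b_incrementPolynomial (M : Method) {S : ℝ → X →L[ℝ] X} (hS : IsC0Semigroup S)
    {h : ℝ} (hh : 0 ≤ h) (i : ℕ) (u₁ u₂ u₃ y : X) (D₂ : X [×2]→L[ℝ] X) (D₃ : X [×3]→L[ℝ] X)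
    (D₄ : X [×4]→L[ℝ] X) :
    h • M.b S h i (incrementPolynomial h ((M.α i 1 * M.P i 1) • u₁)
        ((M.α i 1 * M.g i 1 * M.P i 2) • u₂) ((M.α i 1 * M.g i 1 ^ 2 * M.P i 3) • u₃ + y) D₂ D₃ D₄)
      = h ^ 3 • (M.α i 1 ^ 2 * M.P i 1 ^ 2 / 2) • M.b S h i (D₂ ![u₁, u₁])
        + h ^ 4 • (M.α i 1 ^ 2 * M.g i 1 * M.P i 1 * M.P i 2) • M.b S h i (D₂ ![u₁, u₂])
        + h ^ 4 • (M.α i 1 ^ 3 * M.P i 1 ^ 3 / 6) • M.b S h i (D₃ ![u₁, u₁, u₁])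
        + h ^ 5 • (M.α i 1 ^ 2 * M.g i 1 ^ 2 * M.P i 1 * M.P i 3) • M.b S h i (D₂ ![u₁, u₃])
        + h ^ 5 • (M.α i 1 ^ 2 * M.g i 1 ^ 2 * M.P i 2 ^ 2 / 2) • M.b S h i (D₂ ![u₂, u₂])
        + h ^ 5 • (M.α i 1 ^ 3 * M.g i 1 * M.P i 1 ^ 2 * M.P i 2 / 2) •
            M.b S h i (D₃ ![u₁, u₁, u₂])
        + h ^ 5 • (M.α i 1 ^ 4 * M.P i 1 ^ 4 / 24) • M.b S h i (D₄ ![u₁, u₁, u₁, u₁])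
        + h ^ 5 • (M.α i 1 * M.P i 1) • M.b S h i (D₂ ![u₁, y]) := by
  simp only [incrementPolynomial, map_two_smul_left, map_two_smul_right, map_two_add_right,
    map_three_smul_fst, map_three_smul_snd, map_three_smul_trd, map_four_smul_diag,
    M.b_map_add hS hh, M.b_map_smul hS hh]
  module

theorem Method.localErrorPrincipal_eq (M : Method) {S : ℝ → X →L[ℝ] X} (hS : IsC0Semigroup S)
    {h : ℝ} (hh : 0 ≤ h) (F u₁ u₂ u₃ : X) (D₂ : X [×2]→L[ℝ] X) (D₃ : X [×3]→L[ℝ] X)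
    (D₄ : X [×4]→L[ℝ] X) :
    M.localErrorPrincipal S h F u₁ u₂ u₃ D₂ D₃ D₄
      = (M.β 1 * h) • M.psi S h (M.s + 1) 1 F
        + h • ∑ i ∈ Finset.Icc 2 M.s, M.b S h i
            (incrementPolynomial h ((M.α i 1 * M.P i 1) • u₁)
              ((M.α i 1 * M.g i 1 * M.P i 2) • u₂)
              ((M.α i 1 * M.g i 1 ^ 2 * M.P i 3) • u₃ + M.Psi S h i (D₂ ![u₁, u₁])) D₂ D₃ D₄)
        - (h • phi S 1 h F + ∑ k ∈ Finset.Icc 2 4,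
            h ^ (k + 1) • phi S (k + 1) h (residualDeriv u₁ u₂ u₃ D₂ D₃ D₄ k)) := by
  rw [Finset.smul_sum]
  simp only [Method.localErrorPrincipal, M.smul_b_incrementPolynomial hS hh, residualDeriv,
    sum_Icc_two_four, Nat.reduceAdd, phi_map_add hS hh, phi_map_smul hS hh,
    Finset.sum_add_distrib, ← Finset.smul_sum]
  module

variable {L : X →ₗ.[ℝ] X} {N : X → X} {t₀ T : ℝ} {u₀ : X} {u : ℝ → X} {δ : ℝ}

theorem Method.rhat_expansion (M : Method) (hL : ∃ S : ℝ → X →L[ℝ] X, IsGenerator L S)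
    (hT : t₀ < T) (hu : IsSolution L N t₀ T u₀ u) (hu_smooth : ContDiffOn ℝ 4 u (Icc t₀ T))
    (hδ : 0 < δ) (hN : ContDiffOn ℝ 5 N (strip t₀ T u δ)) {Q : Set (ℝ × ℝ)} (i : ℕ) :
    (fun a : ℝ × ℝ => M.rhat L N u a.2 a.1 i
      - incrementPolynomial a.1 ((M.α i 1 * M.P i 1) • iteratedDerivWithin 1 u (Icc t₀ T) a.2)
        ((M.α i 1 * M.g i 1 * M.P i 2) • iteratedDerivWithin 2 u (Icc t₀ T) a.2)
        ((M.α i 1 * M.g i 1 ^ 2 * M.P i 3) • iteratedDerivWithin 3 u (Icc t₀ T) a.2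
          + M.Psi (Method.expJ L N u a.2) a.1 i
            (iteratedFDeriv ℝ 2 (Ntilde N (u a.2)) (u a.2)
              ![iteratedDerivWithin 1 u (Icc t₀ T) a.2, iteratedDerivWithin 1 u (Icc t₀ T) a.2]))
        (iteratedFDeriv ℝ 2 (Ntilde N (u a.2)) (u a.2))
        (iteratedFDeriv ℝ 3 (Ntilde N (u a.2)) (u a.2))
        (iteratedFDeriv ℝ 4 (Ntilde N (u a.2)) (u a.2)))
      =O[stepFilter (Icc t₀ T) Q] fun a => a.1 ^ 5 := by
  obtain ⟨C, ω, hω, H⟩ := exists_expJ_bound hL hδ hu_smooth.continuousOn (hN.of_le (by norm_num))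
  have derivative_isBigO {k : ℕ} (hk : k ≤ 4) :=
    isBigO_iteratedDerivWithin (n := 4) (Q := Q) hT hu_smooth hk
  have hu₁ := derivative_isBigO (by norm_num : 1 ≤ 4)
  have second := isBigO_one_map_two (isBigO_iteratedFDeriv_Ntilde (Q := Q) (k := 0) hδ
    hu_smooth.continuousOn (hN.of_le (by norm_num))) hu₁ hu₁
  have hPsi := (uniformFamily_expJ (Q := Q) hω H).symOp_isBigO (M.PsiSym i) second
  simp only [Method.symOp_PsiSym] at hPsi
  have expansion := residual_expansion_along hδ hu_smooth.continuousOn hN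
    (hu₁.const_smul_left (M.α i 1 * M.P i 1))
    ((derivative_isBigO (by norm_num : 2 ≤ 4)).const_smul_left (M.α i 1 * M.g i 1 * M.P i 2))
    (((derivative_isBigO (by norm_num : 3 ≤ 4)).const_smul_left
      (M.α i 1 * M.g i 1 ^ 2 * M.P i 3)).add hPsi)
    (M.Uhat_expansion hL hT hu hu_smooth hδ (hN.of_le (by norm_num)) i)
  simp only [Pi.smul_apply, add_sub_cancel] at expansion
  exact expansion

theorem Method.localError_expansion (M : Method) (hL : ∃ S : ℝ → X →L[ℝ] X, IsGenerator L S)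
    (hT : t₀ < T) (hu : IsSolution L N t₀ T u₀ u) (hu_smooth : ContDiffOn ℝ 4 u (Icc t₀ T))
    (hδ : 0 < δ) (hN : ContDiffOn ℝ 5 N (strip t₀ T u δ)) :
    (fun a : ℝ × ℝ => M.localError L N u a.2 a.1
      - M.localErrorPrincipal (Method.expJ L N u a.2) a.1 (rhs L N (u a.2))
        (iteratedDerivWithin 1 u (Icc t₀ T) a.2) (iteratedDerivWithin 2 u (Icc t₀ T) a.2)
        (iteratedDerivWithin 3 u (Icc t₀ T) a.2) (iteratedFDeriv ℝ 2 (Ntilde N (u a.2)) (u a.2))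
        (iteratedFDeriv ℝ 3 (Ntilde N (u a.2)) (u a.2))
        (iteratedFDeriv ℝ 4 (Ntilde N (u a.2)) (u a.2)))
      =O[stepFilter (Icc t₀ T) (admissibleSteps T)] fun a => a.1 ^ 6 := by
  obtain ⟨C, ω, hω, H⟩ := exists_expJ_bound hL hδ hu_smooth.continuousOn (hN.of_le (by norm_num))
  have family := uniformFamily_expJ (Q := admissibleSteps T) hω H
  have update := isBigO_pow_smul 1 <| IsBigO.fun_sum (s := Finset.Icc 2 M.s) fun i _ =>
    family.symOp_isBigO (M.bSym i) (M.rhat_expansion hL hT hu hu_smooth hδ hN i)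
  refine (update.sub (hu.step_expansion hL hT hu_smooth hδ hN)).congr' ?_ EventuallyEq.rfl
  filter_upwards [eventually_mem_stepFilter] with a ⟨h_pos, _, ht⟩
  have hS := (H a.2 ht).1.semigroup
  simp only [symOp_map_sub hS h_pos.le, Method.symOp_bSym, pow_one, Finset.sum_sub_distrib,
    M.localErrorPrincipal_eq hS h_pos.le, Method.localError, Method.uhatNext,
    solutionResidualDeriv, smul_sub]
  abel

end LocalError

/-! ### The stiff order conditions -/

section OrderConditions

open Asymptotics

variable {α : Type*} {l : Filter α} {h : α → ℝ} {S : α → ℝ → X →L[ℝ] X} {M : Method}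

theorem isBigO_pow_smul_of_eventually_eq_zero (hh : h =O[l] fun _ => (1 : ℝ)) {f : α → X}
    (hf : f =O[l] fun _ => (1 : ℝ)) {m n : ℕ} (h_zero : m < n → ∀ᶠ a in l, f a = 0) :
    (fun a => h a ^ m • f a) =O[l] fun a => h a ^ n := by
  rcases lt_or_ge m n with hlt | hle
  · exact (isBigO_zero (fun a => h a ^ n) l).congr'
      ((h_zero hlt).mono fun a ha => by simp only [ha, smul_zero]) EventuallyEq.rfl
  · exact isBigO_pow_smul_of_bounded hh hf hle

theorem Method.QuadratureCondition.const_mul {c c' : ℕ → ℝ} {d d' : ℝ} {k : ℕ}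
    (H : M.QuadratureCondition c d k) (r : ℝ) (hc : ∀ i, c' i = r * c i) (hd : d' = r * d) :
    M.QuadratureCondition c' d' k := fun m Z x => by
  simp only [hc, hd, mul_smul, ← Finset.smul_sum, H m Z x]

variable [CompleteSpace X]

theorem UniformFamily.quadrature_isBigO (H : UniformFamily l h S) {x : α → X}
    (hx : x =O[l] fun _ => (1 : ℝ)) {c : ℕ → ℝ} {d : ℝ} {k m n : ℕ}
    (hq : m < n → M.QuadratureCondition c d (k + 1)) :
    (fun a => h a ^ m • (∑ i ∈ Finset.Icc 2 M.s, c i • M.b (S a) (h a) i (x a)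
      - d • phi (S a) (k + 1) (h a) (x a))) =O[l] fun a => h a ^ n := by
  have update (i : ℕ) := H.symOp_isBigO (M.bSym i) hx
  have flow := H.symOp_isBigO (phiSym k) hx
  simp only [Method.symOp_bSym, symOp_phiSym] at update flow
  refine isBigO_pow_smul_of_eventually_eq_zero H.step_isBigO
    ((IsBigO.fun_sum fun i _ => (update i).const_smul_left (c i)).sub (flow.const_smul_left d))
    fun hlt => ?_
  filter_upwards [H.pos, H.semigroup] with a h_pos hS
  simp only [Pi.smul_apply]
  rw [(hq hlt).apply hS h_pos.le, sub_self]

theorem UniformFamily.C0_isBigO (H : UniformFamily l h S) (hC : M.C0) (x : α → X) (n : ℕ) :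
    (fun a => h a • (M.β 1 • M.psi (S a) (h a) (M.s + 1) 1 (x a) - phi (S a) 1 (h a) (x a)))
      =O[l] fun a => h a ^ n := by
  refine (isBigO_zero (fun a => h a ^ n) l).congr' ?_ EventuallyEq.rfl
  filter_upwards [H.pos, H.semigroup] with a h_pos hS
  rw [hC.apply hS h_pos.le, sub_self, smul_zero]

theorem UniformFamily.C8_isBigO (H : UniformFamily l h S) {D : α → X [×2]→L[ℝ] X}
    (hD : D =O[l] fun _ => (1 : ℝ)) {x y : α → X} (hx : x =O[l] fun _ => (1 : ℝ))
    (hy : y =O[l] fun _ => (1 : ℝ)) {m n : ℕ} (hC : m < n → M.C8) :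
    (fun a => h a ^ m • ∑ i ∈ Finset.Icc 2 M.s,
      (M.α i 1 * M.P i 1) • M.b (S a) (h a) i (D a ![x a, M.Psi (S a) (h a) i (y a)]))
      =O[l] fun a => h a ^ n := by
  have stage (i : ℕ) := H.symOp_isBigO (M.PsiSym i) hy
  have update (i : ℕ) := H.symOp_isBigO (M.bSym i) (isBigO_one_map_two hD hx (stage i))
  simp only [Method.symOp_bSym, Method.symOp_PsiSym] at update
  refine isBigO_pow_smul_of_eventually_eq_zero H.step_isBigO
    (IsBigO.fun_sum fun i _ => (update i).const_smul_left (M.α i 1 * M.P i 1)) fun hlt => ?_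
  filter_upwards [H.pos, H.semigroup] with a h_pos hS
  -- (C8) is applied with `Q = D(x, ·)`.
  have curried (z : X) : (D a).toContinuousLinearMap ![x a, 0] 1 z = D a ![x a, z] := by
    exact congrArg (D a) (by ext j; fin_cases j <;> rfl)
  simpa only [curried, Pi.smul_apply] using
    (hC hlt).apply hS h_pos.le ((D a).toContinuousLinearMap ![x a, 0] 1) (y a)

theorem Method.StiffOrder.principal_isBigO {q : ℕ} (hq : M.StiffOrder q) (hq₂ : 2 ≤ q)
    (hq₅ : q ≤ 5) (H : UniformFamily l h S) (F : α → X) {u₁ u₂ u₃ : α → X}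
    {D₂ : α → X [×2]→L[ℝ] X} {D₃ : α → X [×3]→L[ℝ] X} {D₄ : α → X [×4]→L[ℝ] X}
    (hu₁ : u₁ =O[l] fun _ => (1 : ℝ)) (hu₂ : u₂ =O[l] fun _ => (1 : ℝ))
    (hu₃ : u₃ =O[l] fun _ => (1 : ℝ)) (hD₂ : D₂ =O[l] fun _ => (1 : ℝ))
    (hD₃ : D₃ =O[l] fun _ => (1 : ℝ)) (hD₄ : D₄ =O[l] fun _ => (1 : ℝ)) :
    (fun a => M.localErrorPrincipal (S a) (h a) (F a) (u₁ a) (u₂ a) (u₃ a) (D₂ a) (D₃ a) (D₄ a))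
      =O[l] fun a => h a ^ (q + 1) := by
  obtain ⟨hC0, hC1, hC23, hC48⟩ := hq
  have d₁₁ := isBigO_one_map_two hD₂ hu₁ hu₁
  have d₁₁₁₁ : (fun a => D₄ a ![u₁ a, u₁ a, u₁ a, u₁ a]) =O[l] fun _ => (1 : ℝ) := by
    simpa only [map_const_four] using isBigO_one_multilinear hD₄ fun _ => hu₁
  have term₁₁ := H.quadrature_isBigO d₁₁ (m := 3) (n := q + 1) fun hlt =>
    (hC1 (by lia)).const_mul (1 / 2) (c' := fun i => M.α i 1 ^ 2 * M.P i 1 ^ 2 / 2) (d' := 1)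
      (fun i => by ring) (by norm_num)
  have term₁₂ := H.quadrature_isBigO (isBigO_one_map_two hD₂ hu₁ hu₂) (m := 4) (n := q + 1)
    fun hlt => (hC23 (by lia)).1
  have term₁₁₁ := H.quadrature_isBigO (isBigO_one_map_three hD₃ hu₁ hu₁ hu₁) (m := 4)
    (n := q + 1) fun hlt => (hC23 (by lia)).2.const_mul (1 / 6)
      (c' := fun i => M.α i 1 ^ 3 * M.P i 1 ^ 3 / 6) (d' := 1) (fun i => by ring) (by norm_num)
  have term₁₃ := H.quadrature_isBigO (isBigO_one_map_two hD₂ hu₁ hu₃) (m := 5) (n := q + 1)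
    fun hlt => (hC48 (by lia)).1
  have term₂₂ := H.quadrature_isBigO (isBigO_one_map_two hD₂ hu₂ hu₂) (m := 5) (n := q + 1)
    fun hlt => (hC48 (by lia)).2.1.const_mul (1 / 2)
      (c' := fun i => M.α i 1 ^ 2 * M.g i 1 ^ 2 * M.P i 2 ^ 2 / 2) (d' := 3)
      (fun i => by ring) (by norm_num)
  have term₁₁₂ := H.quadrature_isBigO (isBigO_one_map_three hD₃ hu₁ hu₁ hu₂) (m := 5)
    (n := q + 1) fun hlt => (hC48 (by lia)).2.2.1.const_mul (1 / 2)
      (c' := fun i => M.α i 1 ^ 3 * M.g i 1 * M.P i 1 ^ 2 * M.P i 2 / 2) (d' := 6)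
      (fun i => by ring) (by norm_num)
  have term₁₁₁₁ := H.quadrature_isBigO d₁₁₁₁ (m := 5) (n := q + 1) fun hlt =>
    (hC48 (by lia)).2.2.2.1.const_mul (1 / 24)
      (c' := fun i => M.α i 1 ^ 4 * M.P i 1 ^ 4 / 24) (d' := 1) (fun i => by ring) (by norm_num)
  have coupled := H.C8_isBigO hD₂ hu₁ d₁₁ (m := 5) (n := q + 1)
    fun hlt => (hC48 (by lia)).2.2.2.2
  simpa only [Method.localErrorPrincipal, one_smul] using
    ((((((((H.C0_isBigO hC0 F (q + 1)).add term₁₁).add term₁₂).add term₁₁₁).add term₁₃).add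
      term₂₂).add term₁₁₂).add term₁₁₁₁).add coupled

end OrderConditions

section Conclusion

open Asymptotics

variable [CompleteSpace X] {L : X →ₗ.[ℝ] X} {N : X → X} {t₀ T : ℝ} {u₀ : X} {u : ℝ → X} {δ : ℝ}

theorem Method.V_expansion (M : Method) (hL : ∃ S : ℝ → X →L[ℝ] X, IsGenerator L S)
    (hT : t₀ < T) (hu : IsSolution L N t₀ T u₀ u) (hu_smooth : ContDiffOn ℝ 4 u (Icc t₀ T))
    (hδ : 0 < δ) (hN : ContDiffOn ℝ 3 N (strip t₀ T u δ)) {Q : Set (ℝ × ℝ)} (i : ℕ) :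
    (fun a : ℝ × ℝ => M.V L N u a.2 a.1 i -
        ((M.α i 1 * M.P i 1) • iteratedDerivWithin 1 u (Icc t₀ T) a.2
          + (a.1 * (M.α i 1 * M.g i 1 * M.P i 2)) • iteratedDerivWithin 2 u (Icc t₀ T) a.2
          + (a.1 ^ 2 * (M.α i 1 * M.g i 1 ^ 2 * M.P i 3)) •
              iteratedDerivWithin 3 u (Icc t₀ T) a.2
          + a.1 ^ 2 • M.Psi (Method.expJ L N u a.2) a.1 i
              (iteratedFDeriv ℝ 2 (Ntilde N (u a.2)) (u a.2)
                ![iteratedDerivWithin 1 u (Icc t₀ T) a.2,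
                  iteratedDerivWithin 1 u (Icc t₀ T) a.2])))
      =O[stepFilter (Icc t₀ T) Q] fun a => a.1 ^ 3 := by
  refine isBigO_pow_of_isBigO_smul (eventually_mem_stepFilter.mono fun a ha => ha.1)
    ((M.Uhat_expansion hL hT hu hu_smooth hδ hN i).congr' ?_ EventuallyEq.rfl)
  filter_upwards [eventually_mem_stepFilter] with a ⟨h_pos, _, _⟩
  rw [Method.V, smul_sub, smul_inv_smul₀ h_pos.ne']
  module

theorem Method.StiffOrder.localError_isBigO {M : Method} {q : ℕ} (hq : M.StiffOrder q)
    (hq₂ : 2 ≤ q) (hq₅ : q ≤ 5) (hL : ∃ S : ℝ → X →L[ℝ] X, IsGenerator L S)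
    (hT : t₀ < T) (hu : IsSolution L N t₀ T u₀ u) (hu_smooth : ContDiffOn ℝ 4 u (Icc t₀ T))
    (hδ : 0 < δ) (hN : ContDiffOn ℝ 5 N (strip t₀ T u δ)) :
    (fun a : ℝ × ℝ => M.localError L N u a.2 a.1)
      =O[stepFilter (Icc t₀ T) (admissibleSteps T)] fun a => a.1 ^ (q + 1) := by
  obtain ⟨C, ω, hω, H⟩ := exists_expJ_bound hL hδ hu_smooth.continuousOn (hN.of_le (by norm_num))
  have family := uniformFamily_expJ (Q := admissibleSteps T) hω H
  have derivative {k : ℕ} (hk : k ≤ 4) :=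
    isBigO_iteratedDerivWithin (n := 4) (Q := admissibleSteps T) hT hu_smooth hk
  have residual {k : ℕ} (hk : k + 2 ≤ 4) :=
    isBigO_iteratedFDeriv_Ntilde (Q := admissibleSteps T) (k := k) hδ hu_smooth.continuousOn
      (hN.of_le (by exact_mod_cast (by lia : k + 2 ≤ 5)))
  have principal := hq.principal_isBigO hq₂ hq₅ family (fun a => rhs L N (u a.2))
    (derivative (by norm_num : 1 ≤ 4)) (derivative (by norm_num : 2 ≤ 4))
    (derivative (by norm_num : 3 ≤ 4)) (residual (by norm_num : 0 + 2 ≤ 4))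
    (residual (by norm_num : 1 + 2 ≤ 4)) (residual (by norm_num : 2 + 2 ≤ 4))
  have remainder := (M.localError_expansion hL hT hu hu_smooth hδ hN).trans
    (isBigO_pow_of_le family.step_isBigO (by lia : q + 1 ≤ 6))
  exact (remainder.add principal).congr_left fun a => sub_add_cancel _ _

end Conclusion

end StiffEPIRK

end

open StiffEPIRK in
theorem mainTheorem5_general {X : Type*} [NormedAddCommGroup X] [NormedSpace ℝ X]
    [CompleteSpace X]
    (M : Method) (L : X →ₗ.[ℝ] X) (hL : ∃ S : ℝ → X →L[ℝ] X, IsGenerator L S)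
    (N : X → X) (t₀ T : ℝ) (hT : t₀ < T) (u₀ : X) (u : ℝ → X)
    (hu : IsSolution L N t₀ T u₀ u) (hu_smooth : ContDiffOn ℝ 4 u (Icc t₀ T))
    (δ : ℝ) (hδ : 0 < δ) (hN_smooth : ContDiffOn ℝ 3 N (strip t₀ T u δ)) :
    (∀ t ∈ Icc t₀ T, IsGenerator (jacobian L N (u t)) (Method.expJ L N u t)) ∧
    (∃ C h₀ : ℝ, 0 < h₀ ∧ ∀ t ∈ Icc t₀ T, ∀ h : ℝ, 0 < h → h ≤ h₀ →
      ∀ i ∈ Finset.Icc 2 M.s,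
        ‖M.V L N u t h i -
          ((M.α i 1 * M.P i 1) • iteratedDerivWithin 1 u (Icc t₀ T) t
            + (h * (M.α i 1 * M.g i 1 * M.P i 2)) • iteratedDerivWithin 2 u (Icc t₀ T) t
            + (h ^ 2 * (M.α i 1 * M.g i 1 ^ 2 * M.P i 3)) •
                iteratedDerivWithin 3 u (Icc t₀ T) t
            + h ^ 2 • M.Psi (Method.expJ L N u t) h i
                (iteratedFDeriv ℝ 2 (Ntilde N (u t)) (u t)
                  ![iteratedDerivWithin 1 u (Icc t₀ T) t,
                    iteratedDerivWithin 1 u (Icc t₀ T) t]))‖ ≤ C * h ^ 3) ∧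
    (ContDiffOn ℝ 5 N (strip t₀ T u δ) →
      (∃ C h₀ : ℝ, 0 < h₀ ∧ ∀ t ∈ Icc t₀ T, ∀ h : ℝ, 0 < h → h ≤ h₀ → t + h ≤ T →
        ‖M.localError L N u t h -
          M.localErrorPrincipal (Method.expJ L N u t) h (rhs L N (u t))
            (iteratedDerivWithin 1 u (Icc t₀ T) t)
            (iteratedDerivWithin 2 u (Icc t₀ T) t)
            (iteratedDerivWithin 3 u (Icc t₀ T) t)
            (iteratedFDeriv ℝ 2 (Ntilde N (u t)) (u t))
            (iteratedFDeriv ℝ 3 (Ntilde N (u t)) (u t))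
            (iteratedFDeriv ℝ 4 (Ntilde N (u t)) (u t))‖ ≤ C * h ^ 6) ∧
      (∀ q ∈ Finset.Icc 2 5, M.StiffOrder q →
        ∃ C h₀ : ℝ, 0 < h₀ ∧ ∀ t ∈ Icc t₀ T, ∀ h : ℝ, 0 < h → h ≤ h₀ → t + h ≤ T →
          ‖M.localError L N u t h‖ ≤ C * h ^ (q + 1))) := by
  obtain ⟨_, _, _, H⟩ := exists_expJ_bound hL hδ hu_smooth.continuousOn
    (hN_smooth.of_le (by norm_num))
  refine ⟨fun t ht => (H t ht).1, ?_, fun hN => ⟨?_, fun q hq horder => ?_⟩⟩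
  · exact exists_bound_of_forall_isBigO_stepFilter fun i _ =>
      M.V_expansion hL hT hu hu_smooth hδ hN_smooth i
  · exact isBigO_stepFilter_iff.1 (M.localError_expansion hL hT hu hu_smooth hδ hN)
  · obtain ⟨hq₂, hq₅⟩ := Finset.mem_Icc.1 hq
    exact isBigO_stepFilter_iff.1
      (horder.localError_isBigO hq₂ hq₅ hL hT hu hu_smooth hδ hN)

open StiffEPIRK in
theorem mainTheorem5 {X : Type*} [NormedAddCommGroup X] [NormedSpace ℝ X] [CompleteSpace X]
    (M : Method) (L : X →ₗ.[ℝ] X) (hL : ∃ S : ℝ → X →L[ℝ] X, IsGenerator L S)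
    (N : X → X) (t₀ T : ℝ) (hT : t₀ < T) (u₀ : X) (u : ℝ → X)
    (hu : IsSolution L N t₀ T u₀ u) (hu_smooth : ContDiffOn ℝ 4 u (Set.Icc t₀ T))
    (δ : ℝ) (hδ : 0 < δ) (hN_smooth : ContDiffOn ℝ 3 N (strip t₀ T u δ)) :
    -- every Jacobian along the solution generates a strongly continuous semigroup
    (∀ t ∈ Set.Icc t₀ T,
      IsGenerator (jacobian L N (u t)) (Method.expJ L N u t)) ∧
    -- the expansion of the normalized stage increments
    (∃ C h₀ : ℝ, 0 < h₀ ∧ ∀ t ∈ Set.Icc t₀ T, ∀ h : ℝ, 0 < h → h ≤ h₀ →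
      ∀ i ∈ Finset.Icc 2 M.s,
        ‖M.V L N u t h i -
          ((M.α i 1 * M.P i 1) • iteratedDerivWithin 1 u (Set.Icc t₀ T) t
            + (h * (M.α i 1 * M.g i 1 * M.P i 2)) • iteratedDerivWithin 2 u (Set.Icc t₀ T) t
            + (h ^ 2 * (M.α i 1 * M.g i 1 ^ 2 * M.P i 3)) •
                iteratedDerivWithin 3 u (Set.Icc t₀ T) t
            + h ^ 2 • M.Psi (Method.expJ L N u t) h i
                (iteratedFDeriv ℝ 2 (Ntilde N (u t)) (u t)
                  ![iteratedDerivWithin 1 u (Set.Icc t₀ T) t,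
                    iteratedDerivWithin 1 u (Set.Icc t₀ T) t]))‖ ≤ C * h ^ 3) ∧
    -- the local error formula and the stiff order conditions
    (ContDiffOn ℝ 5 u (Set.Icc t₀ T) → ContDiffOn ℝ 5 N (strip t₀ T u δ) →
      (∃ C h₀ : ℝ, 0 < h₀ ∧ ∀ t ∈ Set.Icc t₀ T, ∀ h : ℝ, 0 < h → h ≤ h₀ → t + h ≤ T →
        ‖M.localError L N u t h -
          M.localErrorPrincipal (Method.expJ L N u t) h (rhs L N (u t))
            (iteratedDerivWithin 1 u (Set.Icc t₀ T) t)
            (iteratedDerivWithin 2 u (Set.Icc t₀ T) t)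
            (iteratedDerivWithin 3 u (Set.Icc t₀ T) t)
            (iteratedFDeriv ℝ 2 (Ntilde N (u t)) (u t))
            (iteratedFDeriv ℝ 3 (Ntilde N (u t)) (u t))
            (iteratedFDeriv ℝ 4 (Ntilde N (u t)) (u t))‖ ≤ C * h ^ 6) ∧
      (∀ q ∈ Finset.Icc 2 5, M.StiffOrder q →
        ∃ C h₀ : ℝ, 0 < h₀ ∧ ∀ t ∈ Set.Icc t₀ T, ∀ h : ℝ, 0 < h → h ≤ h₀ → t + h ≤ T →
          ‖M.localError L N u t h‖ ≤ C * h ^ (q + 1))) :=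
  have general := mainTheorem5_general M L hL N t₀ T hT u₀ u hu hu_smooth δ hδ hN_smooth
  ⟨general.1, general.2.1, fun _ => general.2.2⟩
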